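/- Let $r>0$ and, for an integer $n\ge 2$, let $P_n\subset\mathbb{C}$ be the solid regular $2n$-gon of circumradius $r$. Let $S_n$ be the quotient of $P_n$ obtained by identifying each pair of opposite sides by the translation that carries one to the other, and suppose that all vertices of $P_n$ are identified to a single point $p\in S_n$. A *flat chart* of $S_n$ is a homeomorphism from an open subset of $S_n$ to an open subset of $\mathbb{C}$ which, composed with the projection $P_n\to S_n$, is locally a translation; a *cone point* is a point of $S_n$ that lies in the domain of no flat chart. For $u\in\mathbb{C}\setminus\{0\}$, a *complete straight line of direction $u$* is the image of a continuous map $\gamma$ from a closed interval (bounded, a half line, or $\mathbb{R}$) of positive length to $S_n$ which in flat charts has the form $t\mapsto a+tu$ at each interior parameter, and which sends the endpoints of the interval, if there are any, to cone points. Given a family of subsets (leaves) of a surface, a point is *regular* if it has an open neighbourhood, homeomorphic to an open rectangle, in which each point lies on exactly one leaf and in which the connected components of each leaf are exactly the horizontal slices that it meets; otherwise it is *singular*. Then $S_n$ is a compact connected orientable surface without boundary, whose genus $g$, determined by $V-E+F=2-2g$ for the cell structure coming from $P_n$, satisfies $g\ge 1$; its only cone point is $p$ if $g>1$, and it has no cone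 point if $g=1$. For every direction $u\ne 0$ the complete straight lines of direction $u$ cover $S_n$ and are the leaves of a foliation in the following sense: if $g>1$, the point $p$ is the one and only singular point, and at least two distinct leaves intersect at $p$; if $g=1$, there is no singular point. Moreover every genus $g\ge 1$ occurs: for $n=2g$ all vertices of $P_n$ are identified and $V-E+F=2-2g$. -/

import Mathlib

open Set Filter Topology
open scoped Complex ContDiff

noncomputable section

namespace PolygonSurface

/-- The `k`-th vertex (indices are read modulo `2n`) of the regular `2n`-gon of circumradius `r`. -/
def vertex (n : ℕ) (r : ℝ) (k : ℕ) : ℂ :=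
  (r : ℂ) * Complex.exp (Real.pi * k / n * Complex.I)

/-- The solid regular `2n`-gon of circumradius `r`, centred at the origin of the plane `ℂ`. -/
def polygon (n : ℕ) (r : ℝ) : Set ℂ :=
  convexHull ℝ (range (vertex n r))

/-- The `k`-th side of the polygon. The side opposite to it is the one of index `k + n`. -/
def side (n : ℕ) (r : ℝ) (k : ℕ) : Set ℂ :=
  segment ℝ (vertex n r k) (vertex n r (k + 1))

/-- The identification of opposite sides: a point `z` of the side `k` is glued to its image under
the translation that carries the side `k` to the opposite side `k + n`; it sends the vertex `k` to
the vertex `k + n + 1` and the vertex `k + 1` to the vertex `k + n`. -/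
def Glue (n : ℕ) (r : ℝ) (z w : polygon n r) : Prop :=
  ∃ k : ℕ, (z : ℂ) ∈ side n r k ∧ (w : ℂ) = z + (vertex n r (k + n + 1) - vertex n r k)

/-- The surface obtained from the regular `2n`-gon by identifying opposite sides by translations,
with the quotient topology (the quotient is by the equivalence relation generated by `Glue`). -/
abbrev Surface (n : ℕ) (r : ℝ) : Type :=
  Quot (Glue n r)

/-- The projection of the polygon to the surface. -/
def proj (n : ℕ) (r : ℝ) (z : polygon n r) : Surface n r :=
  Quot.mk (Glue n r) z

/-- The point of the surface represented by the `k`-th vertex of the polygon. -/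
def vertexPoint (n : ℕ) (r : ℝ) (k : ℕ) : Surface n r :=
  proj n r ⟨vertex n r k, subset_convexHull ℝ _ (mem_range_self k)⟩

/-- The image of the `k`-th side in the surface. -/
def edge (n : ℕ) (r : ℝ) (k : ℕ) : Set (Surface n r) :=
  proj n r '' {z | (z : ℂ) ∈ side n r k}

/-- All vertices of the polygon are identified to one point. -/
def OneVertex (n : ℕ) (r : ℝ) : Prop :=
  ∀ k : ℕ, vertexPoint n r k = vertexPoint n r 0

/-- Euler characteristic of the cell structure induced by the polygon: number of vertices
minus number of edges plus one face. -/
def eulerChar (n : ℕ) (r : ℝ) : ℤ :=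
  (range (vertexPoint n r)).ncard - (range (edge n r)).ncard + 1

/-- A compact connected orientable surface without boundary: a compact connected Hausdorff space
with a smooth atlas modelled on the plane whose transition maps have positive Jacobian. -/
structure IsClosedOrientableSurface (S : Type*) [TopologicalSpace S] : Prop where
  t2 : T2Space S
  compact : CompactSpace S
  connected : ConnectedSpace S
  oriented_atlas : ∃ A : Set (OpenPartialHomeomorph S ℂ),
    (∀ x : S, ∃ φ ∈ A, x ∈ φ.source) ∧
    ∀ φ ∈ A, ∀ ψ ∈ A,
      ContDiffOn ℝ ∞ (ψ ∘ φ.symm) (φ.symm.trans ψ).source ∧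
      ∀ z ∈ (φ.symm.trans ψ).source, 0 < (fderiv ℝ (ψ ∘ φ.symm) z).det

/-- The charts of the flat structure: charts of the surface which, read in the polygon, are
translations near every point of the polygon that represents a point of their domain. -/
def IsFlatChart (n : ℕ) (r : ℝ) (φ : OpenPartialHomeomorph (Surface n r) ℂ) : Prop :=
  ∀ z : polygon n r, proj n r z ∈ φ.source →
    ∃ c : ℂ, ∀ᶠ w : polygon n r in 𝓝 z, φ (proj n r w) = (w : ℂ) + c

/-- The points at which the piecewise Euclidean structure is singular: those without a flat chart. -/
def conePoints (n : ℕ) (r : ℝ) : Set (Surface n r) :=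
  {x | ¬ ∃ φ, IsFlatChart n r φ ∧ x ∈ φ.source}

/-- On the open set `I` of parameters, `γ` is a straight line with velocity `u`. -/
def IsStraightOn (n : ℕ) (r : ℝ) (u : ℂ) (γ : ℝ → Surface n r) (I : Set ℝ) : Prop :=
  ∀ t ∈ I, ∃ φ, IsFlatChart n r φ ∧ γ t ∈ φ.source ∧
    ∀ᶠ s in 𝓝 t, γ s ∈ φ.source ∧ φ (γ s) = φ (γ t) + ((s - t : ℝ) : ℂ) * u

/-- A complete straight line of direction `u`, as a subset of the surface: it is parametrized by
a closed interval `closure I` with nonempty interior `I` (possibly a half line or the whole line),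
it is straight on `I`, and it can end only at a cone point. -/
def IsLine (n : ℕ) (r : ℝ) (u : ℂ) (L : Set (Surface n r)) : Prop :=
  ∃ (I : Set ℝ) (γ : ℝ → Surface n r), IsOpen I ∧ I.Nonempty ∧ I.OrdConnected ∧
    IsStraightOn n r u γ I ∧ ContinuousOn γ (closure I) ∧
    (∀ t ∈ frontier I, γ t ∈ conePoints n r) ∧ L = γ '' closure I

/-- The family of all complete straight lines of direction `u` in the surface. -/
def lines (n : ℕ) (r : ℝ) (u : ℂ) : Set (Set (Surface n r)) :=
  {L | IsLine n r u L}

/-- The point `x` is a regular point of the family `F` of leaves on a surface: it has a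
neighbourhood, mapped by a chart to an open rectangle, in which every point lies on exactly one
leaf and in which the connected components of each leaf are the horizontal slices. -/
def IsRegularPoint {S : Type*} [TopologicalSpace S] (F : Set (Set S)) (x : S) : Prop :=
  ∃ φ : OpenPartialHomeomorph S ℂ, x ∈ φ.source ∧
    (∃ a b c d : ℝ, φ.target = Ioo a b ×ℂ Ioo c d) ∧
    (∀ y ∈ φ.source, ∃! L, L ∈ F ∧ y ∈ L) ∧
    ∀ L ∈ F, ∀ y ∈ L ∩ φ.source,
      connectedComponentIn (L ∩ φ.source) y = {z ∈ φ.source | (φ z).im = (φ y).im}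

/-- The singular points of a family of leaves. -/
def singularPoints {S : Type*} [TopologicalSpace S] (F : Set (Set S)) : Set S :=
  {x | ¬ IsRegularPoint F x}

end PolygonSurface

end

/-!
Away from the cone points the flat charts form a translation atlas, so straight lines continue
uniquely, and in a compact surface a line that stops has a limit, which can only be a cone point.
Hence the lines of a given direction foliate the complement of the cone points.

At the vertices the polygon unfolds: the `2n` corners, of angle `(n - 1)π/n` each, close up to a
total angle `2π(n - 1)`, and the maps `ζ ↦ ζ ^ (n - 1)` on `2n` sectors of the disc give an oriented
chart of the surface there. If `n = 2` this chart is flat. If `n ≥ 4`, a corner is so wide that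
every direction enters the polygon from two distinct vertices; the two rays end at the vertex point
but differ near it, which rules out a flat chart and makes two leaves meet there. Finally,
following the corners around shows that all vertices are identified exactly when `n` is even, in
which case `V - E + F = 1 - n + 1`.
-/

noncomputable section

namespace PolygonSurface

section TranslationAtlas

variable {S : Type*} [TopologicalSpace S]

/-- A translation atlas: a family of plane charts any two of which differ, near every common point,
by a translation. The charts need not cover the space. -/
def IsTranslationAtlas (A : Set (OpenPartialHomeomorph S ℂ)) : Prop :=
  ∀ φ ∈ A, ∀ ψ ∈ A, ∀ x ∈ φ.source ∩ ψ.source, ∀ᶠ y in 𝓝 x, ψ y = φ y + (ψ x - φ x)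

/-- The points that lie in the domain of no chart of the family; for the flat charts of a
polygon surface these are the cone points. -/
def uncharted (A : Set (OpenPartialHomeomorph S ℂ)) : Set S :=
  {x | ¬ ∃ φ ∈ A, x ∈ φ.source}

/-- At the parameters in `I`, the curve `γ` is straight with velocity `u` in charts of `A`. -/
def IsStraight (A : Set (OpenPartialHomeomorph S ℂ)) (u : ℂ) (γ : ℝ → S) (I : Set ℝ) : Prop :=
  ∀ t ∈ I, ∃ φ ∈ A, γ t ∈ φ.source ∧
    ∀ᶠ s in 𝓝 t, γ s ∈ φ.source ∧ φ (γ s) = φ (γ t) + ((s - t : ℝ) : ℂ) * u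

/-- A straight curve through `x`, defined on an open interval `I` containing `0`. -/
structure IsStraightThrough (A : Set (OpenPartialHomeomorph S ℂ)) (u : ℂ) (x : S) (γ : ℝ → S)
    (I : Set ℝ) : Prop where
  isOpen : IsOpen I
  ordConnected : I.OrdConnected
  zero_mem : 0 ∈ I
  isStraight : IsStraight A u γ I
  map_zero : γ 0 = x

/-- A parametrization of a complete straight line of direction `u`: it is straight on the nonempty
open interval `I`, continuous on the closure of `I`, and can end only outside the charts. -/
structure IsCompleteLine (A : Set (OpenPartialHomeomorph S ℂ)) (u : ℂ) (γ : ℝ → S)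
    (I : Set ℝ) : Prop where
  isOpen : IsOpen I
  nonempty : I.Nonempty
  ordConnected : I.OrdConnected
  isStraight : IsStraight A u γ I
  continuousOn : ContinuousOn γ (closure I)
  mem_uncharted : ∀ t ∈ frontier I, γ t ∈ uncharted A

/-- The complete straight lines of direction `u`, as subsets of the space. -/
def leaves (A : Set (OpenPartialHomeomorph S ℂ)) (u : ℂ) : Set (Set S) :=
  {L | ∃ γ I, IsCompleteLine A u γ I ∧ L = γ '' closure I}

variable {A : Set (OpenPartialHomeomorph S ℂ)} {u : ℂ} {x p : S} {γ δ : ℝ → S} {I J : Set ℝ}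
  {t : ℝ} {φ : OpenPartialHomeomorph S ℂ}

theorem notMem_uncharted_iff : x ∉ uncharted A ↔ ∃ φ ∈ A, x ∈ φ.source := not_not

theorem notMem_uncharted (hφ : φ ∈ A) (hx : x ∈ φ.source) : x ∉ uncharted A :=
  notMem_uncharted_iff.2 ⟨φ, hφ, hx⟩

theorem IsStraight.mono (h : IsStraight A u γ I) (hJI : J ⊆ I) : IsStraight A u γ J :=
  fun t ht => h t (hJI ht)

theorem IsStraight.notMem_uncharted (h : IsStraight A u γ I) (ht : t ∈ I) :
    γ t ∉ uncharted A := by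
  obtain ⟨φ, hφ, hγt, -⟩ := h t ht
  exact PolygonSurface.notMem_uncharted hφ hγt

theorem IsStraight.continuousAt (h : IsStraight A u γ I) (ht : t ∈ I) : ContinuousAt γ t := by
  obtain ⟨φ, -, hγt, hev⟩ := h t ht
  have hline : ContinuousAt (fun s : ℝ => φ.symm (φ (γ t) + ((s - t : ℝ) : ℂ) * u)) t := by
    refine ContinuousAt.comp (g := φ.symm) ?_ (by fun_prop)
    simpa using φ.continuousAt_symm (φ.map_source hγt)
  refine hline.congr ?_
  filter_upwards [hev] with s hs
  rw [← hs.2, φ.left_inv hs.1]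

theorem IsStraight.congr (hI : IsOpen I) (h : IsStraight A u γ I) (heq : EqOn γ δ I) :
    IsStraight A u δ I := by
  intro t ht
  obtain ⟨φ, hφ, hγt, hev⟩ := h t ht
  refine ⟨φ, hφ, heq ht ▸ hγt, ?_⟩
  filter_upwards [hev, hI.mem_nhds ht] with s hs hsI
  rw [← heq hsI, ← heq ht]
  exact hs

theorem IsStraight.union (hI : IsStraight A u γ I) (hJ : IsStraight A u γ J) :
    IsStraight A u γ (I ∪ J) := fun t ht => ht.elim (hI t) (hJ t)

theorem IsStraight.comp_add_const (h : IsStraight A u γ I) (c : ℝ) :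
    IsStraight A u (γ ∘ (· + c)) ((· + c) ⁻¹' I) := by
  intro t ht
  obtain ⟨φ, hφ, hγt, hev⟩ := h (t + c) ht
  refine ⟨φ, hφ, hγt, ?_⟩
  filter_upwards [((continuous_add_const c).tendsto t).eventually hev] with s hs
  simpa using hs

theorem isStraight_symm_line (hφ : φ ∈ A) (a u : ℂ) (t₀ : ℝ) :
    IsStraight A u (fun s => φ.symm (a + ((s - t₀ : ℝ) : ℂ) * u))
      {s | a + ((s - t₀ : ℝ) : ℂ) * u ∈ φ.target} := by
  intro t ht
  refine ⟨φ, hφ, φ.map_target ht, ?_⟩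
  have hline : Continuous fun s : ℝ => a + ((s - t₀ : ℝ) : ℂ) * u := by fun_prop
  filter_upwards [(φ.open_target.preimage hline).mem_nhds ht] with s hs
  refine ⟨φ.map_target hs, ?_⟩
  rw [φ.right_inv hs, φ.right_inv ht]
  push_cast
  ring

theorem exists_isStraight_ball_of_mem_source (hφ : φ ∈ A) (hx : x ∈ φ.source) (u : ℂ) :
    ∃ ε > 0, ∀ᶠ y in 𝓝 x, ∀ t : ℝ,
      ∃ δ : ℝ → S, IsStraight A u δ (Metric.ball t ε) ∧ δ t = y := by
  have hflow : ∀ᶠ q : S × ℝ in 𝓝 x ×ˢ 𝓝 0, φ q.1 + (q.2 : ℂ) * u ∈ φ.target := by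
    have hcont : ContinuousAt (fun q : S × ℝ => φ q.1 + (q.2 : ℂ) * u) (x, 0) :=
      ((φ.continuousAt hx).comp continuousAt_fst).add (by fun_prop)
    rw [← nhds_prod_eq]
    exact hcont.eventually (φ.open_target.mem_nhds (by simpa using φ.map_source hx))
  obtain ⟨P, hP, Q, hQ, hPQ⟩ := eventually_prod_iff.1 hflow
  obtain ⟨ε, hε, hball⟩ := Metric.eventually_nhds_iff.1 hQ
  refine ⟨ε, hε, ?_⟩
  filter_upwards [hP, φ.open_source.mem_nhds hx] with y hy hyφ t
  refine ⟨fun s => φ.symm (φ y + ((s - t : ℝ) : ℂ) * u),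
    (isStraight_symm_line hφ _ u t).mono fun s hs => hPQ hy (hball ?_), by simp [φ.left_inv hyφ]⟩
  simpa [Real.dist_eq] using hs

theorem IsStraight.eventually_mem_source (h : IsStraight A u γ I) (hA : IsTranslationAtlas A)
    (ht : t ∈ I) (hφ : φ ∈ A) (hγt : γ t ∈ φ.source) :
    ∀ᶠ s in 𝓝 t, γ s ∈ φ.source ∧ φ (γ s) = φ (γ t) + ((s - t : ℝ) : ℂ) * u := by
  obtain ⟨ψ, hψ, hγt', hev⟩ := h t ht
  have hcont := h.continuousAt ht
  filter_upwards [hev, hcont.eventually (hA ψ hψ φ hφ _ ⟨hγt', hγt⟩),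
    hcont.eventually (φ.open_source.mem_nhds hγt)] with s hs hchange hsφ
  refine ⟨hsφ, ?_⟩
  rw [hchange, hs.2]
  ring

theorem IsStraight.eqOn [T2Space S] (hA : IsTranslationAtlas A) (hIo : IsOpen I)
    (hI : I.OrdConnected) (hγ : IsStraight A u γ I) (hδ : IsStraight A u δ I) (ht : t ∈ I)
    (heq : γ t = δ t) : EqOn γ δ I := by
  have hopen : IsOpen (I ∩ {s | γ s = δ s}) := by
    refine isOpen_iff_mem_nhds.2 fun s ⟨hsI, hs⟩ => ?_
    obtain ⟨φ, hφ, hγs, hev⟩ := hγ s hsI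
    filter_upwards [hev, hδ.eventually_mem_source hA hsI hφ (hs ▸ hγs), hIo.mem_nhds hsI]
      with s' hγs' hδs' hs'I
    refine ⟨hs'I, φ.injOn hγs'.1 hδs'.1 ?_⟩
    rw [hγs'.2, hδs'.2, hs]
  have hopen' : IsOpen (I ∩ {s | γ s ≠ δ s}) := by
    refine isOpen_iff_mem_nhds.2 fun s ⟨hsI, hs⟩ => ?_
    filter_upwards [((hγ.continuousAt hsI).prodMk (hδ.continuousAt hsI)).eventually
      (isClosed_diagonal.isOpen_compl.mem_nhds hs), hIo.mem_nhds hsI] with s' hne hs'I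
    exact ⟨hs'I, hne⟩
  intro s hs
  by_contra hne
  obtain ⟨s', -, heq', hne'⟩ := hI.isPreconnected _ _ hopen hopen'
    (fun s' hs' => (em (γ s' = δ s')).imp (⟨hs', ·⟩) (⟨hs', ·⟩)) ⟨t, ht, ht, heq⟩ ⟨s, hs, hs, hne⟩
  exact hne'.2 heq'.2

theorem IsStraight.exists_extension [T2Space S] (hA : IsTranslationAtlas A) (hIo : IsOpen I)
    (hI : I.OrdConnected) (hJo : IsOpen J) (hJ : J.OrdConnected) (hγ : IsStraight A u γ I)
    (hδ : IsStraight A u δ J) (htI : t ∈ I) (htJ : t ∈ J) (heq : γ t = δ t) :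
    ∃ η, IsStraight A u η (I ∪ J) ∧ EqOn γ η I := by
  classical
  have hIJ : EqOn γ δ (I ∩ J) := (hγ.mono inter_subset_left).eqOn hA (hIo.inter hJo) (hI.inter hJ)
    (hδ.mono inter_subset_right) ⟨htI, htJ⟩ heq
  have hγη : EqOn γ (I.piecewise γ δ) I := (piecewise_eqOn I γ δ).symm
  have hδη : EqOn δ (I.piecewise γ δ) J := by
    intro s hs
    by_cases hsI : s ∈ I
    · rw [piecewise_eq_of_mem _ _ _ hsI, hIJ ⟨hsI, hs⟩]
    · rw [piecewise_eq_of_notMem _ _ _ hsI]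
  exact ⟨_, (hγ.congr hIo hγη).union (hδ.congr hJo hδη), hγη⟩

theorem exists_maximal_isStraightThrough [T2Space S] (hA : IsTranslationAtlas A)
    (hx : x ∉ uncharted A) (u : ℂ) :
    ∃ γ I, IsStraightThrough A u x γ I ∧ ∀ δ J, IsStraightThrough A u x δ J → J ⊆ I := by
  let I : Set ℝ := {t | ∃ δ J, IsStraightThrough A u x δ J ∧ t ∈ J}
  have hsub : ∀ δ J, IsStraightThrough A u x δ J → J ⊆ I := fun δ J h t ht => ⟨δ, J, h, ht⟩
  have : Nonempty S := ⟨x⟩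
  choose! Γ D hΓ hD using fun t (ht : t ∈ I) => ht
  let γ : ℝ → S := fun t => Γ t t
  have heqOn : ∀ δ J, IsStraightThrough A u x δ J → EqOn δ γ J := fun δ J h t ht =>
    have ht' := hsub δ J h ht
    (h.isStraight.mono inter_subset_left).eqOn hA (h.isOpen.inter (hΓ t ht').isOpen)
      (h.ordConnected.inter (hΓ t ht').ordConnected)
      ((hΓ t ht').isStraight.mono inter_subset_right) ⟨h.zero_mem, (hΓ t ht').zero_mem⟩
      (h.map_zero.trans (hΓ t ht').map_zero.symm) ⟨ht, hD t ht'⟩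
  have hlocal : ∃ δ J, IsStraightThrough A u x δ J := by
    obtain ⟨φ, hφ, hxφ⟩ := notMem_uncharted_iff.1 hx
    obtain ⟨ε, hε, hev⟩ := exists_isStraight_ball_of_mem_source hφ hxφ u
    obtain ⟨δ, hδ, hδ0⟩ := hev.self_of_nhds 0
    exact ⟨δ, _, Metric.isOpen_ball, Real.ball_eq_Ioo 0 ε ▸ ordConnected_Ioo,
      Metric.mem_ball_self hε, hδ, hδ0⟩
  obtain ⟨δ, J, hδ⟩ := hlocal
  refine ⟨γ, I, ⟨?_, ?_, hsub δ J hδ hδ.zero_mem, ?_, ?_⟩, hsub⟩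
  · exact isOpen_iff_mem_nhds.2 fun t ht =>
      mem_of_superset ((hΓ t ht).isOpen.mem_nhds (hD t ht)) (hsub _ _ (hΓ t ht))
  · refine (isPreconnected_of_forall 0 fun t ht => ?_).ordConnected
    exact ⟨D t, hsub _ _ (hΓ t ht), (hΓ t ht).zero_mem, hD t ht,
      (hΓ t ht).ordConnected.isPreconnected⟩
  · exact fun t ht => (hΓ t ht).isStraight.congr (hΓ t ht).isOpen (heqOn _ _ (hΓ t ht)) t (hD t ht)
  · exact (heqOn δ J hδ hδ.zero_mem).symm.trans hδ.map_zero

-- Near a charted point the straight flow is defined for a uniform time `ε`; a straight curve that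
-- comes close to such a point less than `ε` before `b` therefore extends beyond `b`.
theorem IsStraightThrough.mem_uncharted_of_mapClusterPt [T2Space S] (hA : IsTranslationAtlas A)
    (hγ : IsStraightThrough A u x γ I) (hmax : ∀ δ J, IsStraightThrough A u x δ J → J ⊆ I)
    {b : ℝ} (hb : b ∉ I) {q : S} (hq : MapClusterPt q (𝓝[I] b) γ) : q ∈ uncharted A := by
  by_contra hqA
  obtain ⟨φ, hφ, hqφ⟩ := notMem_uncharted_iff.1 hqA
  obtain ⟨ε, hε, hev⟩ := exists_isStraight_ball_of_mem_source hφ hqφ u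
  obtain ⟨t, hflow, htI, htb⟩ := ((hq.frequently hev).and_eventually
    (eventually_mem_nhdsWithin.and (nhdsWithin_le_nhds (Metric.ball_mem_nhds b hε)))).exists
  obtain ⟨δ, hδ, hδt⟩ := hflow t
  have hball : (Metric.ball t ε).OrdConnected := Real.ball_eq_Ioo t ε ▸ ordConnected_Ioo
  have htt : t ∈ Metric.ball t ε := Metric.mem_ball_self hε
  obtain ⟨η, hη, hγη⟩ := hγ.isStraight.exists_extension hA hγ.isOpen hγ.ordConnected
    Metric.isOpen_ball hball hδ htI htt hδt.symm
  have hext : IsStraightThrough A u x η (I ∪ Metric.ball t ε) :=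
    { isOpen := hγ.isOpen.union Metric.isOpen_ball
      ordConnected :=
        (hγ.ordConnected.isPreconnected.union t htI htt hball.isPreconnected).ordConnected
      zero_mem := Or.inl hγ.zero_mem
      isStraight := hη
      map_zero := (hγη hγ.zero_mem).symm.trans hγ.map_zero }
  exact hb (hmax η _ hext (Or.inr (Metric.mem_ball_comm.1 htb)))

theorem exists_isCompleteLine [T2Space S] [CompactSpace S] (hA : IsTranslationAtlas A)
    (hsub : (uncharted A).Subsingleton) (hx : x ∉ uncharted A) (u : ℂ) :
    ∃ γ I, IsCompleteLine A u γ I ∧ 0 ∈ I ∧ γ 0 = x := by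
  obtain ⟨γ, I, hγ, hmax⟩ := exists_maximal_isStraightThrough hA hx u
  have hend : ∀ b ∈ closure I, b ∉ I → ∃ p ∈ uncharted A, Tendsto γ (𝓝[I] b) (𝓝 p) := by
    intro b hb hbI
    have : (𝓝[I] b).NeBot := mem_closure_iff_nhdsWithin_neBot.1 hb
    obtain ⟨p, hp⟩ := exists_clusterPt_of_compactSpace (map γ (𝓝[I] b))
    have huncharted : ∀ q, MapClusterPt q (𝓝[I] b) γ → q ∈ uncharted A :=
      fun q => hγ.mem_uncharted_of_mapClusterPt hA hmax hbI
    exact ⟨p, huncharted p hp,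
      le_nhds_of_unique_clusterPt fun q hq => hsub (huncharted q hq) (huncharted p hp)⟩
  have hcont : ContinuousOn γ I := fun t ht => (hγ.isStraight.continuousAt ht).continuousWithinAt
  have hext : EqOn γ (extendFrom I γ) I := fun t ht => (extendFrom_extends hcont t ht).symm
  have hlim : ∀ t ∈ closure I, ∃ y, Tendsto γ (𝓝[I] t) (𝓝 y) := by
    intro t ht
    by_cases htI : t ∈ I
    · exact ⟨γ t, hcont t htI⟩
    · obtain ⟨p, -, hp⟩ := hend t ht htI
      exact ⟨p, hp⟩
  refine ⟨extendFrom I γ, I,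
    { isOpen := hγ.isOpen
      nonempty := ⟨0, hγ.zero_mem⟩
      ordConnected := hγ.ordConnected
      isStraight := hγ.isStraight.congr hγ.isOpen hext
      continuousOn := continuousOn_extendFrom subset_rfl hlim
      mem_uncharted := fun t ht => ?_ },
    hγ.zero_mem, (hext hγ.zero_mem).symm.trans hγ.map_zero⟩
  rw [hγ.isOpen.frontier_eq] at ht
  obtain ⟨p, hp, htend⟩ := hend t ht.1 ht.2
  rwa [extendFrom_eq ht.1 htend]

theorem exists_mem_leaves [T2Space S] [CompactSpace S] (hA : IsTranslationAtlas A)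
    (hsub : (uncharted A).Subsingleton) (hx : x ∉ uncharted A) (u : ℂ) :
    ∃ L ∈ leaves A u, x ∈ L := by
  obtain ⟨γ, I, hγ, h0, rfl⟩ := exists_isCompleteLine hA hsub hx u
  exact ⟨_, ⟨γ, I, hγ, rfl⟩, 0, subset_closure h0, rfl⟩

theorem IsCompleteLine.mem_of_mem_closure (hγ : IsCompleteLine A u γ I) (ht : t ∈ closure I)
    (hγt : γ t ∉ uncharted A) : t ∈ I := by
  by_contra htI
  exact hγt (hγ.mem_uncharted t (hγ.isOpen.frontier_eq ▸ ⟨ht, htI⟩))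

theorem IsCompleteLine.comp_add_const (hγ : IsCompleteLine A u γ I) (c : ℝ) :
    IsCompleteLine A u (γ ∘ (· + c)) ((· + c) ⁻¹' I) where
  isOpen := hγ.isOpen.preimage (continuous_add_const c)
  nonempty := hγ.nonempty.preimage (add_right_surjective c)
  ordConnected := hγ.ordConnected.preimage_mono fun _ _ h => by gcongr
  isStraight := hγ.isStraight.comp_add_const c
  continuousOn := by
    have hclosure := (Homeomorph.addRight c).preimage_closure I
    rw [Homeomorph.coe_addRight] at hclosure
    rw [← hclosure]
    exact hγ.continuousOn.comp (continuous_add_const c).continuousOn (mapsTo_preimage _ _)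
  mem_uncharted := by
    have hfrontier := (Homeomorph.addRight c).preimage_frontier I
    rw [Homeomorph.coe_addRight] at hfrontier
    rw [← hfrontier]
    exact fun t ht => hγ.mem_uncharted _ ht

theorem IsCompleteLine.subset_of_isStraight [T2Space S] (hA : IsTranslationAtlas A)
    (hγ : IsCompleteLine A u γ I) (hJo : IsOpen J) (hJ : J.OrdConnected)
    (hδ : IsStraight A u δ J) (htI : t ∈ I) (htJ : t ∈ J) (heq : γ t = δ t) :
    J ⊆ I ∧ EqOn γ δ J := by
  have hIJ : EqOn γ δ (I ∩ J) := (hγ.isStraight.mono inter_subset_left).eqOn hA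
    (hγ.isOpen.inter hJo) (hγ.ordConnected.inter hJ) (hδ.mono inter_subset_right) ⟨htI, htJ⟩ heq
  have hclosure : J ∩ closure I ⊆ I := by
    rintro s ⟨hsJ, hsI⟩
    have hmem : s ∈ closure (I ∩ J) := inter_comm J I ▸ hJo.inter_closure ⟨hsJ, hsI⟩
    have : (𝓝[I ∩ J] s).NeBot := mem_closure_iff_nhdsWithin_neBot.1 hmem
    have hγs : Tendsto γ (𝓝[I ∩ J] s) (𝓝 (γ s)) :=
      (hγ.continuousOn s hsI).mono (inter_subset_left.trans subset_closure)
    have hδs : Tendsto δ (𝓝[I ∩ J] s) (𝓝 (δ s)) :=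
      (hδ.continuousAt hsJ).mono_left nhdsWithin_le_nhds
    have hγδ : γ s = δ s :=
      tendsto_nhds_unique (hγs.congr' (eventually_nhdsWithin_of_forall hIJ)) hδs
    exact hγ.mem_of_mem_closure hsI (hγδ ▸ hδ.notMem_uncharted hsJ)
  have hJI : J ⊆ I := by
    refine hJ.isPreconnected.subset_left_of_subset_union hγ.isOpen isClosed_closure.isOpen_compl
      (disjoint_compl_right.mono_left subset_closure) (fun s hs => ?_) ⟨t, htJ, htI⟩
    exact (em (s ∈ closure I)).imp (fun h => hclosure ⟨hs, h⟩) id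
  exact ⟨hJI, fun s hs => hIJ ⟨hJI hs, hs⟩⟩

theorem IsCompleteLine.eq_of_eq [T2Space S] (hA : IsTranslationAtlas A)
    (hγ : IsCompleteLine A u γ I) (hδ : IsCompleteLine A u δ J) (htI : t ∈ I) (htJ : t ∈ J)
    (heq : γ t = δ t) : I = J ∧ EqOn γ δ (closure I) := by
  obtain ⟨hJI, hEq⟩ :=
    hγ.subset_of_isStraight hA hδ.isOpen hδ.ordConnected hδ.isStraight htI htJ heq
  obtain ⟨hIJ, -⟩ :=
    hδ.subset_of_isStraight hA hγ.isOpen hγ.ordConnected hγ.isStraight htJ htI heq.symm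
  obtain rfl : I = J := hIJ.antisymm hJI
  exact ⟨rfl, hEq.of_subset_closure hγ.continuousOn hδ.continuousOn subset_closure subset_rfl⟩

theorem eq_of_mem_leaves [T2Space S] (hA : IsTranslationAtlas A) {L L' : Set S}
    (hL : L ∈ leaves A u) (hL' : L' ∈ leaves A u) (hx : x ∉ uncharted A) (hxL : x ∈ L)
    (hxL' : x ∈ L') : L = L' := by
  obtain ⟨γ, I, hγ, rfl⟩ := hL
  obtain ⟨δ, J, hδ, rfl⟩ := hL'
  obtain ⟨t, ht, rfl⟩ := hxL
  obtain ⟨s, hs, hst⟩ := hxL'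
  obtain ⟨hIJ, hEq⟩ := hγ.eq_of_eq hA (hδ.comp_add_const (s - t)) (hγ.mem_of_mem_closure ht hx)
    (by simpa using hδ.mem_of_mem_closure hs (hst ▸ hx)) (by simp [hst])
  have hclosure : closure I = (· + (s - t)) ⁻¹' closure J :=
    hIJ ▸ ((Homeomorph.addRight (s - t)).preimage_closure J).symm
  rw [hEq.image_eq, hclosure, image_comp, image_preimage_eq _ (add_right_surjective _)]

theorem exists_isCompleteLine_of_ray [T2Space S] [CompactSpace S] (hA : IsTranslationAtlas A)
    (hsub : (uncharted A).Subsingleton) (hp : p ∈ uncharted A) {σ : ℝ → S} {ε : ℝ} (hε : 0 < ε)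
    (hσ : IsStraight A u σ (Ioo 0 ε)) (hlim : Tendsto σ (𝓝[>] 0) (𝓝 p)) :
    ∃ γ I, IsCompleteLine A u γ I ∧ Ioo 0 ε ⊆ I ∧ I ⊆ Ioi 0 ∧ EqOn γ σ (Ioo 0 ε) ∧
      0 ∈ closure I ∧ γ 0 = p := by
  have hmid : ε / 2 ∈ Ioo 0 ε := ⟨half_pos hε, half_lt_self hε⟩
  obtain ⟨γ₀, I₀, hγ₀, h0I₀, hγ₀0⟩ := exists_isCompleteLine hA hsub (hσ.notMem_uncharted hmid) u
  have hγ := hγ₀.comp_add_const (-(ε / 2))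
  set γ := γ₀ ∘ (· + -(ε / 2)) with hγdef
  set I := (· + -(ε / 2)) ⁻¹' I₀ with hIdef
  obtain ⟨hεI, hγσ⟩ := hγ.subset_of_isStraight hA isOpen_Ioo ordConnected_Ioo hσ (t := ε / 2)
    (by simpa [hIdef] using h0I₀) hmid (by simpa [hγdef] using hγ₀0)
  have h0 : (0 : ℝ) ∈ closure I :=
    closure_mono hεI (closure_Ioo hε.ne ▸ left_mem_Icc.2 hε.le)
  have hγ0 : γ 0 = p := by
    have : (𝓝[Ioo 0 ε] (0 : ℝ)).NeBot := by
      rw [nhdsWithin_Ioo_eq_nhdsGT hε]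
      infer_instance
    have hγlim : Tendsto γ (𝓝[Ioo 0 ε] 0) (𝓝 (γ 0)) :=
      (hγ.continuousOn 0 h0).mono (hεI.trans subset_closure)
    refine tendsto_nhds_unique (hγlim.congr' (eventually_nhdsWithin_of_forall hγσ)) ?_
    exact hlim.mono_left (nhdsWithin_mono _ Ioo_subset_Ioi_self)
  refine ⟨γ, I, hγ, hεI, fun t ht => ?_, hγσ, h0, hγ0⟩
  by_contra hneg
  have h0I : (0 : ℝ) ∈ I := hγ.ordConnected.out ht (hεI hmid) ⟨not_lt.1 hneg, hmid.1.le⟩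
  exact hγ.isStraight.notMem_uncharted h0I (hγ0 ▸ hp)

theorem exists_leaves_ne_of_rays [T2Space S] [CompactSpace S] (hA : IsTranslationAtlas A)
    (hsub : (uncharted A).Subsingleton) (hp : p ∈ uncharted A) {σ τ : ℝ → S} {ε : ℝ}
    (hε : 0 < ε) (hσ : IsStraight A u σ (Ioo 0 ε)) (hσp : Tendsto σ (𝓝[>] 0) (𝓝 p))
    (hτ : IsStraight A u τ (Ioo 0 ε)) (hτp : Tendsto τ (𝓝[>] 0) (𝓝 p))
    (hne : ∀ t ∈ Ioo 0 ε, σ t ≠ τ t) :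
    ∃ L ∈ leaves A u, ∃ L' ∈ leaves A u, L ≠ L' ∧ p ∈ L ∩ L' := by
  obtain ⟨γ, I, hγ, hεI, hI, hγσ, h0I, hγ0⟩ := exists_isCompleteLine_of_ray hA hsub hp hε hσ hσp
  obtain ⟨δ, J, hδ, -, hJ, hδτ, h0J, hδ0⟩ := exists_isCompleteLine_of_ray hA hsub hp hε hτ hτp
  refine ⟨_, ⟨γ, I, hγ, rfl⟩, _, ⟨δ, J, hδ, rfl⟩, fun heq => ?_, ⟨0, h0I, hγ0⟩, ⟨0, h0J, hδ0⟩⟩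
  have hmid : ε / 2 ∈ Ioo 0 ε := ⟨half_pos hε, half_lt_self hε⟩
  obtain ⟨s, hs, hst⟩ : γ (ε / 2) ∈ δ '' closure J :=
    heq ▸ mem_image_of_mem γ (subset_closure (hεI hmid))
  have hsJ := hδ.mem_of_mem_closure hs (hst ▸ hγ.isStraight.notMem_uncharted (hεI hmid))
  obtain ⟨hIJ, -⟩ := hγ.eq_of_eq hA (hδ.comp_add_const (s - ε / 2)) (hεI hmid)
    (by simpa using hsJ) (by simp [hst])
  have hI0 : closure I ⊆ Ici 0 := closure_minimal (hI.trans Ioi_subset_Ici_self) isClosed_Ici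
  have hJ0 : closure J ⊆ Ici 0 := closure_minimal (hJ.trans Ioi_subset_Ici_self) isClosed_Ici
  have hclosure : closure I = (· + (s - ε / 2)) ⁻¹' closure J :=
    hIJ ▸ ((Homeomorph.addRight (s - ε / 2)).preimage_closure J).symm
  -- The shift carrying one parameter interval to the other vanishes as both intervals start at `0`.
  have hle : 0 ≤ 0 + (s - ε / 2) := hJ0 (hclosure.subset h0I)
  have hge : 0 ≤ -(s - ε / 2) := hI0 (hclosure.superset (by simpa using h0J))
  obtain rfl : s = ε / 2 := by linarith
  exact hne _ hmid (by rw [← hγσ hmid, ← hδτ hmid, hst])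

/-- A chart in which the straight curves of direction `u` are horizontal: it is obtained from a
chart of `A` by restriction and division by `u`. -/
def IsRectifyingChart (A : Set (OpenPartialHomeomorph S ℂ)) (u : ℂ)
    (ψ : OpenPartialHomeomorph S ℂ) : Prop :=
  ∃ φ ∈ A, ψ.source ⊆ φ.source ∧ ∀ y ∈ ψ.source, φ y = u * ψ y

theorem exists_rectangle_subset {U : Set ℂ} (hU : IsOpen U) {z : ℂ} (hz : z ∈ U) :
    ∃ a b c d : ℝ, z ∈ Ioo a b ×ℂ Ioo c d ∧ Ioo a b ×ℂ Ioo c d ⊆ U := by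
  have hnhds : Complex.equivRealProdCLM.symm ⁻¹' U ∈ 𝓝 (z.re, z.im) :=
    (hU.preimage Complex.equivRealProdCLM.symm.continuous).mem_nhds hz
  obtain ⟨V, hV, W, hW, hVW⟩ := mem_nhds_prod_iff.1 hnhds
  obtain ⟨a, b, hab, habV⟩ := mem_nhds_iff_exists_Ioo_subset.1 hV
  obtain ⟨c, d, hcd, hcdW⟩ := mem_nhds_iff_exists_Ioo_subset.1 hW
  exact ⟨a, b, c, d, ⟨hab, hcd⟩, fun w hw => hVW (mk_mem_prod (habV hw.1) (hcdW hw.2))⟩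

theorem exists_isRectifyingChart_rectangle (hu : u ≠ 0) (hx : x ∉ uncharted A) :
    ∃ ψ, IsRectifyingChart A u ψ ∧ x ∈ ψ.source ∧
      ∃ a b c d : ℝ, ψ.target = Ioo a b ×ℂ Ioo c d := by
  obtain ⟨φ, hφ, hxφ⟩ := notMem_uncharted_iff.1 hx
  let χ := φ.transHomeomorph (Homeomorph.mulLeft₀ u⁻¹ (inv_ne_zero hu))
  have hχ : ∀ y, φ y = u * χ y := fun y => (mul_inv_cancel_left₀ hu (φ y)).symm
  obtain ⟨a, b, c, d, hmem, hsub⟩ := exists_rectangle_subset χ.open_target (χ.map_source hxφ)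
  let ψ := χ.trans (OpenPartialHomeomorph.ofSet _ (isOpen_Ioo.reProdIm isOpen_Ioo :
    IsOpen (Ioo a b ×ℂ Ioo c d)))
  have hsource : ψ.source = φ.source ∩ χ ⁻¹' (Ioo a b ×ℂ Ioo c d) := rfl
  refine ⟨ψ, ⟨φ, hφ, inter_subset_left, fun y _ => hχ y⟩, hsource ▸ ⟨hxφ, hmem⟩, a, b, c, d, ?_⟩
  exact inter_eq_left.2 hsub

namespace IsRectifyingChart

variable {ψ : OpenPartialHomeomorph S ℂ} {y : S}

theorem notMem_uncharted (hψ : IsRectifyingChart A u ψ) (hy : y ∈ ψ.source) :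
    y ∉ uncharted A := by
  obtain ⟨φ, hφ, hsub, -⟩ := hψ
  exact PolygonSurface.notMem_uncharted hφ (hsub hy)

theorem isStraight_symm (hψ : IsRectifyingChart A u ψ) (w : ℂ) :
    IsStraight A u (fun s : ℝ => ψ.symm (w + s)) {s | w + (s : ℂ) ∈ ψ.target} := by
  obtain ⟨φ, hφ, hsub, hmul⟩ := hψ
  have hφψ : ∀ z ∈ ψ.target, φ (ψ.symm z) = u * z := fun z hz => by
    rw [hmul _ (ψ.map_target hz), ψ.right_inv hz]
  intro t ht
  refine ⟨φ, hφ, hsub (ψ.map_target ht), ?_⟩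
  have hline : Continuous fun s : ℝ => w + (s : ℂ) := by fun_prop
  filter_upwards [(ψ.open_target.preimage hline).mem_nhds ht] with s hs
  refine ⟨hsub (ψ.map_target hs), ?_⟩
  rw [hφψ _ hs, hφψ _ ht]
  push_cast
  ring

theorem countable_im_image (hψ : IsRectifyingChart A u ψ) (hA : IsTranslationAtlas A)
    (hu : u ≠ 0) (hγ : IsStraight A u γ I) :
    ((fun y => (ψ y).im) '' (γ '' I ∩ ψ.source)).Countable := by
  obtain ⟨φ, hφ, hsub, hmul⟩ := hψ
  let T : Set ℝ := {t ∈ I | γ t ∈ ψ.source}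
  have hconst : ∀ t ∈ T, {s | γ s ∈ ψ.source → (ψ (γ s)).im = (ψ (γ t)).im} ∈ 𝓝[T] t := by
    rintro t ⟨htI, htψ⟩
    refine mem_nhdsWithin_of_mem_nhds ?_
    filter_upwards [hγ.eventually_mem_source hA htI hφ (hsub htψ)] with s hs hsψ
    have hshift : ψ (γ s) = ψ (γ t) + ((s - t : ℝ) : ℂ) := by
      refine mul_left_cancel₀ hu ?_
      rw [← hmul _ hsψ, hs.2, hmul _ htψ]
      ring
    rw [hshift, Complex.add_im, Complex.ofReal_im, add_zero]
  obtain ⟨C, -, hC, hcover⟩ := TopologicalSpace.countable_cover_nhdsWithin hconst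
  refine (hC.image fun t => (ψ (γ t)).im).mono ?_
  rintro _ ⟨_, ⟨⟨s, hs, rfl⟩, hsψ⟩, rfl⟩
  obtain ⟨t, ht, hst⟩ := mem_iUnion₂.1 (hcover ⟨hs, hsψ⟩)
  exact ⟨t, ht, (hst hsψ).symm⟩

theorem ordConnected_setOf_add_ofReal_mem {V : Set ℂ} (hV : Convex ℝ V) (w : ℂ) :
    {s : ℝ | w + (s : ℂ) ∈ V}.OrdConnected :=
  ((hV.translate_preimage_right w).linear_preimage Complex.ofRealCLM.toLinearMap).ordConnected

theorem slice_eq_image (ψ : OpenPartialHomeomorph S ℂ) (w : ℂ) :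
    {z ∈ ψ.source | (ψ z).im = w.im} =
      (fun s : ℝ => ψ.symm (w + s)) '' {s | w + (s : ℂ) ∈ ψ.target} := by
  ext z
  constructor
  · rintro ⟨hz, him⟩
    have hψz : w + ((ψ z).re - w.re : ℝ) = ψ z := by
      apply Complex.ext <;> simp [him]
    exact ⟨(ψ z).re - w.re, by simpa only [mem_ofPred_eq, hψz] using ψ.map_source hz,
      by simp only [hψz, ψ.left_inv hz]⟩
  · rintro ⟨s, hs, rfl⟩
    refine ⟨ψ.map_target hs, ?_⟩
    rw [ψ.right_inv hs, Complex.add_im, Complex.ofReal_im, add_zero]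

theorem slice_subset_of_mem [T2Space S] (hψ : IsRectifyingChart A u ψ)
    (hA : IsTranslationAtlas A) (hconv : Convex ℝ ψ.target) {L : Set S} (hL : L ∈ leaves A u)
    (hyL : y ∈ L) (hy : y ∈ ψ.source) : {z ∈ ψ.source | (ψ z).im = (ψ y).im} ⊆ L := by
  obtain ⟨γ, I, hγ, rfl⟩ := hL
  obtain ⟨t, ht, rfl⟩ := hyL
  have htI := hγ.mem_of_mem_closure ht (hψ.notMem_uncharted hy)
  have him : (ψ (γ t) - t).im = (ψ (γ t)).im := by simp
  have hopen : IsOpen {s : ℝ | ψ (γ t) - t + s ∈ ψ.target} :=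
    ψ.open_target.preimage (by fun_prop)
  obtain ⟨hJI, hEq⟩ := hγ.subset_of_isStraight hA hopen
    (ordConnected_setOf_add_ofReal_mem hconv _) (hψ.isStraight_symm (ψ (γ t) - t)) htI
    (by simpa using ψ.map_source hy) (by simp [ψ.left_inv hy])
  rw [← him, slice_eq_image, ← hEq.image_eq]
  exact image_mono (hJI.trans subset_closure)

theorem connectedComponentIn_leaf_eq_slice [T2Space S] (hψ : IsRectifyingChart A u ψ)
    (hA : IsTranslationAtlas A) (hu : u ≠ 0) (hconv : Convex ℝ ψ.target) {L : Set S}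
    (hL : L ∈ leaves A u) (hy : y ∈ L ∩ ψ.source) :
    connectedComponentIn (L ∩ ψ.source) y = {z ∈ ψ.source | (ψ z).im = (ψ y).im} := by
  have hcomp := connectedComponentIn_subset (L ∩ ψ.source) y
  apply Subset.antisymm
  · intro z hz
    refine ⟨(hcomp hz).2, ?_⟩
    have him : ContinuousOn (fun z => (ψ z).im) (L ∩ ψ.source) :=
      Complex.continuous_im.comp_continuousOn (ψ.continuousOn.mono inter_subset_right)
    have hcountable : ((fun z => (ψ z).im) '' (L ∩ ψ.source)).Countable := by
      obtain ⟨γ, I, hγ, rfl⟩ := hL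
      refine (hψ.countable_im_image hA hu hγ.isStraight).mono ?_
      rintro _ ⟨_, ⟨⟨t, ht, rfl⟩, htψ⟩, rfl⟩
      exact ⟨_, ⟨⟨t, hγ.mem_of_mem_closure ht (hψ.notMem_uncharted htψ), rfl⟩, htψ⟩, rfl⟩
    exact hcountable.isTotallyDisconnected _ (image_mono hcomp)
      (isPreconnected_connectedComponentIn.image _ (him.mono hcomp))
      (mem_image_of_mem _ hz) (mem_image_of_mem _ (mem_connectedComponentIn hy))
  · refine IsPreconnected.subset_connectedComponentIn ?_ ⟨hy.2, rfl⟩ fun z hz =>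
      ⟨hψ.slice_subset_of_mem hA hconv hL hy.1 hy.2 hz, hz.1⟩
    rw [slice_eq_image]
    exact (ordConnected_setOf_add_ofReal_mem hconv _).isPreconnected.image _ fun s hs =>
      ((hψ.isStraight_symm _).continuousAt hs).continuousWithinAt

end IsRectifyingChart

theorem isRegularPoint_leaves [T2Space S] [CompactSpace S] (hA : IsTranslationAtlas A)
    (hsub : (uncharted A).Subsingleton) (hu : u ≠ 0) (hx : x ∉ uncharted A) :
    IsRegularPoint (leaves A u) x := by
  obtain ⟨ψ, hψ, hxψ, a, b, c, d, htarget⟩ := exists_isRectifyingChart_rectangle hu hx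
  have hconv : Convex ℝ ψ.target := by
    rw [htarget]
    exact ((convex_Ioo a b).linear_preimage Complex.reLm).inter
      ((convex_Ioo c d).linear_preimage Complex.imLm)
  refine ⟨ψ, hxψ, ⟨a, b, c, d, htarget⟩, fun y hy => ?_, fun L hL y hy =>
    hψ.connectedComponentIn_leaf_eq_slice hA hu hconv hL hy⟩
  have hyA := hψ.notMem_uncharted hy
  obtain ⟨L, hL, hyL⟩ := exists_mem_leaves hA hsub hyA u
  exact ⟨L, ⟨hL, hyL⟩, fun L' hL' => eq_of_mem_leaves hA hL'.1 hL hyA hL'.2 hyL⟩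

end TranslationAtlas

section Geometry

/-- The point of the unit circle of angle `π x / n`. -/
def cis (n : ℕ) (x : ℝ) : ℂ := Complex.exp ((Real.pi * x / n : ℝ) * Complex.I)

/-- The apothem of the regular `2n`-gon of circumradius `r`. -/
def apothem (n : ℕ) (r : ℝ) : ℝ := r * Real.cos (Real.pi / (2 * n))

/-- Half of the side length of the regular `2n`-gon of circumradius `r`. -/
def halfSide (n : ℕ) (r : ℝ) : ℝ := r * Real.sin (Real.pi / (2 * n))

/-- The vertices of the polygon, indexed by the integers so that indices can be subtracted. -/
def corner (n : ℕ) (r : ℝ) (k : ℤ) : ℂ := r * cis n k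

/-- The outward unit normal of the `k`-th side. -/
def normal (n : ℕ) (k : ℤ) : ℂ := cis n (k + 1 / 2)

/-- The coordinate in the direction of the `k`-th normal; the `k`-th side lies at height
`apothem n r`. -/
def height (n : ℕ) (k : ℤ) : ℂ →L[ℝ] ℝ :=
  Complex.reCLM.comp (ContinuousLinearMap.mul ℝ ℂ (cis n (-(k + 1 / 2))))

/-- The interior of the polygon, given by the strict inequalities of its sides. -/
def openPolygon (n : ℕ) (r : ℝ) : Set ℂ := {z | ∀ k, height n k z < apothem n r}

/-- The coordinate along the `k`-th side, measured from its midpoint. -/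
def offset (n : ℕ) (k : ℤ) (z : ℂ) : ℝ := (z * cis n (-(k + 1 / 2))).im

variable {n : ℕ} {r : ℝ}

theorem cis_add (n : ℕ) (x y : ℝ) : cis n (x + y) = cis n x * cis n y := by
  unfold cis
  rw [← Complex.exp_add]
  congr 1
  push_cast
  ring

@[simp] theorem cis_zero (n : ℕ) : cis n 0 = 1 := by simp [cis]

theorem cis_mul_cis_neg (n : ℕ) (x : ℝ) : cis n x * cis n (-x) = 1 := by
  rw [← cis_add, add_neg_cancel, cis_zero]

@[simp] theorem norm_cis (n : ℕ) (x : ℝ) : ‖cis n x‖ = 1 := Complex.norm_exp_ofReal_mul_I _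

theorem cis_re (n : ℕ) (x : ℝ) : (cis n x).re = Real.cos (Real.pi * x / n) :=
  Complex.exp_ofReal_mul_I_re _

theorem cis_im (n : ℕ) (x : ℝ) : (cis n x).im = Real.sin (Real.pi * x / n) :=
  Complex.exp_ofReal_mul_I_im _

theorem cis_nat_mul (n : ℕ) (x : ℝ) (m : ℕ) : cis n (m * x) = cis n x ^ m := by
  unfold cis
  rw [← Complex.exp_nat_mul]
  congr 1
  push_cast
  ring

theorem cis_self (hn : n ≠ 0) : cis n n = -1 := by
  have hn' : (n : ℝ) ≠ 0 := Nat.cast_ne_zero.2 hn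
  rw [cis, mul_div_cancel_right₀ _ hn', Complex.exp_pi_mul_I]

theorem cis_add_self (hn : n ≠ 0) (x : ℝ) : cis n (x + n) = -cis n x := by
  rw [cis_add, cis_self hn, mul_neg_one]

theorem cis_add_period (hn : n ≠ 0) (x : ℝ) (m : ℤ) : cis n (x + 2 * n * m) = cis n x := by
  have hn' : (n : ℂ) ≠ 0 := Nat.cast_ne_zero.2 hn
  unfold cis
  rw [Complex.exp_eq_exp_iff_exists_int]
  refine ⟨m, ?_⟩
  push_cast
  field_simp

theorem cis_congr (hn : n ≠ 0) {j k : ℤ} (h : (2 * n : ℤ) ∣ j - k) (x : ℝ) :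
    cis n (j + x) = cis n (k + x) := by
  obtain ⟨m, hm⟩ := h
  have hj : (j : ℝ) = k + 2 * n * m := by exact_mod_cast eq_add_of_sub_eq' hm
  rw [hj, add_right_comm, cis_add_period hn]

theorem vertex_eq_corner (n : ℕ) (r : ℝ) (k : ℕ) : vertex n r k = corner n r k := by
  unfold vertex corner cis
  push_cast
  rfl

theorem corner_congr (hn : n ≠ 0) {j k : ℤ} (h : (2 * n : ℤ) ∣ j - k) :
    corner n r j = corner n r k := by
  simpa only [corner, add_zero] using congrArg ((r : ℂ) * ·) (cis_congr hn h 0)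

theorem corner_add_self (hn : n ≠ 0) (k : ℤ) : corner n r (k + n) = -corner n r k := by
  rw [corner, Int.cast_add, Int.cast_natCast, cis_add_self hn, mul_neg, corner]

theorem exists_nat_dvd_sub (hn : n ≠ 0) (k : ℤ) :
    ∃ m : ℕ, m < 2 * n ∧ (2 * n : ℤ) ∣ k - m := by
  have hpos : (0 : ℤ) < 2 * n := by omega
  have h0 := Int.emod_nonneg k hpos.ne'
  have h1 := Int.emod_lt_of_pos k hpos
  refine ⟨(k % (2 * n)).toNat, by omega, ?_⟩
  rw [Int.toNat_of_nonneg h0]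
  exact Int.dvd_self_sub_emod

theorem exists_vertex_eq_corner (hn : n ≠ 0) (r : ℝ) (k : ℤ) :
    ∃ m : ℕ, m < 2 * n ∧ vertex n r m = corner n r k := by
  obtain ⟨m, hm, h⟩ := exists_nat_dvd_sub hn k
  exact ⟨m, hm, by rw [vertex_eq_corner, corner_congr hn h]⟩

theorem range_vertex (hn : n ≠ 0) (r : ℝ) : range (vertex n r) = range (corner n r) := by
  apply Subset.antisymm
  · rintro _ ⟨k, rfl⟩
    exact ⟨k, (vertex_eq_corner n r k).symm⟩
  · rintro _ ⟨k, rfl⟩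
    obtain ⟨m, -, h⟩ := exists_vertex_eq_corner hn r k
    exact ⟨m, h⟩

theorem finite_range_corner (hn : n ≠ 0) (r : ℝ) : (range (corner n r)).Finite := by
  refine ((Finset.range (2 * n)).finite_toSet.image (vertex n r)).subset ?_
  rintro _ ⟨k, rfl⟩
  obtain ⟨m, hm, h⟩ := exists_vertex_eq_corner hn r k
  exact ⟨m, Finset.mem_coe.2 (Finset.mem_range.2 hm), h⟩

theorem isCompact_polygon (hn : n ≠ 0) (r : ℝ) : IsCompact (polygon n r) := by
  rw [polygon, range_vertex hn]
  exact (finite_range_corner hn r).isCompact_convexHull (𝕜 := ℝ)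

theorem convex_polygon (n : ℕ) (r : ℝ) : Convex ℝ (polygon n r) := convex_convexHull ℝ _

theorem corner_mem_polygon (hn : n ≠ 0) (k : ℤ) : corner n r k ∈ polygon n r := by
  rw [polygon, range_vertex hn]
  exact subset_convexHull ℝ _ ⟨k, rfl⟩

theorem zero_mem_polygon (hn : n ≠ 0) (r : ℝ) : (0 : ℂ) ∈ polygon n r := by
  have h := (convex_polygon n r).midpoint_mem (corner_mem_polygon hn 0)
    (corner_mem_polygon hn (0 + n))
  rwa [corner_add_self hn, midpoint_self_neg] at h

theorem height_apply (n : ℕ) (k : ℤ) (z : ℂ) : height n k z = (z * cis n (-(k + 1 / 2))).re := by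
  simp only [height, ContinuousLinearMap.comp_apply, ContinuousLinearMap.mul_apply',
    Complex.reCLM_apply, mul_comm z]

theorem height_ofReal_mul (n : ℕ) (k : ℤ) (a : ℝ) (z : ℂ) :
    height n k (a * z) = a * height n k z := by
  rw [← Complex.real_smul, map_smul, smul_eq_mul]

theorem abs_height_le (n : ℕ) (k : ℤ) (z : ℂ) : |height n k z| ≤ ‖z‖ := by
  rw [height_apply]
  refine (Complex.abs_re_le_norm _).trans ?_
  rw [norm_mul, norm_cis, mul_one]

theorem height_congr (hn : n ≠ 0) {j k : ℤ} (h : (2 * n : ℤ) ∣ j - k) :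
    height n j = height n k := by
  have h' : (2 * n : ℤ) ∣ -j - -k := by rw [neg_sub_neg]; exact (dvd_sub_comm).1 h
  have hcis := cis_congr hn h' (-(1 / 2))
  push_cast at hcis
  rw [height, height, neg_add, neg_add, hcis]

theorem height_add_self (hn : n ≠ 0) (k : ℤ) (z : ℂ) :
    height n (k + n) z = -height n k z := by
  have hcis : cis n (-((k : ℝ) + 1 / 2)) = -cis n (-((k : ℝ) + n + 1 / 2)) := by
    rw [← cis_add_self hn]
    congr 1
    ring
  rw [height_apply, height_apply, hcis, mul_neg, Complex.neg_re, neg_neg, Int.cast_add,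
    Int.cast_natCast]

theorem normal_congr (hn : n ≠ 0) {j k : ℤ} (h : (2 * n : ℤ) ∣ j - k) :
    normal n j = normal n k := cis_congr hn h _

theorem normal_add_self (hn : n ≠ 0) (k : ℤ) : normal n (k + n) = -normal n k := by
  rw [normal, normal, ← cis_add_self hn]
  congr 1
  push_cast
  ring

@[simp] theorem norm_normal (n : ℕ) (k : ℤ) : ‖normal n k‖ = 1 := norm_cis _ _

@[simp] theorem height_normal (n : ℕ) (k : ℤ) : height n k (normal n k) = 1 := by
  rw [height_apply, normal, cis_mul_cis_neg, Complex.one_re]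

theorem eq_normal_mul (n : ℕ) (k : ℤ) (z : ℂ) :
    z = normal n k * (height n k z + offset n k z * Complex.I) := by
  rw [height_apply, offset, Complex.re_add_im, normal, mul_left_comm, cis_mul_cis_neg, mul_one]

theorem height_add_int (n : ℕ) (k m : ℤ) (z : ℂ) :
    height n (k + m) z = height n k z * Real.cos (Real.pi * m / n) +
      offset n k z * Real.sin (Real.pi * m / n) := by
  have hcis : z * cis n (-((k + m : ℤ) + 1 / 2)) = z * cis n (-(k + 1 / 2)) * cis n (-m) := by
    rw [mul_assoc, ← cis_add]
    congr 2
    push_cast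
    ring
  rw [height_apply, hcis, Complex.mul_re, cis_re, cis_im, mul_neg, neg_div, Real.cos_neg,
    Real.sin_neg, height_apply, offset]
  ring

theorem half_angle_pos (hn : n ≠ 0) : 0 < Real.pi / (2 * n) := by
  have : (0 : ℝ) < n := Nat.cast_pos.2 (Nat.pos_of_ne_zero hn)
  positivity

theorem half_angle_le (hn : 2 ≤ n) : Real.pi / (2 * n) ≤ Real.pi / 4 := by
  have hn' : (2 : ℝ) ≤ n := by exact_mod_cast hn
  exact div_le_div_of_nonneg_left Real.pi_pos.le (by norm_num) (by linarith)

theorem cos_half_angle_pos (hn : 2 ≤ n) : 0 < Real.cos (Real.pi / (2 * n)) := by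
  have h0 := half_angle_pos (n := n) (by omega)
  have h1 := half_angle_le hn
  exact Real.cos_pos_of_mem_Ioo ⟨by linarith, by linarith⟩

theorem sin_half_angle_pos (hn : 2 ≤ n) : 0 < Real.sin (Real.pi / (2 * n)) := by
  have h0 := half_angle_pos (n := n) (by omega)
  have h1 := half_angle_le hn
  exact Real.sin_pos_of_pos_of_lt_pi h0 (by linarith)

theorem apothem_pos (hn : 2 ≤ n) (hr : 0 < r) : 0 < apothem n r :=
  mul_pos hr (cos_half_angle_pos hn)

theorem halfSide_pos (hn : 2 ≤ n) (hr : 0 < r) : 0 < halfSide n r :=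
  mul_pos hr (sin_half_angle_pos hn)

theorem cis_half (n : ℕ) : cis n (1 / 2) =
    Real.cos (Real.pi / (2 * n)) + Real.sin (Real.pi / (2 * n)) * Complex.I := by
  rw [cis, Complex.exp_mul_I, ← Complex.ofReal_cos, ← Complex.ofReal_sin, mul_one_div, div_div]

theorem cis_neg_half (n : ℕ) : cis n (-(1 / 2)) =
    Real.cos (Real.pi / (2 * n)) - Real.sin (Real.pi / (2 * n)) * Complex.I := by
  rw [cis, Complex.exp_mul_I, ← Complex.ofReal_cos, ← Complex.ofReal_sin, mul_neg, mul_one_div,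
    neg_div, div_div, Real.cos_neg, Real.sin_neg, Complex.ofReal_neg, neg_mul, ← sub_eq_add_neg]

theorem corner_eq_normal_mul (n : ℕ) (r : ℝ) (k : ℤ) :
    corner n r k = normal n k * (apothem n r - halfSide n r * Complex.I) := by
  have hk : (k : ℝ) = k + 1 / 2 + -(1 / 2) := by ring
  unfold corner normal apothem halfSide
  rw [hk, cis_add, cis_neg_half, ← hk]
  push_cast
  ring

theorem corner_succ_eq_normal_mul (n : ℕ) (r : ℝ) (k : ℤ) :
    corner n r (k + 1) = normal n k * (apothem n r + halfSide n r * Complex.I) := by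
  have hk : ((k + 1 : ℤ) : ℝ) = k + 1 / 2 + 1 / 2 := by push_cast; ring
  unfold corner normal apothem halfSide
  rw [hk, cis_add, cis_half]
  push_cast
  ring

theorem corner_add_corner_succ (n : ℕ) (r : ℝ) (k : ℤ) :
    corner n r k + corner n r (k + 1) = 2 * apothem n r * normal n k := by
  rw [corner_eq_normal_mul, corner_succ_eq_normal_mul]
  ring

theorem height_corner (n : ℕ) (r : ℝ) (j k : ℤ) :
    height n j (corner n r k) = r * Real.cos (Real.pi * (k - j - 1 / 2) / n) := by
  rw [height_apply, corner, mul_assoc, ← cis_add, Complex.re_ofReal_mul, cis_re, ← sub_eq_add_neg,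
    sub_add_eq_sub_sub]

theorem apothem_sub_height_corner (n : ℕ) (r : ℝ) (j k : ℤ) :
    apothem n r - height n j (corner n r k) =
      2 * r * (Real.sin (Real.pi * (k - j) / (2 * n)) *
        Real.sin (Real.pi * (k - j - 1) / (2 * n))) := by
  have hadd : (Real.pi / (2 * n) + Real.pi * (k - j - 1 / 2) / n) / 2 =
      Real.pi * (k - j) / (2 * n) := by
    rw [div_mul_eq_div_div, div_mul_eq_div_div]
    ring
  have hsub : (Real.pi / (2 * n) - Real.pi * (k - j - 1 / 2) / n) / 2 =
      -(Real.pi * (k - j - 1) / (2 * n)) := by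
    rw [div_mul_eq_div_div, div_mul_eq_div_div]
    ring
  rw [height_corner, apothem, ← mul_sub, Real.cos_sub_cos, hadd, hsub, Real.sin_neg]
  ring

@[simp] theorem height_corner_self (n : ℕ) (r : ℝ) (k : ℤ) :
    height n k (corner n r k) = apothem n r := by
  have h := apothem_sub_height_corner n r k k
  rw [sub_self, mul_zero, zero_div, Real.sin_zero, zero_mul, mul_zero] at h
  exact (sub_eq_zero.1 h).symm

@[simp] theorem height_corner_succ (n : ℕ) (r : ℝ) (k : ℤ) :
    height n k (corner n r (k + 1)) = apothem n r := by
  have h := apothem_sub_height_corner n r k (k + 1)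
  rw [Int.cast_add, Int.cast_one, add_sub_cancel_left, sub_self, mul_zero, zero_div, Real.sin_zero,
    mul_zero, mul_zero] at h
  exact (sub_eq_zero.1 h).symm

theorem sin_pi_mul_div_pos {x y : ℝ} (hx : 0 < x) (hxy : x < y) :
    0 < Real.sin (Real.pi * x / y) := by
  have := Real.pi_pos
  have hy : 0 < y := hx.trans hxy
  refine Real.sin_pos_of_pos_of_lt_pi (by positivity) ?_
  rw [div_lt_iff₀ hy]
  gcongr

theorem height_corner_lt (hn : n ≠ 0) (hr : 0 < r) {j k : ℤ} (h0 : ¬ (2 * n : ℤ) ∣ k - j)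
    (h1 : ¬ (2 * n : ℤ) ∣ k - j - 1) : height n j (corner n r k) < apothem n r := by
  obtain ⟨m, hm, hd⟩ := exists_nat_dvd_sub hn (k - j)
  have hd' : (2 * n : ℤ) ∣ k - (j + m) := by rwa [sub_add_eq_sub_sub]
  have hm0 : m ≠ 0 := by
    rintro rfl
    exact h0 (by simpa using hd)
  have hm1 : m ≠ 1 := by
    rintro rfl
    exact h1 (by simpa using hd)
  have hm2 : (2 : ℝ) ≤ m := by exact_mod_cast (by omega : 2 ≤ m)
  have hmn : (m : ℝ) < 2 * n := by exact_mod_cast hm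
  have hsin := sin_pi_mul_div_pos (by linarith : (0 : ℝ) < m) hmn
  have hsin' := sin_pi_mul_div_pos (by linarith : (0 : ℝ) < m - 1) (by linarith : _ < 2 * (n : ℝ))
  rw [corner_congr hn hd', ← sub_pos, apothem_sub_height_corner, Int.cast_add, Int.cast_natCast,
    add_sub_cancel_left]
  positivity

theorem height_corner_eq_iff (hn : n ≠ 0) (hr : 0 < r) {j k : ℤ} :
    height n j (corner n r k) = apothem n r ↔
      (2 * n : ℤ) ∣ k - j ∨ (2 * n : ℤ) ∣ k - j - 1 := by
  constructor
  · contrapose!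
    exact fun h => (height_corner_lt hn hr h.1 h.2).ne
  · rintro (h | h)
    · rw [corner_congr hn h, height_corner_self]
    · rw [sub_sub] at h
      rw [corner_congr hn h, height_corner_succ]

theorem height_corner_le (hn : n ≠ 0) (hr : 0 < r) (j k : ℤ) :
    height n j (corner n r k) ≤ apothem n r := by
  by_cases h : (2 * n : ℤ) ∣ k - j ∨ (2 * n : ℤ) ∣ k - j - 1
  · exact ((height_corner_eq_iff hn hr).2 h).le
  · push Not at h
    exact (height_corner_lt hn hr h.1 h.2).le

theorem height_le_of_mem (hn : n ≠ 0) (hr : 0 < r) {z : ℂ} (hz : z ∈ polygon n r) (j : ℤ) :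
    height n j z ≤ apothem n r := by
  refine convexHull_min ?_ (convex_halfSpace_le (height n j).isLinear (apothem n r)) hz
  rw [range_vertex hn]
  rintro _ ⟨k, rfl⟩
  exact height_corner_le hn hr j k

theorem cis_eq_combo (hn : 2 ≤ n) (s : ℝ) :
    cis n s = (Real.sin (Real.pi * (1 - s) / n) / Real.sin (Real.pi / n) : ℝ) +
      (Real.sin (Real.pi * s / n) / Real.sin (Real.pi / n) : ℝ) * cis n 1 := by
  have hsin : 0 < Real.sin (Real.pi / n) := by
    simpa using sin_pi_mul_div_pos one_pos (by exact_mod_cast hn : (1 : ℝ) < n)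
  apply Complex.ext
  · have hsub : Real.pi * (1 - s) / n = Real.pi / n - Real.pi * s / n := by ring
    simp only [Complex.add_re, Complex.ofReal_re, Complex.re_ofReal_mul, cis_re, mul_one]
    rw [hsub, Real.sin_sub]
    field_simp
    ring
  · simp only [Complex.add_im, Complex.ofReal_im, Complex.im_ofReal_mul, cis_im, mul_one]
    rw [zero_add, div_mul_cancel₀ _ hsin.ne']

theorem sin_pi_mul_div_nonneg (n : ℕ) {s : ℝ} (h0 : 0 ≤ s) (h1 : s ≤ 1) :
    0 ≤ Real.sin (Real.pi * s / n) := by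
  have hpi := Real.pi_pos
  refine Real.sin_nonneg_of_nonneg_of_le_pi (by positivity) ?_
  rcases n.eq_zero_or_pos with rfl | hn
  · simpa using hpi.le
  · have hn' : (1 : ℝ) ≤ n := by exact_mod_cast hn
    rw [div_le_iff₀ (by positivity)]
    gcongr
    exact h1.trans hn'

theorem exists_norm_mul_cis (hn : n ≠ 0) (z : ℂ) : ∃ x : ℝ, |x| ≤ n ∧ z = ‖z‖ * cis n x := by
  have hpi := Real.pi_pos
  refine ⟨n * z.arg / Real.pi, ?_, ?_⟩
  · rw [abs_div, abs_mul, abs_of_pos hpi, Nat.abs_cast, div_le_iff₀ hpi]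
    exact mul_le_mul_of_nonneg_left (Complex.abs_arg_le_pi z) n.cast_nonneg
  · rw [cis, show Real.pi * (n * z.arg / Real.pi) / n = z.arg by field_simp]
    exact (Complex.norm_mul_exp_arg_mul_I z).symm

theorem exists_combo_corner (hn : 2 ≤ n) (hr : 0 < r) (z : ℂ) :
    ∃ (k : ℤ) (a b : ℝ), 0 ≤ a ∧ 0 ≤ b ∧ z = a * corner n r k + b * corner n r (k + 1) := by
  obtain ⟨x, -, hx⟩ := exists_norm_mul_cis (by omega : n ≠ 0) z
  have hsin : 0 ≤ Real.sin (Real.pi / n) := by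
    simpa using sin_pi_mul_div_nonneg n zero_le_one le_rfl
  have hsin0 := sin_pi_mul_div_nonneg n (Int.fract_nonneg x) (Int.fract_lt_one x).le
  have hsin1 := sin_pi_mul_div_nonneg n (sub_nonneg.2 (Int.fract_lt_one x).le)
    (sub_le_self _ (Int.fract_nonneg x))
  refine ⟨⌊x⌋, ‖z‖ * (Real.sin (Real.pi * (1 - Int.fract x) / n) / Real.sin (Real.pi / n)) / r,
    ‖z‖ * (Real.sin (Real.pi * Int.fract x / n) / Real.sin (Real.pi / n)) / r,
    by positivity, by positivity, ?_⟩
  have hr' : (r : ℂ) ≠ 0 := by exact_mod_cast hr.ne'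
  conv_lhs => rw [hx, ← Int.floor_add_fract x, cis_add, cis_eq_combo hn (Int.fract x)]
  unfold corner
  push_cast
  rw [cis_add]
  field_simp

theorem mem_polygon_iff (hn : 2 ≤ n) (hr : 0 < r) (z : ℂ) :
    z ∈ polygon n r ↔ ∀ j, height n j z ≤ apothem n r := by
  have hn' : n ≠ 0 := by omega
  refine ⟨fun h j => height_le_of_mem hn' hr h j, fun h => ?_⟩
  obtain ⟨k, a, b, ha, hb, rfl⟩ := exists_combo_corner hn hr z
  have hab : a + b ≤ 1 := by
    have hk := h k
    rw [map_add, height_ofReal_mul, height_ofReal_mul, height_corner_self, height_corner_succ,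
      ← add_mul] at hk
    exact le_of_mul_le_mul_right (by rwa [one_mul]) (apothem_pos hn hr)
  rcases (add_nonneg ha hb).eq_or_lt with h0 | hpos
  · obtain ⟨rfl, rfl⟩ : a = 0 ∧ b = 0 := ⟨by linarith, by linarith⟩
    simpa using zero_mem_polygon hn' r
  · have hmem := (convex_polygon n r).smul_mem_of_zero_mem (zero_mem_polygon hn' r)
      ((convex_polygon n r) (corner_mem_polygon hn' k) (corner_mem_polygon hn' (k + 1))
        (div_nonneg ha hpos.le) (div_nonneg hb hpos.le) (by rw [← add_div, div_self hpos.ne']))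
      ⟨hpos.le, hab⟩
    rwa [smul_add, smul_smul, smul_smul, mul_div_cancel₀ _ hpos.ne',
      mul_div_cancel₀ _ hpos.ne'] at hmem

theorem openPolygon_subset_polygon (hn : 2 ≤ n) (hr : 0 < r) : openPolygon n r ⊆ polygon n r :=
  fun z hz => (mem_polygon_iff hn hr z).2 fun j => (hz j).le

theorem abs_offset_le (hn : 2 ≤ n) (hr : 0 < r) {k : ℤ} {z : ℂ} (hz : z ∈ polygon n r)
    (hk : height n k z = apothem n r) : |offset n k z| ≤ halfSide n r := by
  have hcos := cos_half_angle_pos hn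
  have hsin := sin_half_angle_pos hn
  set α := Real.pi / (2 * n) with hα
  have hα2 : Real.pi / n = 2 * α := by rw [hα]; ring
  have hsin2 : 0 < Real.sin (2 * α) := by rw [Real.sin_two_mul]; positivity
  have hchord : apothem n r - apothem n r * Real.cos (2 * α) =
      halfSide n r * Real.sin (2 * α) := by
    rw [apothem, halfSide, ← hα, Real.cos_two_mul, Real.sin_two_mul]
    linear_combination (2 * r * Real.cos α) * (-1) * (Real.sin_sq_add_cos_sq α)
  have hnext := height_le_of_mem (by omega) hr hz (k + 1)
  have hprev := height_le_of_mem (by omega) hr hz (k + -1)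
  rw [height_add_int, hk, Int.cast_one, mul_one, hα2] at hnext
  rw [height_add_int, hk, Int.cast_neg, Int.cast_one, mul_neg_one, neg_div, hα2, Real.cos_neg,
    Real.sin_neg] at hprev
  refine abs_le.2 ⟨?_, ?_⟩ <;> refine le_of_mul_le_mul_right ?_ hsin2 <;> linarith

theorem mem_segment_corner_iff (hn : 2 ≤ n) (hr : 0 < r) (k : ℤ) (z : ℂ) :
    z ∈ segment ℝ (corner n r k) (corner n r (k + 1)) ↔
      z ∈ polygon n r ∧ height n k z = apothem n r := by
  have hn' : n ≠ 0 := by omega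
  constructor
  · intro h
    refine ⟨(convex_polygon n r).segment_subset (corner_mem_polygon hn' _)
      (corner_mem_polygon hn' _) h, ?_⟩
    obtain ⟨a, b, -, -, hab, rfl⟩ := h
    rw [map_add, map_smul, map_smul, height_corner_self, height_corner_succ, ← add_smul, hab,
      one_smul]
  · rintro ⟨hz, hk⟩
    obtain ⟨hlo, hup⟩ := abs_le.1 (abs_offset_le hn hr hz hk)
    have hs := halfSide_pos hn hr
    have hs' : (halfSide n r : ℂ) ≠ 0 := by exact_mod_cast hs.ne'
    refine ⟨(halfSide n r - offset n k z) / (2 * halfSide n r),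
      (halfSide n r + offset n k z) / (2 * halfSide n r),
      div_nonneg (by linarith) (by linarith), div_nonneg (by linarith) (by linarith),
      by field_simp; ring, ?_⟩
    conv_rhs => rw [eq_normal_mul n k z, hk]
    rw [Complex.real_smul, Complex.real_smul, corner_eq_normal_mul, corner_succ_eq_normal_mul]
    push_cast
    field_simp
    ring

theorem mem_side_iff (hn : 2 ≤ n) (hr : 0 < r) (k : ℕ) (z : ℂ) :
    z ∈ side n r k ↔ z ∈ polygon n r ∧ height n k z = apothem n r := by
  rw [← mem_segment_corner_iff hn hr, side, vertex_eq_corner, vertex_eq_corner, Nat.cast_succ]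

theorem eq_of_combo_eq {a b x y m : ℝ} (ha : 0 < a) (hb : 0 < b) (hab : a + b = 1) (hx : x ≤ m)
    (hy : y ≤ m) (h : a * x + b * y = m) : x = m ∧ y = m := by
  have hsum : a * (m - x) + b * (m - y) = 0 := by linear_combination m * hab - h
  have hax := mul_nonneg ha.le (sub_nonneg.2 hx)
  have hby := mul_nonneg hb.le (sub_nonneg.2 hy)
  have hx' := (mul_eq_zero.1 (by linarith : a * (m - x) = 0)).resolve_left ha.ne'
  have hy' := (mul_eq_zero.1 (by linarith : b * (m - y) = 0)).resolve_left hb.ne'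
  exact ⟨(sub_eq_zero.1 hx').symm, (sub_eq_zero.1 hy').symm⟩

theorem mem_range_corner_of_height_eq (hn : 2 ≤ n) (hr : 0 < r) {z : ℂ} (hz : z ∈ polygon n r)
    {j k : ℤ} (hj : height n j z = apothem n r) (hk : height n k z = apothem n r)
    (hjk : ¬ (2 * n : ℤ) ∣ j - k) : z ∈ range (corner n r) := by
  have hn' : n ≠ 0 := by omega
  obtain ⟨a, b, ha, hb, hab, rfl⟩ := (mem_segment_corner_iff hn hr k z).2 ⟨hz, hk⟩
  rcases ha.eq_or_lt with rfl | ha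
  · exact ⟨k + 1, by simp [show b = 1 by linarith]⟩
  rcases hb.eq_or_lt with rfl | hb
  · exact ⟨k, by simp [show a = 1 by linarith]⟩
  exfalso
  rw [map_add, map_smul, map_smul] at hj
  obtain ⟨hj0, hj1⟩ := eq_of_combo_eq ha hb hab (height_corner_le hn' hr j k)
    (height_corner_le hn' hr j (k + 1)) hj
  have hne : ¬ (2 * n : ℤ) ∣ k - j := fun h => hjk (dvd_sub_comm.1 h)
  have hd := ((height_corner_eq_iff hn' hr).1 hj0).resolve_left hne
  rcases (height_corner_eq_iff hn' hr).1 hj1 with h | h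
  · have h2 := dvd_sub h hd
    rw [show k + 1 - j - (k - j - 1) = 2 by ring] at h2
    have := Int.le_of_dvd two_pos h2
    omega
  · exact hne (by rwa [show k + 1 - j - 1 = k - j by ring] at h)

end Geometry

section Gluing

variable {n : ℕ} {r : ℝ}

/-- The image of a point of the side `k` on the opposite side, under the translation of the whole
plane that carries the side `k` to the opposite one. -/
def crossing (n : ℕ) (r : ℝ) (k : ℤ) (z : ℂ) : ℂ := z - 2 * apothem n r * normal n k

/-- The midpoint of the `k`-th side. -/
def sideMidpoint (n : ℕ) (r : ℝ) (k : ℤ) : ℂ := apothem n r * normal n k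

/-- The relation, on the polygon, of having the same image in the surface when all vertices are
identified. -/
def Related (n : ℕ) (r : ℝ) (z w : ℂ) : Prop :=
  z = w ∨ (∃ k : ℤ, height n k z = apothem n r ∧ w = crossing n r k z) ∨
    (z ∈ range (corner n r) ∧ w ∈ range (corner n r))

/-- The vertices of even index; they are told apart from the other vertices by a gluing of sides
when `n` is odd. -/
def IsEvenCorner (n : ℕ) (r : ℝ) (z : ℂ) : Prop := ∃ k : ℤ, Even k ∧ z = corner n r k

theorem corner_eq_corner_iff (hn : 2 ≤ n) (hr : 0 < r) {j k : ℤ} :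
    corner n r j = corner n r k ↔ (2 * n : ℤ) ∣ j - k := by
  have hn' : n ≠ 0 := by omega
  refine ⟨fun h => ?_, corner_congr hn'⟩
  have hself : height n j (corner n r k) = apothem n r := h ▸ height_corner_self n r j
  have hpred : height n (j - 1) (corner n r k) = apothem n r := by
    rw [← h, ← height_corner_succ n r (j - 1), sub_add_cancel]
  rw [dvd_sub_comm]
  refine ((height_corner_eq_iff hn' hr).1 hself).elim id fun hd => ?_
  refine ((height_corner_eq_iff hn' hr).1 hpred).elim (fun hd' => ?_) fun hd' => ?_
  · have h2 := dvd_sub hd' hd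
    rw [show k - (j - 1) - (k - j - 1) = 2 by ring] at h2
    have := Int.le_of_dvd two_pos h2
    omega
  · rwa [show k - (j - 1) - 1 = k - j by ring] at hd'

theorem norm_corner (hr : 0 ≤ r) (k : ℤ) : ‖corner n r k‖ = r := by
  rw [corner, norm_mul, norm_cis, mul_one, Complex.norm_of_nonneg hr]

theorem apothem_lt (hn : 2 ≤ n) (hr : 0 < r) : apothem n r < r := by
  have hpos := half_angle_pos (n := n) (by omega)
  have hle := half_angle_le hn
  have hcos := Real.cos_lt_cos_of_nonneg_of_le_pi le_rfl (by linarith [Real.pi_pos]) hpos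
  rw [Real.cos_zero] at hcos
  exact mul_lt_of_lt_one_right hr hcos

theorem vertex_sub_vertex (hn : n ≠ 0) (r : ℝ) (k : ℕ) :
    vertex n r (k + n + 1) - vertex n r k = -(2 * apothem n r * normal n k) := by
  have hk : ((k + n + 1 : ℕ) : ℤ) = k + 1 + n := by push_cast; ring
  rw [vertex_eq_corner, vertex_eq_corner, ← corner_add_corner_succ, hk, corner_add_self hn]
  ring

theorem crossing_congr (hn : n ≠ 0) {j k : ℤ} (h : (2 * n : ℤ) ∣ j - k) (z : ℂ) :
    crossing n r j z = crossing n r k z := by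
  rw [crossing, crossing, normal_congr hn h]

theorem crossing_corner (hn : n ≠ 0) (r : ℝ) (k : ℤ) :
    crossing n r k (corner n r k) = corner n r (k + n + 1) := by
  rw [crossing, ← corner_add_corner_succ, add_right_comm, corner_add_self hn]
  ring

theorem crossing_corner_succ (hn : n ≠ 0) (r : ℝ) (k : ℤ) :
    crossing n r k (corner n r (k + 1)) = corner n r (k + n) := by
  rw [crossing, ← corner_add_corner_succ, corner_add_self hn]
  ring

theorem crossing_crossing (hn : n ≠ 0) (r : ℝ) (k : ℤ) (z : ℂ) :
    crossing n r (k + n) (crossing n r k z) = z := by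
  rw [crossing, crossing, normal_add_self hn]
  ring

theorem height_crossing (n : ℕ) (r : ℝ) (k : ℤ) (z : ℂ) :
    height n k (crossing n r k z) = height n k z - 2 * apothem n r := by
  rw [crossing, map_sub, ← Complex.ofReal_ofNat, ← Complex.ofReal_mul, height_ofReal_mul,
    height_normal, mul_one]

theorem height_crossing_opposite (hn : n ≠ 0) {k : ℤ} {z : ℂ}
    (h : height n k z = apothem n r) : height n (k + n) (crossing n r k z) = apothem n r := by
  rw [height_add_self hn, height_crossing, h]
  ring

theorem eq_corner_of_height_eq (hn : n ≠ 0) (hr : 0 < r) {k : ℤ} {z : ℂ}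
    (hz : z ∈ range (corner n r)) (h : height n k z = apothem n r) :
    z = corner n r k ∨ z = corner n r (k + 1) := by
  obtain ⟨j, rfl⟩ := hz
  refine ((height_corner_eq_iff hn hr).1 h).imp (corner_congr hn) fun hd => corner_congr hn ?_
  rwa [← sub_sub]

theorem crossing_mem_range_corner_iff (hn : n ≠ 0) (hr : 0 < r) {k : ℤ} {z : ℂ}
    (h : height n k z = apothem n r) :
    crossing n r k z ∈ range (corner n r) ↔ z ∈ range (corner n r) := by
  have himp : ∀ (k : ℤ) (z : ℂ), height n k z = apothem n r → z ∈ range (corner n r) →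
      crossing n r k z ∈ range (corner n r) := by
    intro k z h hz
    rcases eq_corner_of_height_eq hn hr hz h with rfl | rfl
    · exact ⟨_, (crossing_corner hn r k).symm⟩
    · exact ⟨_, (crossing_corner_succ hn r k).symm⟩
  refine ⟨fun hc => ?_, himp k z h⟩
  rw [← crossing_crossing hn r k z]
  exact himp _ _ (height_crossing_opposite hn h) hc

theorem crossing_mem_polygon (hn : 2 ≤ n) (hr : 0 < r) {k : ℤ} {z : ℂ} (hz : z ∈ polygon n r)
    (h : height n k z = apothem n r) : crossing n r k z ∈ polygon n r := by
  have hn' : n ≠ 0 := by omega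
  obtain ⟨a, b, ha, hb, hab, rfl⟩ := (mem_segment_corner_iff hn hr k z).2 ⟨hz, h⟩
  have hcombo : crossing n r k (a • corner n r k + b • corner n r (k + 1)) =
      a • corner n r (k + n + 1) + b • corner n r (k + n) := by
    have hab' : (a : ℂ) + b = 1 := by exact_mod_cast hab
    rw [← crossing_corner hn', ← crossing_corner_succ hn']
    simp only [crossing, Complex.real_smul]
    linear_combination (2 * (apothem n r : ℂ) * normal n k) * hab'
  rw [hcombo]
  exact convex_polygon n r (corner_mem_polygon hn' _) (corner_mem_polygon hn' _) ha hb hab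

theorem glue_iff (hn : 2 ≤ n) (hr : 0 < r) (z w : polygon n r) :
    Glue n r z w ↔ ∃ k : ℤ, height n k z = apothem n r ∧ (w : ℂ) = crossing n r k z := by
  have hn' : n ≠ 0 := by omega
  constructor
  · rintro ⟨k, hk, hw⟩
    refine ⟨k, ((mem_side_iff hn hr k z).1 hk).2, ?_⟩
    rw [hw, vertex_sub_vertex hn', crossing, sub_eq_add_neg]
  · rintro ⟨k, hk, hw⟩
    obtain ⟨m, -, hd⟩ := exists_nat_dvd_sub hn' k
    refine ⟨m, (mem_side_iff hn hr m z).2 ⟨z.2, by rw [← hk, height_congr hn' hd]⟩, ?_⟩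
    rw [hw, crossing_congr hn' hd, vertex_sub_vertex hn', crossing, sub_eq_add_neg]

theorem isEvenCorner_corner_iff (hn : 2 ≤ n) (hr : 0 < r) (k : ℤ) :
    IsEvenCorner n r (corner n r k) ↔ Even k := by
  refine ⟨?_, fun hk => ⟨k, hk, rfl⟩⟩
  rintro ⟨j, hj, hjk⟩
  obtain ⟨m, hm⟩ := (corner_eq_corner_iff hn hr).1 hjk
  rw [show k = j + 2 * (n * m) by linarith]
  exact hj.add (even_two_mul _)

theorem isEvenCorner_crossing_iff (hn : 2 ≤ n) (hr : 0 < r) (hodd : Odd n) {k : ℤ} {z : ℂ}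
    (hz : height n k z = apothem n r) :
    IsEvenCorner n r (crossing n r k z) ↔ IsEvenCorner n r z := by
  have hn' : n ≠ 0 := by omega
  by_cases hc : z ∈ range (corner n r)
  · rcases eq_corner_of_height_eq hn' hr hc hz with rfl | rfl
    · rw [crossing_corner hn', isEvenCorner_corner_iff hn hr, isEvenCorner_corner_iff hn hr]
      grind
    · rw [crossing_corner_succ hn', isEvenCorner_corner_iff hn hr, isEvenCorner_corner_iff hn hr]
      grind
  · have hc' := mt (crossing_mem_range_corner_iff hn' hr hz).1 hc
    constructor
    · rintro ⟨j, -, hj⟩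
      exact absurd ⟨j, hj.symm⟩ hc'
    · rintro ⟨j, -, hj⟩
      exact absurd ⟨j, hj.symm⟩ hc

theorem even_of_oneVertex (hn : 2 ≤ n) (hr : 0 < r) (h1 : OneVertex n r) : Even n := by
  by_contra hodd
  rw [Nat.not_even_iff_odd] at hodd
  let parity : Surface n r → Prop := Quot.lift (fun z : polygon n r => IsEvenCorner n r z) (by
    intro z w hzw
    obtain ⟨k, hk, hw⟩ := (glue_iff hn hr z w).1 hzw
    rw [hw, isEvenCorner_crossing_iff hn hr hodd hk])
  have hpar : parity (vertexPoint n r 1) = parity (vertexPoint n r 0) := by rw [h1 1]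
  change IsEvenCorner n r (vertex n r 1) = IsEvenCorner n r (vertex n r 0) at hpar
  rw [vertex_eq_corner, vertex_eq_corner, eq_iff_iff, isEvenCorner_corner_iff hn hr,
    isEvenCorner_corner_iff hn hr] at hpar
  simp at hpar

theorem vertexPoint_periodic (n : ℕ) (r : ℝ) : (vertexPoint n r).Periodic (n + 1) := fun k =>
  (Quot.sound ⟨k, left_mem_segment ℝ _ _, (add_sub_cancel _ _).symm⟩).symm

theorem vertexPoint_eq_proj {k : ℕ} {z : polygon n r} (h : vertex n r k = z) :
    vertexPoint n r k = proj n r z :=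
  congrArg (proj n r) (Subtype.ext h)

theorem oneVertex_of_even (hn : n ≠ 0) (h : Even n) (r : ℝ) : OneVertex n r := by
  obtain ⟨m, rfl⟩ := h
  intro k
  induction k with
  | zero => rfl
  | succ k ih =>
    -- `n + 1` turns of the period `n + 1` advance by one vertex, modulo `2 n`.
    rw [← ih, ← (vertexPoint_periodic (m + m) r).nat_mul (m + m + 1) k]
    refine vertexPoint_eq_proj ?_
    change vertex (m + m) r _ = vertex (m + m) r _
    rw [vertex_eq_corner, vertex_eq_corner]
    refine corner_congr hn ⟨-(m + 1), ?_⟩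
    push_cast
    ring

theorem Related.symm (hn : n ≠ 0) {z w : ℂ} (h : Related n r z w) : Related n r w z := by
  rcases h with rfl | ⟨k, hk, rfl⟩ | ⟨hz, hw⟩
  · exact Or.inl rfl
  · exact Or.inr (Or.inl ⟨k + n, height_crossing_opposite hn hk, (crossing_crossing hn r k z).symm⟩)
  · exact Or.inr (Or.inr ⟨hw, hz⟩)

theorem Related.mem_range_corner (hn : n ≠ 0) (hr : 0 < r) {z w : ℂ} (h : Related n r z w)
    (hz : z ∈ range (corner n r)) : w ∈ range (corner n r) := by
  rcases h with rfl | ⟨k, hk, rfl⟩ | ⟨-, hw⟩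
  · exact hz
  · exact (crossing_mem_range_corner_iff hn hr hk).2 hz
  · exact hw

theorem Related.trans (hn : 2 ≤ n) (hr : 0 < r) {z w x : ℂ} (hw : w ∈ polygon n r)
    (h : Related n r z w) (h' : Related n r w x) : Related n r z x := by
  have hn' : n ≠ 0 := by omega
  by_cases hc : w ∈ range (corner n r)
  · exact Or.inr (Or.inr ⟨(h.symm hn').mem_range_corner hn' hr hc, h'.mem_range_corner hn' hr hc⟩)
  rcases h with rfl | ⟨k, hk, rfl⟩ | ⟨-, hw'⟩
  · exact h'
  · rcases h' with rfl | ⟨j, hj, rfl⟩ | ⟨hw', -⟩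
    · exact Or.inr (Or.inl ⟨k, hk, rfl⟩)
    · left
      have hd : (2 * n : ℤ) ∣ j - (k + n) := by
        by_contra hd
        exact hc (mem_range_corner_of_height_eq hn hr hw hj (height_crossing_opposite hn' hk) hd)
      rw [crossing_congr hn' hd, crossing_crossing hn']
    · exact absurd hw' hc
  · exact absurd hw' hc

theorem related_of_eqvGen (hn : 2 ≤ n) (hr : 0 < r) {z w : polygon n r}
    (h : Relation.EqvGen (Glue n r) z w) : Related n r z w := by
  induction h with
  | rel z w hzw => exact Or.inr (Or.inl ((glue_iff hn hr z w).1 hzw))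
  | refl z => exact Or.inl rfl
  | symm z w _ ih => exact ih.symm (by omega)
  | trans z w x _ _ ih ih' => exact ih.trans hn hr w.2 ih'

theorem proj_eq_vertexPoint (hn : n ≠ 0) (h1 : OneVertex n r) {z : polygon n r}
    (hz : (z : ℂ) ∈ range (corner n r)) : proj n r z = vertexPoint n r 0 := by
  obtain ⟨k, hk⟩ := hz
  obtain ⟨m, -, hm⟩ := exists_vertex_eq_corner hn r k
  rw [← h1 m, vertexPoint_eq_proj (hm.trans hk)]

theorem proj_eq_proj_iff (hn : 2 ≤ n) (hr : 0 < r) (h1 : OneVertex n r) (z w : polygon n r) :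
    proj n r z = proj n r w ↔ Related n r z w := by
  refine ⟨fun h => related_of_eqvGen hn hr (Quot.eqvGen_exact h), ?_⟩
  rintro (h | h | ⟨hz, hw⟩)
  · rw [Subtype.ext h]
  · exact Quot.sound ((glue_iff hn hr z w).2 h)
  · rw [proj_eq_vertexPoint (by omega) h1 hz, proj_eq_vertexPoint (by omega) h1 hw]

theorem continuous_proj (n : ℕ) (r : ℝ) : Continuous (proj n r) := continuous_quot_mk

theorem proj_surjective (n : ℕ) (r : ℝ) : Function.Surjective (proj n r) := Quot.mk_surjective

theorem t2Space_of_isProperMap {X Y : Type*} [TopologicalSpace X] [TopologicalSpace Y] [T2Space X]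
    {f : X → Y} (hf : IsProperMap f) (hs : Function.Surjective f) : T2Space Y := by
  rw [t2_iff_isClosed_diagonal]
  have himage : Prod.map f f '' diagonal X = diagonal Y := by
    rw [← range_diag, ← range_diag, ← range_comp]
    exact hs.range_comp fun y => (y, y)
  rw [← himage]
  exact (hf.prodMap hf).isClosedMap _ isClosed_diagonal

theorem isClosedMap_of_isClosed_ker {X Y : Type*} [TopologicalSpace X] [TopologicalSpace Y]
    [CompactSpace X] {f : X → Y} (hf : IsQuotientMap f)
    (hker : IsClosed {q : X × X | f q.1 = f q.2}) : IsClosedMap f := by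
  intro C hC
  have hsat : f ⁻¹' (f '' C) = Prod.snd '' ((C ×ˢ univ) ∩ {q : X × X | f q.1 = f q.2}) := by
    ext w
    constructor
    · rintro ⟨z, hz, hzw⟩
      exact ⟨(z, w), ⟨⟨hz, trivial⟩, hzw⟩, rfl⟩
    · rintro ⟨⟨z, w⟩, ⟨⟨hz, -⟩, hzw⟩, rfl⟩
      exact ⟨z, hz, hzw⟩
  rw [← hf.isClosed_preimage, hsat]
  exact isClosedMap_snd_of_compactSpace _ ((hC.prod isClosed_univ).inter hker)

theorem t2Space_of_isClosed_ker {X Y : Type*} [TopologicalSpace X] [TopologicalSpace Y]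
    [CompactSpace X] [T2Space X] {f : X → Y} (hf : IsQuotientMap f)
    (hker : IsClosed {q : X × X | f q.1 = f q.2}) : T2Space Y := by
  have hclosed := isClosedMap_of_isClosed_ker hf hker
  refine t2Space_of_isProperMap ?_ hf.surjective
  refine isProperMap_iff_isClosedMap_and_compact_fibers.2 ⟨hf.continuous, hclosed, fun y => ?_⟩
  obtain ⟨x, rfl⟩ := hf.surjective y
  rw [← image_singleton]
  exact ((hclosed _ isClosed_singleton).preimage hf.continuous).isCompact

theorem isClosed_related (hn : n ≠ 0) (r : ℝ) : IsClosed {q : ℂ × ℂ | Related n r q.1 q.2} := by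
  have hunion : {q : ℂ × ℂ | Related n r q.1 q.2} = {q : ℂ × ℂ | q.1 = q.2} ∪
      ((⋃ m ∈ Finset.range (2 * n), {q : ℂ × ℂ | height n m q.1 = apothem n r} ∩
        {q : ℂ × ℂ | q.2 = crossing n r m q.1}) ∪
      (range (corner n r)) ×ˢ (range (corner n r))) := by
    ext ⟨z, w⟩
    refine or_congr Iff.rfl (or_congr ?_ Iff.rfl)
    simp only [mem_iUnion, mem_inter_iff, mem_ofPred_eq, Finset.mem_range, exists_prop]
    constructor
    · rintro ⟨k, hk, hw⟩
      obtain ⟨m, hm, hd⟩ := exists_nat_dvd_sub hn k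
      exact ⟨m, hm, by rw [← hk, height_congr hn hd], by rw [hw, crossing_congr hn hd]⟩
    · rintro ⟨m, -, hm⟩
      exact ⟨m, hm⟩
  have hcorner := (finite_range_corner hn r).isClosed
  rw [hunion]
  refine (isClosed_eq continuous_fst continuous_snd).union (.union ?_ (hcorner.prod hcorner))
  refine isClosed_biUnion_finset fun m _ => ?_
  unfold crossing
  exact (isClosed_eq (by fun_prop) (by fun_prop)).inter (isClosed_eq (by fun_prop) (by fun_prop))

theorem compactSpace_polygon (hn : n ≠ 0) (r : ℝ) : CompactSpace (polygon n r) :=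
  isCompact_iff_compactSpace.1 (isCompact_polygon hn r)

theorem t2Space_surface (hn : 2 ≤ n) (hr : 0 < r) (h1 : OneVertex n r) :
    T2Space (Surface n r) := by
  have hn' : n ≠ 0 := by omega
  have := compactSpace_polygon hn' r
  refine t2Space_of_isClosed_ker (f := proj n r) isQuotientMap_quot_mk ?_
  simp only [proj_eq_proj_iff hn hr h1]
  exact (isClosed_related hn' r).preimage
    (f := fun q : polygon n r × polygon n r => ((q.1 : ℂ), (q.2 : ℂ))) (by fun_prop)

theorem compactSpace_surface (hn : n ≠ 0) (r : ℝ) : CompactSpace (Surface n r) := by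
  have := compactSpace_polygon hn r
  infer_instance

theorem connectedSpace_surface (hn : n ≠ 0) (r : ℝ) : ConnectedSpace (Surface n r) := by
  have hconn : IsConnected (polygon n r) :=
    ⟨⟨0, zero_mem_polygon hn r⟩, (convex_polygon n r).isPreconnected⟩
  have := isConnected_iff_connectedSpace.1 hconn
  exact (proj_surjective n r).connectedSpace (continuous_proj n r)

theorem edge_congr (hn : 2 ≤ n) (hr : 0 < r) {j k : ℕ} (h : (2 * n : ℤ) ∣ j - k) :
    edge n r j = edge n r k := by
  have hside : side n r j = side n r k := by
    ext z
    rw [mem_side_iff hn hr, mem_side_iff hn hr, height_congr (by omega) h]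
  rw [edge, edge, hside]

theorem edge_subset_edge_opposite (hn : 2 ≤ n) (hr : 0 < r) (k : ℕ) :
    edge n r k ⊆ edge n r (k + n) := by
  rintro _ ⟨z, hz, rfl⟩
  have hz' := ((mem_side_iff hn hr k z).1 hz).2
  have hmem := crossing_mem_polygon hn hr z.2 hz'
  refine ⟨⟨crossing n r k z, hmem⟩, (mem_side_iff hn hr _ _).2 ⟨hmem, ?_⟩, ?_⟩
  · rw [Nat.cast_add]
    exact height_crossing_opposite (by omega) hz'
  · exact (Quot.sound ((glue_iff hn hr _ _).2 ⟨k, hz', rfl⟩)).symm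

theorem edge_periodic (hn : 2 ≤ n) (hr : 0 < r) : (edge n r).Periodic n := by
  intro k
  refine Subset.antisymm ?_ (edge_subset_edge_opposite hn hr k)
  refine (edge_subset_edge_opposite hn hr (k + n)).trans (edge_congr hn hr ?_).subset
  exact ⟨1, by push_cast; ring⟩

theorem sideMidpoint_notMem_range_corner (hn : 2 ≤ n) (hr : 0 < r) (k : ℤ) :
    sideMidpoint n r k ∉ range (corner n r) := by
  rintro ⟨j, hj⟩
  have hnorm := norm_corner (n := n) hr.le j
  rw [hj, sideMidpoint, norm_mul, norm_normal, mul_one,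
    Complex.norm_of_nonneg (apothem_pos hn hr).le] at hnorm
  exact (apothem_lt hn hr).ne hnorm

theorem sideMidpoint_mem_polygon (hn : n ≠ 0) (r : ℝ) (k : ℤ) :
    sideMidpoint n r k ∈ polygon n r := by
  have hmid : sideMidpoint n r k = midpoint ℝ (corner n r k) (corner n r (k + 1)) := by
    rw [midpoint_eq_smul_add, corner_add_corner_succ, sideMidpoint, mul_assoc, invOf_eq_inv,
      Complex.real_smul, Complex.ofReal_inv, Complex.ofReal_ofNat, inv_mul_cancel_left₀ two_ne_zero]
  rw [hmid]
  exact (convex_polygon n r).midpoint_mem (corner_mem_polygon hn k) (corner_mem_polygon hn (k + 1))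

@[simp] theorem height_sideMidpoint (n : ℕ) (r : ℝ) (k : ℤ) :
    height n k (sideMidpoint n r k) = apothem n r := by
  rw [sideMidpoint, height_ofReal_mul, height_normal, mul_one]

theorem crossing_sideMidpoint (hn : n ≠ 0) (r : ℝ) (k : ℤ) :
    crossing n r k (sideMidpoint n r k) = sideMidpoint n r (k + n) := by
  rw [crossing, sideMidpoint, sideMidpoint, normal_add_self hn]
  ring

theorem dvd_sub_of_height_sideMidpoint_eq (hn : 2 ≤ n) (hr : 0 < r) {j k : ℤ}
    (h : height n k (sideMidpoint n r j) = apothem n r) : (2 * n : ℤ) ∣ k - j := by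
  by_contra hd
  exact sideMidpoint_notMem_range_corner hn hr j (mem_range_corner_of_height_eq hn hr
    (sideMidpoint_mem_polygon (by omega) r j) h (height_sideMidpoint n r j) hd)

theorem dvd_sub_of_related_sideMidpoint (hn : 2 ≤ n) (hr : 0 < r) {j k : ℤ} {z : ℂ}
    (hz : height n k z = apothem n r) (h : Related n r (sideMidpoint n r j) z) :
    (n : ℤ) ∣ k - j := by
  have hn' : n ≠ 0 := by omega
  have hdvd : (n : ℤ) ∣ 2 * n := dvd_mul_left _ _
  rcases h with rfl | ⟨i, hi, rfl⟩ | ⟨h, -⟩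
  · exact hdvd.trans (dvd_sub_of_height_sideMidpoint_eq hn hr hz)
  · rw [crossing_congr hn' (dvd_sub_of_height_sideMidpoint_eq hn hr hi),
      crossing_sideMidpoint hn'] at hz
    have hd := hdvd.trans (dvd_sub_of_height_sideMidpoint_eq hn hr hz)
    rwa [← sub_sub, dvd_sub_self_right] at hd
  · exact absurd h (sideMidpoint_notMem_range_corner hn hr j)

theorem edge_injOn (hn : 2 ≤ n) (hr : 0 < r) (h1 : OneVertex n r) :
    InjOn (edge n r) (Finset.range n) := by
  intro j hj k hk hjk
  rw [Finset.mem_coe, Finset.mem_range] at hj hk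
  have hmem := sideMidpoint_mem_polygon (n := n) (by omega) r j
  have hedge : proj n r ⟨_, hmem⟩ ∈ edge n r k := by
    rw [← hjk]
    exact ⟨_, (mem_side_iff hn hr j _).2 ⟨hmem, height_sideMidpoint n r j⟩, rfl⟩
  obtain ⟨z, hz, hzj⟩ := hedge
  have hd := dvd_sub_of_related_sideMidpoint hn hr ((mem_side_iff hn hr k z).1 hz).2
    ((proj_eq_proj_iff hn hr h1 _ _).1 hzj.symm)
  have := Int.eq_zero_of_abs_lt_dvd hd (abs_lt.2 ⟨by omega, by omega⟩)
  omega

theorem ncard_range_edge (hn : 2 ≤ n) (hr : 0 < r) (h1 : OneVertex n r) :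
    (range (edge n r)).ncard = n := by
  have hrange : range (edge n r) = edge n r '' (Finset.range n) := by
    refine Subset.antisymm ?_ (image_subset_range _ _)
    rintro _ ⟨k, rfl⟩
    exact ⟨k % n, Finset.mem_coe.2 (Finset.mem_range.2 (Nat.mod_lt _ (by omega))),
      (edge_periodic hn hr).map_mod_nat k⟩
  rw [hrange, (edge_injOn hn hr h1).ncard_image, ncard_coe_finset, Finset.card_range]

theorem eulerChar_eq (hn : 2 ≤ n) (hr : 0 < r) (h1 : OneVertex n r) :
    eulerChar n r = 2 - n := by
  have hvertex : range (vertexPoint n r) = {vertexPoint n r 0} := by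
    rw [funext h1, range_const]
  rw [eulerChar, hvertex, ncard_singleton, ncard_range_edge hn hr h1]
  push_cast
  ring

end Gluing

section Charts

/-- The atlas of all flat charts of the surface. -/
def flatCharts (n : ℕ) (r : ℝ) : Set (OpenPartialHomeomorph (Surface n r) ℂ) :=
  {φ | IsFlatChart n r φ}

open Classical in
/-- The projection of the polygon to the surface, extended to the plane by a constant. -/
def toSurface (n : ℕ) (r : ℝ) (w : ℂ) : Surface n r :=
  if h : w ∈ polygon n r then proj n r ⟨w, h⟩ else vertexPoint n r 0

/-- A closed disc cut into closed pieces `C i`, together with maps `f i` of the pieces to the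
polygon under which the pieces are glued to each other exactly as the polygon is. It encodes a
parametrization of a neighbourhood in the surface by a disc. -/
structure DiscPieces (n : ℕ) (r : ℝ) {ι : Type*} (C : ι → Set ℂ) (f : ι → ℂ → ℂ) (c : ℂ)
    (ρ : ℝ) : Prop where
  isClosed : ∀ i, IsClosed (C i)
  continuous : ∀ i, Continuous (f i)
  cover : Metric.closedBall c ρ ⊆ ⋃ i, C i
  mapsTo : ∀ i, MapsTo (f i) (C i ∩ Metric.closedBall c ρ) (polygon n r)
  related : ∀ i j, ∀ a ∈ C i ∩ Metric.closedBall c ρ, a ∈ C j → Related n r (f i a) (f j a)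
  eq_of_eq : ∀ i j, ∀ a ∈ C i ∩ Metric.closedBall c ρ, ∀ b ∈ C j ∩ Metric.closedBall c ρ,
    f i a = f j b → a = b
  saturated : ∀ i, ∀ a ∈ C i ∩ Metric.closedBall c ρ, ∀ w, Related n r (f i a) w →
    ∃ j, a ∈ C j ∧ f j a = w
  eventually_mem : ∀ i, ∀ a ∈ C i ∩ Metric.ball c ρ,
    ∀ᶠ w in 𝓝[polygon n r] (f i a), ∃ j, w ∈ f j '' (C j ∩ Metric.ball c ρ)

/-- A set near a point of the `k`-th side, away from the vertices: on it, only the `k`-th side is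
crossed, and after crossing only the opposite side is. -/
structure IsNearSide (n : ℕ) (r : ℝ) (k : ℤ) (K : Set ℂ) : Prop where
  height_lt : ∀ a ∈ K, ∀ j : ℤ, ¬ (2 * n : ℤ) ∣ j - k → height n j a < apothem n r
  height_crossing_lt : ∀ a ∈ K, ∀ j : ℤ, ¬ (2 * n : ℤ) ∣ j - (k + n) →
    height n j (crossing n r k a) < apothem n r
  height_pos : ∀ a ∈ K, 0 < height n k a
  height_crossing_neg : ∀ a ∈ K, height n k (crossing n r k a) < 0

/-- The two half-planes bounded by the line carrying the `k`-th side; `true` is the half-plane of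
the polygon. -/
def sideHalf (n : ℕ) (r : ℝ) (k : ℤ) : Bool → Set ℂ
  | true => {a | height n k a ≤ apothem n r}
  | false => {a | apothem n r ≤ height n k a}

/-- The translations that bring the two halves of a small disc centred on the `k`-th side into the
polygon. -/
def sideShift (n : ℕ) (r : ℝ) (k : ℤ) : Bool → ℂ
  | true => 0
  | false => -(2 * apothem n r * normal n k)

variable {n : ℕ} {r : ℝ}

theorem isTranslationAtlas_flatCharts (hn : 2 ≤ n) (hr : 0 < r) (h1 : OneVertex n r) :
    IsTranslationAtlas (flatCharts n r) := by
  have hn' : n ≠ 0 := by omega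
  have := compactSpace_polygon hn' r
  have := t2Space_surface hn hr h1
  intro φ hφ ψ hψ x hx
  have hfiber := (continuous_proj n r).isClosedMap.eventually_nhds_fiber
    (p := fun z => ψ (proj n r z) = φ (proj n r z) + (ψ x - φ x)) x ?_
  · filter_upwards [hfiber] with y hy
    obtain ⟨z, rfl⟩ := proj_surjective n r y
    exact hy z rfl
  rintro z rfl
  obtain ⟨c, hc⟩ := hφ z hx.1
  obtain ⟨d, hd⟩ := hψ z hx.2
  filter_upwards [hc, hd] with w hcw hdw
  rw [hcw, hdw, hc.self_of_nhds, hd.self_of_nhds]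
  ring

theorem toSurface_of_mem {w : ℂ} (h : w ∈ polygon n r) : toSurface n r w = proj n r ⟨w, h⟩ :=
  dif_pos h

theorem toSurface_coe (z : polygon n r) : toSurface n r z = proj n r z :=
  toSurface_of_mem z.2

theorem continuousOn_toSurface (n : ℕ) (r : ℝ) : ContinuousOn (toSurface n r) (polygon n r) := by
  rw [continuousOn_iff_continuous_domRestrict]
  exact (continuous_proj n r).congr fun z => (toSurface_coe z).symm

theorem toSurface_eq_iff (hn : 2 ≤ n) (hr : 0 < r) (h1 : OneVertex n r) {z w : ℂ}
    (hz : z ∈ polygon n r) (hw : w ∈ polygon n r) :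
    toSurface n r z = toSurface n r w ↔ Related n r z w := by
  rw [toSurface_of_mem hz, toSurface_of_mem hw, proj_eq_proj_iff hn hr h1]

theorem toSurface_corner (hn : n ≠ 0) (h1 : OneVertex n r) (k : ℤ) :
    toSurface n r (corner n r k) = vertexPoint n r 0 := by
  rw [toSurface_of_mem (corner_mem_polygon hn k)]
  exact proj_eq_vertexPoint hn h1 (mem_range_self k)

theorem exists_openPartialHomeomorph_of_injOn {X Y : Type*} [TopologicalSpace X]
    [TopologicalSpace Y] [T2Space Y] [Nonempty X] {K B : Set X} (hK : IsCompact K) (hB : IsOpen B)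
    (hBK : B ⊆ K) {f : X → Y} (hf : ContinuousOn f K) (hinj : InjOn f K) (hfB : IsOpen (f '' B)) :
    ∃ e : OpenPartialHomeomorph X Y, e.source = B ∧ ⇑e = f := by
  have hopen : ∀ U, IsOpen U → IsOpen (f '' (B ∩ U)) := by
    intro U hU
    have hclosed : IsClosed (f '' (K \ U)) :=
      ((hK.diff hU).image_of_continuousOn (hf.mono sdiff_subset)).isClosed
    have himage : f '' (B ∩ U) = f '' B ∩ (f '' (K \ U))ᶜ := by
      apply Subset.antisymm
      · rintro _ ⟨a, ⟨haB, haU⟩, rfl⟩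
        exact ⟨mem_image_of_mem f haB, fun ⟨b, hb, hab⟩ => hb.2 (hinj hb.1 (hBK haB) hab ▸ haU)⟩
      · rintro _ ⟨⟨a, ha, rfl⟩, hna⟩
        exact ⟨a, ⟨ha, by_contra fun haU => hna ⟨a, ⟨hBK ha, haU⟩, rfl⟩⟩, rfl⟩
    exact himage ▸ hfB.inter hclosed.isOpen_compl
  refine ⟨.ofContinuousOpenRestrict (hinj.mono hBK).toPartialEquiv (hf.mono hBK) ?_ hB, rfl, rfl⟩
  intro V hV
  obtain ⟨U, hU, rfl⟩ := isOpen_induced_iff.1 hV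
  have himage : B.domRestrict f '' (Subtype.val ⁻¹' U) = f '' (B ∩ U) := by
    rw [domRestrict_eq, image_comp, Subtype.image_preimage_coe]
  exact himage ▸ hopen U hU

namespace DiscPieces

variable {ι : Type*} {C : ι → Set ℂ} {f : ι → ℂ → ℂ} {c : ℂ} {ρ : ℝ} {Ψ : ℂ → Surface n r}

theorem related_iff (h : DiscPieces n r C f c ρ) {i j : ι} {a b : ℂ}
    (ha : a ∈ C i ∩ Metric.closedBall c ρ) (hb : b ∈ C j ∩ Metric.closedBall c ρ) :
    Related n r (f i a) (f j b) ↔ a = b := by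
  constructor
  · intro hab
    obtain ⟨l, hal, hl⟩ := h.saturated i a ha _ hab
    exact h.eq_of_eq l j a ⟨hal, ha.2⟩ b hb hl
  · rintro rfl
    exact h.related i j a ha hb.1

theorem toSurface_eq_iff (h : DiscPieces n r C f c ρ) (hn : 2 ≤ n) (hr : 0 < r)
    (h1 : OneVertex n r) {i j : ι} {a b : ℂ} (ha : a ∈ C i ∩ Metric.closedBall c ρ)
    (hb : b ∈ C j ∩ Metric.closedBall c ρ) :
    toSurface n r (f i a) = toSurface n r (f j b) ↔ a = b := by
  rw [PolygonSurface.toSurface_eq_iff hn hr h1 (h.mapsTo i ha) (h.mapsTo j hb), h.related_iff ha hb]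

theorem exists_eq_toSurface (h : DiscPieces n r C f c ρ) (hn : 2 ≤ n) (hr : 0 < r)
    (h1 : OneVertex n r) :
    ∃ Ψ : ℂ → Surface n r, ∀ i, EqOn Ψ (toSurface n r ∘ f i) (C i ∩ Metric.closedBall c ρ) := by
  have hcover : ∀ a, ∃ s, ∀ i, a ∈ C i ∩ Metric.closedBall c ρ → s = toSurface n r (f i a) := by
    intro a
    by_cases ha : a ∈ Metric.closedBall c ρ
    · obtain ⟨i, hi⟩ := mem_iUnion.1 (h.cover ha)
      exact ⟨_, fun j hj => (h.toSurface_eq_iff hn hr h1 ⟨hi, ha⟩ hj).2 rfl⟩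
    · exact ⟨vertexPoint n r 0, fun i hi => absurd hi.2 ha⟩
  choose Ψ hΨ using hcover
  exact ⟨Ψ, fun i a ha => hΨ a i ha⟩

theorem injOn (h : DiscPieces n r C f c ρ) (hn : 2 ≤ n) (hr : 0 < r) (h1 : OneVertex n r)
    (hΨ : ∀ i, EqOn Ψ (toSurface n r ∘ f i) (C i ∩ Metric.closedBall c ρ)) :
    InjOn Ψ (Metric.closedBall c ρ) := by
  intro a ha b hb hab
  obtain ⟨i, hi⟩ := mem_iUnion.1 (h.cover ha)
  obtain ⟨j, hj⟩ := mem_iUnion.1 (h.cover hb)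
  rw [hΨ i ⟨hi, ha⟩, hΨ j ⟨hj, hb⟩] at hab
  exact (h.toSurface_eq_iff hn hr h1 ⟨hi, ha⟩ ⟨hj, hb⟩).1 hab

theorem continuousOn [Finite ι] (h : DiscPieces n r C f c ρ)
    (hΨ : ∀ i, EqOn Ψ (toSurface n r ∘ f i) (C i ∩ Metric.closedBall c ρ)) :
    ContinuousOn Ψ (Metric.closedBall c ρ) := by
  rw [← inter_eq_right.2 h.cover, iUnion_inter]
  refine (locallyFinite_of_finite _).continuousOn_iUnion
    (fun i => (h.isClosed i).inter Metric.isClosed_closedBall) fun i => ?_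
  exact ((continuousOn_toSurface n r).comp (h.continuous i).continuousOn (h.mapsTo i)).congr (hΨ i)

theorem isOpen_image_ball (h : DiscPieces n r C f c ρ) (hn : 2 ≤ n) (hr : 0 < r)
    (h1 : OneVertex n r)
    (hΨ : ∀ i, EqOn Ψ (toSurface n r ∘ f i) (C i ∩ Metric.closedBall c ρ)) :
    IsOpen (Ψ '' Metric.ball c ρ) := by
  have hBK : Metric.ball c ρ ⊆ Metric.closedBall c ρ := Metric.ball_subset_closedBall
  rw [← (isQuotientMap_quot_mk (r := Glue n r)).isOpen_preimage, isOpen_iff_mem_nhds]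
  rintro z ⟨a, ha, haz⟩
  obtain ⟨i, hi⟩ := mem_iUnion.1 (h.cover (hBK ha))
  have hrel : Related n r (f i a) z := by
    rw [← PolygonSurface.toSurface_eq_iff hn hr h1 (h.mapsTo i ⟨hi, hBK ha⟩) z.2, toSurface_coe]
    exact (hΨ i ⟨hi, hBK ha⟩).symm.trans haz
  obtain ⟨j, haj, hjz⟩ := h.saturated i a ⟨hi, hBK ha⟩ z hrel
  have hev := h.eventually_mem j a ⟨haj, ha⟩
  rw [hjz, ← eventually_nhds_subtype_iff] at hev
  filter_upwards [hev] with w ⟨l, b, hb, hbw⟩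
  refine ⟨b, hb.2, (hΨ l ⟨hb.1, hBK hb.2⟩).trans ?_⟩
  rw [Function.comp_apply, hbw, toSurface_coe, proj]

theorem exists_chart [Finite ι] (h : DiscPieces n r C f c ρ) (hn : 2 ≤ n) (hr : 0 < r)
    (h1 : OneVertex n r) :
    ∃ φ : OpenPartialHomeomorph (Surface n r) ℂ, φ.target = Metric.ball c ρ ∧
      ∀ i, ∀ a ∈ C i ∩ Metric.ball c ρ, φ.symm a = toSurface n r (f i a) := by
  have := t2Space_surface hn hr h1
  obtain ⟨Ψ, hΨ⟩ := h.exists_eq_toSurface hn hr h1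
  obtain ⟨e, he, rfl⟩ := exists_openPartialHomeomorph_of_injOn (isCompact_closedBall c ρ)
    Metric.isOpen_ball Metric.ball_subset_closedBall (h.continuousOn hΨ) (h.injOn hn hr h1 hΨ)
    (h.isOpen_image_ball hn hr h1 hΨ)
  refine ⟨e.symm, he, fun i a ha => ?_⟩
  rw [OpenPartialHomeomorph.symm_symm]
  exact hΨ i ⟨ha.1, Metric.ball_subset_closedBall ha.2⟩

-- The images of the pieces are compact, and those that are translated differently do not meet.
theorem eventually_shift_eq [Finite ι] {t : ι → ℂ}
    (h : DiscPieces n r C (fun i a => a + t i) c ρ) {j : ι} {a : ℂ}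
    (ha : a ∈ C j ∩ Metric.closedBall c ρ) :
    ∀ᶠ w in 𝓝 (a + t j), ∀ l, ∀ b ∈ C l ∩ Metric.closedBall c ρ, b + t l = w → t l = t j := by
  rw [eventually_all]
  intro l
  by_cases hl : t l = t j
  · exact Eventually.of_forall fun _ _ _ _ => hl
  have hclosed : IsClosed ((· + t l) '' (C l ∩ Metric.closedBall c ρ)) :=
    (((isCompact_closedBall c ρ).inter_left (h.isClosed l)).image (h.continuous l)).isClosed
  have hnotMem : a + t j ∉ (· + t l) '' (C l ∩ Metric.closedBall c ρ) := by
    rintro ⟨b, hb, hba : b + t l = a + t j⟩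
    rw [h.eq_of_eq l j b hb a ha hba] at hba
    exact hl (add_left_cancel hba)
  filter_upwards [hclosed.isOpen_compl.mem_nhds hnotMem] with w hw b hb hbw
  exact absurd ⟨b, hb, hbw⟩ hw

theorem isFlatChart [Finite ι] {t : ι → ℂ} (h : DiscPieces n r C (fun i a => a + t i) c ρ)
    (hn : 2 ≤ n) (hr : 0 < r) (h1 : OneVertex n r) {φ : OpenPartialHomeomorph (Surface n r) ℂ}
    (hφt : φ.target = Metric.ball c ρ)
    (hφ : ∀ i, ∀ a ∈ C i ∩ Metric.ball c ρ, φ.symm a = toSurface n r (a + t i)) :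
    IsFlatChart n r φ := by
  have hBK : Metric.ball c ρ ⊆ Metric.closedBall c ρ := Metric.ball_subset_closedBall
  intro z hz
  have ha : φ (proj n r z) ∈ Metric.ball c ρ := hφt ▸ φ.map_source hz
  obtain ⟨i, hi⟩ := mem_iUnion.1 (h.cover (hBK ha))
  have hrel : Related n r (φ (proj n r z) + t i) z := by
    rw [← PolygonSurface.toSurface_eq_iff hn hr h1 (h.mapsTo i ⟨hi, hBK ha⟩) z.2,
      ← hφ i _ ⟨hi, ha⟩, φ.left_inv hz, toSurface_coe]
  obtain ⟨j, haj, hjz⟩ := h.saturated i _ ⟨hi, hBK ha⟩ z hrel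
  have hmem := h.eventually_mem j _ ⟨haj, ha⟩
  have hshift := (h.eventually_shift_eq ⟨haj, hBK ha⟩).filter_mono
    (nhdsWithin_le_nhds (s := polygon n r))
  rw [hjz, ← eventually_nhds_subtype_iff] at hmem hshift
  refine ⟨-t j, ?_⟩
  filter_upwards [hmem, hshift] with w ⟨l, b, hb, hbw⟩ hw
  have hbw : b + t l = w := hbw
  have hproj : φ.symm b = proj n r w := by rw [hφ l b hb, hbw, toSurface_coe]
  rw [← hproj, φ.right_inv (hφt ▸ hb.2), ← hw l b ⟨hb.1, hBK hb.2⟩ hbw, ← hbw]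
  ring

theorem exists_flatChart [Finite ι] {t : ι → ℂ} (h : DiscPieces n r C (fun i a => a + t i) c ρ)
    (hn : 2 ≤ n) (hr : 0 < r) (h1 : OneVertex n r) (hρ : 0 < ρ) {i : ι} (hi : c ∈ C i) :
    ∃ φ, IsFlatChart n r φ ∧ toSurface n r (c + t i) ∈ φ.source := by
  obtain ⟨φ, hφt, hφ⟩ := h.exists_chart hn hr h1
  have hc : c ∈ Metric.ball c ρ := Metric.mem_ball_self hρ
  refine ⟨φ, h.isFlatChart hn hr h1 hφt hφ, ?_⟩
  rw [← hφ i c ⟨hi, hc⟩]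
  exact φ.map_target (hφt ▸ hc)

end DiscPieces

theorem exists_closedBall_height_lt (hn : n ≠ 0) (r : ℝ) (z₀ : ℂ) :
    ∃ ρ > 0, ∀ z ∈ Metric.closedBall z₀ ρ, ∀ j : ℤ, height n j z₀ < apothem n r →
      height n j z < apothem n r := by
  have hev : ∀ᶠ z in 𝓝 z₀, ∀ m ∈ Finset.range (2 * n), height n (m : ℕ) z₀ < apothem n r →
      height n (m : ℕ) z < apothem n r := by
    rw [eventually_all_finset]
    intro m _
    by_cases hm : height n m z₀ < apothem n r
    · filter_upwards [(height n m).continuous.continuousAt.eventually_lt continuousAt_const hm]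
        with z hz _ using hz
    · exact Eventually.of_forall fun z h => absurd h hm
  obtain ⟨ρ, hρ, hlt⟩ := Metric.nhds_basis_closedBall.eventually_iff.1 hev
  refine ⟨ρ, hρ, fun z hz j hj => ?_⟩
  obtain ⟨m, hm, hd⟩ := exists_nat_dvd_sub hn j
  rw [height_congr hn hd] at hj ⊢
  exact hlt hz m (Finset.mem_range.2 hm) hj

theorem height_lt_of_notMem_range_corner (hn : 2 ≤ n) (hr : 0 < r) {z : ℂ}
    (hz : z ∈ polygon n r) (hc : z ∉ range (corner n r)) {k : ℤ}
    (hk : height n k z = apothem n r) {j : ℤ} (hj : ¬ (2 * n : ℤ) ∣ j - k) :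
    height n j z < apothem n r :=
  (height_le_of_mem (by omega) hr hz j).lt_of_ne
    fun h => hc (mem_range_corner_of_height_eq hn hr hz h hk hj)

theorem Related.eq_or_crossing (hn : 2 ≤ n) {k : ℤ} {z w : ℂ}
    (hz : ∀ j : ℤ, ¬ (2 * n : ℤ) ∣ j - k → height n j z < apothem n r) (h : Related n r z w) :
    w = z ∨ (height n k z = apothem n r ∧ w = crossing n r k z) := by
  have hn' : n ≠ 0 := by omega
  have hdvd : ∀ j, height n j z = apothem n r → (2 * n : ℤ) ∣ j - k := fun j hj => by
    by_contra hd
    exact (hz j hd).ne hj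
  rcases h with rfl | ⟨j, hj, rfl⟩ | ⟨⟨j, rfl⟩, -⟩
  · exact Or.inl rfl
  · exact Or.inr ⟨height_congr hn' (hdvd j hj) ▸ hj, crossing_congr hn' (hdvd j hj) z⟩
  · have hpred := hdvd (j - 1) (by simpa using height_corner_succ n r (j - 1))
    have hone := dvd_sub (hdvd j (height_corner_self n r j)) hpred
    rw [sub_sub_sub_cancel_right, sub_sub_cancel] at hone
    have := Int.le_of_dvd one_pos hone
    omega

theorem exists_flatChart_interior (hn : 2 ≤ n) (hr : 0 < r) (h1 : OneVertex n r) {z₀ : ℂ}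
    (hz₀ : z₀ ∈ openPolygon n r) : ∃ φ, IsFlatChart n r φ ∧ toSurface n r z₀ ∈ φ.source := by
  obtain ⟨ρ, hρ, hball⟩ := exists_closedBall_height_lt (by omega : n ≠ 0) r z₀
  have hlt : ∀ z ∈ Metric.closedBall z₀ ρ, ∀ j, height n j z < apothem n r :=
    fun z hz j => hball z hz j (hz₀ j)
  have hrel : ∀ z ∈ Metric.closedBall z₀ ρ, ∀ w, Related n r z w → w = z := fun z hz w hw =>
    (hw.eq_or_crossing (k := 0) hn fun j _ => hlt z hz j).resolve_right
      fun h => (hlt z hz 0).ne h.1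
  have hpieces : DiscPieces n r (fun _ : Unit => univ) (fun _ a => a + 0) z₀ ρ := by
    simp only [add_zero]
    exact
      { isClosed := fun _ => isClosed_univ
        continuous := fun _ => continuous_id
        cover := fun _ _ => mem_iUnion.2 ⟨(), trivial⟩
        mapsTo := fun _ a ha => (mem_polygon_iff hn hr a).2 fun j => (hlt a ha.2 j).le
        related := fun _ _ _ _ _ => Or.inl rfl
        eq_of_eq := fun _ _ _ _ _ _ h => h
        saturated := fun _ a ha w hw => ⟨(), trivial, (hrel a ha.2 w hw).symm⟩
        eventually_mem := fun _ a ha => nhdsWithin_le_nhds <| by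
          filter_upwards [Metric.isOpen_ball.mem_nhds ha.2] with w hw
          exact ⟨(), w, ⟨trivial, hw⟩, rfl⟩ }
  simpa only [add_zero] using hpieces.exists_flatChart (i := ()) hn hr h1 hρ (mem_univ z₀)

theorem add_sideShift_true (n : ℕ) (r : ℝ) (k : ℤ) (a : ℂ) : a + sideShift n r k true = a :=
  add_zero a

theorem add_sideShift_false (n : ℕ) (r : ℝ) (k : ℤ) (a : ℂ) :
    a + sideShift n r k false = crossing n r k a :=
  (sub_eq_add_neg _ _).symm

theorem isClosed_sideHalf (n : ℕ) (r : ℝ) (k : ℤ) : ∀ b, IsClosed (sideHalf n r k b)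
  | true => isClosed_le (height n k).continuous continuous_const
  | false => isClosed_le continuous_const (height n k).continuous

theorem height_opposite_crossing (hn : n ≠ 0) (k : ℤ) (a : ℂ) :
    height n (k + n) (crossing n r k a) = 2 * apothem n r - height n k a := by
  rw [height_add_self hn, height_crossing, neg_sub]

theorem exists_isNearSide_closedBall (hn : 2 ≤ n) (hr : 0 < r) {z₀ : ℂ} (hz₀ : z₀ ∈ polygon n r)
    (hc : z₀ ∉ range (corner n r)) {k : ℤ} (hk : height n k z₀ = apothem n r) :
    ∃ ρ > 0, IsNearSide n r k (Metric.closedBall z₀ ρ) := by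
  have hn' : n ≠ 0 := by omega
  have hpos := apothem_pos hn hr
  obtain ⟨ρ₀, hρ₀, hlt₀⟩ := exists_closedBall_height_lt hn' r z₀
  obtain ⟨ρ₁, hρ₁, hlt₁⟩ := exists_closedBall_height_lt hn' r (crossing n r k z₀)
  have hle₀ : min (min ρ₀ ρ₁) (apothem n r / 2) ≤ ρ₀ := (min_le_left _ _).trans (min_le_left _ _)
  have hle₁ : min (min ρ₀ ρ₁) (apothem n r / 2) ≤ ρ₁ := (min_le_left _ _).trans (min_le_right _ _)
  have hheight : ∀ a ∈ Metric.closedBall z₀ (min (min ρ₀ ρ₁) (apothem n r / 2)),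
      |height n k a - apothem n r| ≤ apothem n r / 2 := by
    intro a ha
    rw [mem_closedBall_iff_norm] at ha
    have hle := (abs_height_le n k (a - z₀)).trans (ha.trans (min_le_right _ _))
    rwa [map_sub, hk] at hle
  refine ⟨min (min ρ₀ ρ₁) (apothem n r / 2), by positivity, ?_, ?_, ?_, ?_⟩
  · exact fun a ha j hj => hlt₀ a (Metric.closedBall_subset_closedBall hle₀ ha) j
      (height_lt_of_notMem_range_corner hn hr hz₀ hc hk hj)
  · intro a ha j hj
    refine hlt₁ _ (Metric.closedBall_subset_closedBall hle₁ ?_) j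
      (height_lt_of_notMem_range_corner hn hr (crossing_mem_polygon hn hr hz₀ hk)
        (mt (crossing_mem_range_corner_iff hn' hr hk).1 hc) (height_crossing_opposite hn' hk) hj)
    rwa [Metric.mem_closedBall, crossing, crossing, dist_sub_right]
  · intro a ha
    linarith [(abs_le.1 (hheight a ha)).1]
  · intro a ha
    rw [height_crossing]
    linarith [(abs_le.1 (hheight a ha)).2]

namespace IsNearSide

variable {k : ℤ} {K : Set ℂ}

theorem add_sideShift_mem_polygon (h : IsNearSide n r k K) (hn : 2 ≤ n) (hr : 0 < r) (b : Bool) :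
    MapsTo (· + sideShift n r k b) (sideHalf n r k b ∩ K) (polygon n r) := by
  have hn' : n ≠ 0 := by omega
  intro a ha
  rw [mem_polygon_iff hn hr]
  intro j
  cases b
  · simp only [add_sideShift_false]
    by_cases hj : (2 * n : ℤ) ∣ j - (k + n)
    · have hle : apothem n r ≤ height n k a := ha.1
      rw [height_congr hn' hj, height_opposite_crossing hn']
      linarith
    · exact (h.height_crossing_lt a ha.2 j hj).le
  · simp only [add_sideShift_true]
    by_cases hj : (2 * n : ℤ) ∣ j - k
    · exact height_congr hn' hj ▸ ha.1
    · exact (h.height_lt a ha.2 j hj).le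

theorem eq_of_add_sideShift_eq (h : IsNearSide n r k K) {b c : Bool} {x y : ℂ} (hx : x ∈ K)
    (hy : y ∈ K) (hxy : x + sideShift n r k b = y + sideShift n r k c) : x = y := by
  cases b <;> cases c
  · exact add_right_cancel hxy
  · rw [add_sideShift_false, add_sideShift_true] at hxy
    exact absurd (hxy ▸ h.height_crossing_neg x hx) (h.height_pos y hy).not_gt
  · rw [add_sideShift_false, add_sideShift_true] at hxy
    exact absurd (hxy ▸ h.height_crossing_neg y hy) (h.height_pos x hx).not_gt
  · exact add_right_cancel hxy

theorem exists_eq_of_related (h : IsNearSide n r k K) (hn : 2 ≤ n) {b : Bool} {a w : ℂ}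
    (ha : a ∈ sideHalf n r k b ∩ K) (hw : Related n r (a + sideShift n r k b) w) :
    ∃ c, a ∈ sideHalf n r k c ∧ a + sideShift n r k c = w := by
  have hn' : n ≠ 0 := by omega
  cases b
  · rw [add_sideShift_false] at hw
    rcases hw.eq_or_crossing hn (h.height_crossing_lt a ha.2) with rfl | ⟨hk, rfl⟩
    · exact ⟨false, ha.1, add_sideShift_false n r k a⟩
    · rw [height_opposite_crossing hn'] at hk
      refine ⟨true, (by linarith : height n k a ≤ apothem n r), ?_⟩
      rw [add_sideShift_true, crossing_crossing hn']
  · rw [add_sideShift_true] at hw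
    rcases hw.eq_or_crossing hn (h.height_lt a ha.2) with rfl | ⟨hk, rfl⟩
    · exact ⟨true, ha.1, add_sideShift_true n r k w⟩
    · exact ⟨false, hk.ge, add_sideShift_false n r k a⟩

end IsNearSide

theorem related_add_sideShift (hn : n ≠ 0) {k : ℤ} {b c : Bool} {a : ℂ}
    (hb : a ∈ sideHalf n r k b) (hc : a ∈ sideHalf n r k c) :
    Related n r (a + sideShift n r k b) (a + sideShift n r k c) := by
  have hcross (h : height n k a = apothem n r) : Related n r a (crossing n r k a) :=
    Or.inr (Or.inl ⟨k, h, rfl⟩)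
  cases b <;> cases c
  · exact Or.inl rfl
  · rw [add_sideShift_false, add_sideShift_true]
    exact (hcross (le_antisymm hc hb)).symm hn
  · rw [add_sideShift_false, add_sideShift_true]
    exact hcross (le_antisymm hb hc)
  · exact Or.inl rfl

theorem sub_sideShift_mem_sideHalf (hn : n ≠ 0) (hr : 0 < r) {w : ℂ} (hw : w ∈ polygon n r)
    (k : ℤ) (b : Bool) : w - sideShift n r k b ∈ sideHalf n r k b := by
  cases b
  · have hle := height_le_of_mem hn hr hw (k + n)
    have hopp := height_opposite_crossing (r := r) hn k (w - sideShift n r k false)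
    rw [← add_sideShift_false, sub_add_cancel] at hopp
    exact (by linarith : apothem n r ≤ height n k (w - sideShift n r k false))
  · rw [sideShift, sub_zero]
    exact height_le_of_mem hn hr hw k

theorem IsNearSide.discPieces (hn : 2 ≤ n) (hr : 0 < r) {k : ℤ} {z₀ : ℂ} {ρ : ℝ}
    (h : IsNearSide n r k (Metric.closedBall z₀ ρ)) :
    DiscPieces n r (sideHalf n r k) (fun b a => a + sideShift n r k b) z₀ ρ where
  isClosed := isClosed_sideHalf n r k
  continuous _ := by fun_prop
  cover a _ := by
    rcases le_total (height n k a) (apothem n r) with ha | ha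
    · exact mem_iUnion.2 ⟨true, ha⟩
    · exact mem_iUnion.2 ⟨false, ha⟩
  mapsTo b := h.add_sideShift_mem_polygon hn hr b
  related _ _ _ ha ha' := related_add_sideShift (by omega) ha.1 ha'
  eq_of_eq _ _ _ hx _ hy := h.eq_of_add_sideShift_eq hx.2 hy.2
  saturated _ _ ha _ := h.exists_eq_of_related hn ha
  eventually_mem b a ha := by
    have htendsto : Tendsto (· - sideShift n r k b) (𝓝 (a + sideShift n r k b)) (𝓝 a) := by
      simpa only [add_sub_cancel_right] using
        (continuous_sub_right (sideShift n r k b)).tendsto (a + sideShift n r k b)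
    filter_upwards [self_mem_nhdsWithin, nhdsWithin_le_nhds
      (htendsto.eventually (Metric.isOpen_ball.mem_nhds ha.2))] with w hwP hw
    exact ⟨b, _, ⟨sub_sideShift_mem_sideHalf (by omega) hr hwP k b, hw⟩, sub_add_cancel _ _⟩

theorem exists_flatChart_side (hn : 2 ≤ n) (hr : 0 < r) (h1 : OneVertex n r) {z₀ : ℂ}
    (hz₀ : z₀ ∈ polygon n r) (hc : z₀ ∉ range (corner n r)) {k : ℤ}
    (hk : height n k z₀ = apothem n r) :
    ∃ φ, IsFlatChart n r φ ∧ toSurface n r z₀ ∈ φ.source := by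
  obtain ⟨ρ, hρ, hnear⟩ := exists_isNearSide_closedBall hn hr hz₀ hc hk
  have hmem : z₀ ∈ sideHalf n r k true := hk.le
  simpa only [add_sideShift_true] using (hnear.discPieces hn hr).exists_flatChart hn hr h1 hρ hmem

theorem conePoints_subset (hn : 2 ≤ n) (hr : 0 < r) (h1 : OneVertex n r) :
    conePoints n r ⊆ {vertexPoint n r 0} := by
  have hn' : n ≠ 0 := by omega
  intro x hx
  obtain ⟨z, rfl⟩ := proj_surjective n r x
  by_contra hne
  have hc : (z : ℂ) ∉ range (corner n r) := mt (proj_eq_vertexPoint hn' h1) hne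
  rw [← toSurface_coe] at hx
  by_cases hk : ∃ k, height n k z = apothem n r
  · obtain ⟨k, hk⟩ := hk
    exact hx (exists_flatChart_side hn hr h1 z.2 hc hk)
  · push Not at hk
    exact hx (exists_flatChart_interior hn hr h1 fun j =>
      (height_le_of_mem hn' hr z.2 j).lt_of_ne (hk j))

end Charts

/-- The closed sector of angle `π / n` around the direction of angle `π m / n`. -/
def sector (n : ℕ) (m : ℤ) : Set ℂ :=
  {ζ | ∃ x : ℝ, |x| ≤ 1 / 2 ∧ ζ = ‖ζ‖ * cis n (m + x)}

/-- The vertex at the apex of the corner of the polygon parametrized by the `m`-th sector; the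
multiplier `n - 1` makes the corners of consecutive sectors adjacent across a side. -/
def apexIndex (n : ℕ) (m : ℤ) : ℤ := (n - 1) * m + n

/-- The parametrization of a corner of the polygon by the `m`-th sector. The exponent is the ratio
of the interior angle `(n - 1) * π / n` of the polygon to the angle of the sector. -/
def wedgeMap (n : ℕ) (r : ℝ) (m : ℤ) (ζ : ℂ) : ℂ := ζ ^ (n - 1) + corner n r (apexIndex n m)

/-- Polar coordinates centred at the `k`-th vertex; `π y / n` is the angle to the inward
bisector. -/
def cornerPolar (n : ℕ) (r : ℝ) (k : ℤ) (σ y : ℝ) : ℂ := corner n r k + σ * cis n (k + n + y)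

/-- A radius of disjoint discs around the vertices, each of which meets only the two sides at its
centre. -/
structure IsVertexRadius (n : ℕ) (r δ : ℝ) : Prop where
  pos : 0 < δ
  le_one : δ ≤ 1
  height_lt {k : ℤ} {z : ℂ} : z ∈ Metric.closedBall (corner n r k) δ →
    ∀ j : ℤ, ¬ (2 * n : ℤ) ∣ j - k → ¬ (2 * n : ℤ) ∣ j - (k - 1) → height n j z < apothem n r
  dvd_sub {j k : ℤ} {z : ℂ} : z ∈ Metric.closedBall (corner n r j) δ →
    z ∈ Metric.closedBall (corner n r k) δ → (2 * n : ℤ) ∣ j - k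

section Vertex

variable {n : ℕ} {r : ℝ}

theorem cis_eq_cis_iff (hn : n ≠ 0) {x y : ℝ} :
    cis n x = cis n y ↔ ∃ q : ℤ, x = y + 2 * n * q := by
  constructor
  · intro h
    obtain ⟨q, hq⟩ := Complex.exp_eq_exp_iff_exists_int.1 h
    have hq' : Real.pi * x / n = Real.pi * y / n + q * (2 * Real.pi) := by
      simpa using congrArg Complex.im hq
    have hpi := Real.pi_ne_zero
    refine ⟨q, ?_⟩
    field_simp at hq'
    linarith
  · rintro ⟨q, rfl⟩
    exact cis_add_period hn y q

theorem exists_int_of_eq_norm_mul_cis (hn : n ≠ 0) {ζ : ℂ} (h0 : ζ ≠ 0) {x y : ℝ}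
    (hx : ζ = ‖ζ‖ * cis n x) (hy : ζ = ‖ζ‖ * cis n y) : ∃ q : ℤ, x = y + 2 * n * q := by
  rw [← cis_eq_cis_iff hn]
  exact mul_left_cancel₀ (Complex.ofReal_ne_zero.2 (norm_ne_zero_iff.2 h0)) (hx ▸ hy)

theorem pow_eq_norm_mul_cis {ζ : ℂ} {x : ℝ} (h : ζ = ‖ζ‖ * cis n x) (k : ℕ) :
    ζ ^ k = ‖ζ ^ k‖ * cis n (k * x) := by
  rw [cis_nat_mul, norm_pow, Complex.ofReal_pow, ← mul_pow, ← h]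

theorem sector_congr (hn : n ≠ 0) {j k : ℤ} (h : (2 * n : ℤ) ∣ j - k) :
    sector n j = sector n k := by
  simp only [sector, cis_congr hn h]

theorem exists_mem_sector (hn : n ≠ 0) (ζ : ℂ) : ∃ m : ℤ, ζ ∈ sector n m := by
  obtain ⟨x, -, hx⟩ := exists_norm_mul_cis hn ζ
  exact ⟨round x, x - round x, abs_sub_round x, by rwa [add_sub_cancel]⟩

theorem zero_mem_sector (n : ℕ) (m : ℤ) : (0 : ℂ) ∈ sector n m := ⟨0, by norm_num, by simp⟩

theorem mem_sector_pred {m : ℤ} {ζ : ℂ} (h : ζ = ‖ζ‖ * cis n (m + -(1 / 2))) :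
    ζ ∈ sector n (m - 1) := by
  refine ⟨1 / 2, by norm_num, ?_⟩
  rwa [show ((m - 1 : ℤ) : ℝ) + 1 / 2 = m + -(1 / 2) by push_cast; ring]

theorem mem_sector_succ {m : ℤ} {ζ : ℂ} (h : ζ = ‖ζ‖ * cis n (m + 1 / 2)) :
    ζ ∈ sector n (m + 1) := by
  refine ⟨-(1 / 2), by norm_num [abs_neg], ?_⟩
  rwa [show ((m + 1 : ℤ) : ℝ) + -(1 / 2) = m + 1 / 2 by push_cast; ring]

theorem isClosed_sector (n : ℕ) (m : ℤ) : IsClosed (sector n m) := by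
  have hclosed : IsClosed
      {q : ℂ × Icc (-(1 / 2) : ℝ) (1 / 2) | q.1 = ‖q.1‖ * cis n (m + q.2)} :=
    isClosed_eq (by fun_prop) (by unfold cis; fun_prop)
  convert isClosedMap_fst_of_compactSpace _ hclosed
  ext ζ
  simp [sector, abs_le]

theorem injOn_pow_sector (hn : 2 ≤ n) (m : ℤ) : InjOn (· ^ (n - 1)) (sector n m) := by
  rintro a ⟨x, hx, hax⟩ b ⟨y, hy, hby⟩ (hab : a ^ (n - 1) = b ^ (n - 1))
  have hN : n - 1 ≠ 0 := by omega
  rcases eq_or_ne a 0 with rfl | ha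
  · exact (eq_zero_of_pow_eq_zero (hab.symm.trans (zero_pow hN))).symm
  have hn2 : (2 : ℝ) ≤ n := by exact_mod_cast hn
  have hnorm : ‖a‖ = ‖b‖ := by
    refine (pow_left_inj₀ (norm_nonneg _) (norm_nonneg _) hN).1 ?_
    rw [← norm_pow, hab, norm_pow]
  obtain ⟨q, hq⟩ := exists_int_of_eq_norm_mul_cis (by omega) (pow_ne_zero _ ha)
    (pow_eq_norm_mul_cis hax (n - 1)) (hab ▸ pow_eq_norm_mul_cis hby (n - 1))
  rw [Nat.cast_pred (by omega)] at hq
  rw [abs_le] at hx hy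
  have hlt : |(q : ℝ)| < 1 := by
    have hle : |2 * n * (q : ℝ)| ≤ n - 1 := by
      rw [show 2 * n * (q : ℝ) = (n - 1) * (x - y) by linear_combination -hq]
      exact abs_le.2 ⟨by nlinarith, by nlinarith⟩
    rw [abs_mul, abs_of_pos (by linarith : (0 : ℝ) < 2 * n)] at hle
    nlinarith
  obtain rfl : q = 0 := Int.abs_lt_one_iff.1 (by exact_mod_cast hlt)
  have hxy : (n - 1 : ℝ) * (x - y) = 0 := by linear_combination hq
  obtain rfl : x = y := sub_eq_zero.1 ((mul_eq_zero.1 hxy).resolve_left (by linarith))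
  rw [hax, hby, hnorm]

theorem apexIndex_dvd {j k : ℤ} (h : (2 * n : ℤ) ∣ j - k) :
    (2 * n : ℤ) ∣ apexIndex n j - apexIndex n k := by
  rw [apexIndex, apexIndex, show ((n : ℤ) - 1) * j + n - ((n - 1) * k + n) = (n - 1) * (j - k) by
    ring]
  exact h.mul_left _

theorem dvd_of_apexIndex_dvd (he : Even n) {j k : ℤ}
    (h : (2 * n : ℤ) ∣ apexIndex n j - apexIndex n k) : (2 * n : ℤ) ∣ j - k := by
  obtain ⟨q, hq⟩ := h
  obtain ⟨m, rfl⟩ := he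
  refine ⟨(m + m - 1) * q - (m - 1) * (j - k), ?_⟩
  unfold apexIndex at hq
  push_cast at hq ⊢
  linear_combination ((m : ℤ) + m - 1) * hq

theorem exists_apexIndex_dvd (he : Even n) (q : ℤ) :
    ∃ l : ℤ, (2 * n : ℤ) ∣ apexIndex n l - q := by
  obtain ⟨m, rfl⟩ := he
  refine ⟨(m + m - 1) * (q - (m + m)), (m - 1) * (q - (m + m)), ?_⟩
  unfold apexIndex
  push_cast
  ring

theorem wedgeMap_congr (hn : n ≠ 0) {j k : ℤ} (h : (2 * n : ℤ) ∣ j - k) :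
    wedgeMap n r j = wedgeMap n r k := by
  funext ζ
  rw [wedgeMap, wedgeMap, corner_congr hn (apexIndex_dvd h)]

theorem wedgeMap_zero (hn : 2 ≤ n) (m : ℤ) : wedgeMap n r m 0 = corner n r (apexIndex n m) := by
  rw [wedgeMap, zero_pow (by omega), zero_add]

theorem wedgeMap_pred (hn : n ≠ 0) (m : ℤ) (ζ : ℂ) :
    wedgeMap n r (m - 1) ζ = crossing n r (apexIndex n m) (wedgeMap n r m ζ) := by
  have hcorner : corner n r (apexIndex n (m - 1)) = -corner n r (apexIndex n m + 1) := by
    rw [← corner_add_self hn]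
    exact corner_congr hn ⟨-1, by unfold apexIndex; ring⟩
  rw [crossing, wedgeMap, wedgeMap, hcorner, ← corner_add_corner_succ]
  ring

theorem wedgeMap_succ (hn : n ≠ 0) (m : ℤ) (ζ : ℂ) :
    wedgeMap n r (m + 1) ζ = crossing n r (apexIndex n m - 1) (wedgeMap n r m ζ) := by
  have hcorner : corner n r (apexIndex n (m + 1)) = -corner n r (apexIndex n m - 1) := by
    rw [← corner_add_self hn]
    exact corner_congr hn ⟨0, by unfold apexIndex; ring⟩
  rw [crossing, wedgeMap, wedgeMap, hcorner, ← corner_add_corner_succ, sub_add_cancel]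
  ring

theorem wedgeMap_norm_mul_cis (hn : 2 ≤ n) (m : ℤ) (ρ x : ℝ) :
    wedgeMap n r m (ρ * cis n (m + x)) =
      cornerPolar n r (apexIndex n m) (ρ ^ (n - 1)) ((n - 1) * x) := by
  have hangle : ((n - 1 : ℕ) : ℝ) * (m + x) + 2 * n * (1 : ℤ) =
      apexIndex n m + n + (n - 1) * x := by
    rw [Nat.cast_pred (by omega), apexIndex]
    push_cast
    ring
  rw [wedgeMap, mul_pow, ← cis_nat_mul, add_comm, ← cis_add_period (by omega) _ 1, hangle,
    cornerPolar, Complex.ofReal_pow]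

theorem height_cornerPolar (hn : n ≠ 0) (k : ℤ) (σ y : ℝ) :
    height n k (cornerPolar n r k σ y) =
      apothem n r - σ * Real.cos (Real.pi * (y - 1 / 2) / n) := by
  rw [cornerPolar, map_add, height_corner_self, height_ofReal_mul, height_apply, ← cis_add,
    show (k + n + y + -(k + 1 / 2) : ℝ) = (y - 1 / 2) + n by ring, cis_add_self hn, Complex.neg_re,
    cis_re]
  ring

theorem height_pred_cornerPolar (hn : n ≠ 0) (k : ℤ) (σ y : ℝ) :
    height n (k - 1) (cornerPolar n r k σ y) =
      apothem n r - σ * Real.cos (Real.pi * (y + 1 / 2) / n) := by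
  have hcorner : height n (k - 1) (corner n r k) = apothem n r := by
    simpa using height_corner_succ n r (k - 1)
  rw [cornerPolar, map_add, hcorner, height_ofReal_mul, height_apply, ← cis_add,
    show (k + n + y + -((k - 1 : ℤ) + 1 / 2) : ℝ) = (y + 1 / 2) + n by push_cast; ring,
    cis_add_self hn, Complex.neg_re, cis_re]
  ring

theorem exists_eq_cornerPolar (hn : n ≠ 0) (r : ℝ) (k : ℤ) (w : ℂ) :
    ∃ y : ℝ, |y| ≤ n ∧ w = cornerPolar n r k ‖w - corner n r k‖ y := by
  obtain ⟨y, hy, hwy⟩ := exists_norm_mul_cis hn ((w - corner n r k) * cis n (-(k + n)))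
  refine ⟨y, hy, ?_⟩
  rw [norm_mul, norm_cis, mul_one] at hwy
  rw [cornerPolar, cis_add, mul_left_comm, ← hwy, mul_left_comm, cis_mul_cis_neg, mul_one,
    add_sub_cancel]

theorem cos_pi_mul_div_nonneg (hn : n ≠ 0) {y : ℝ} (hy : |y| ≤ n / 2) :
    0 ≤ Real.cos (Real.pi * y / n) := by
  have hpi := Real.pi_pos
  rw [abs_le] at hy
  refine Real.cos_nonneg_of_mem_Icc ⟨?_, ?_⟩
  · rw [le_div_iff₀ (by positivity)]; nlinarith
  · rw [div_le_iff₀ (by positivity)]; nlinarith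

theorem cos_pi_mul_div_pos (hn : n ≠ 0) {y : ℝ} (hy : |y| < n / 2) :
    0 < Real.cos (Real.pi * y / n) := by
  have hpi := Real.pi_pos
  rw [abs_lt] at hy
  refine Real.cos_pos_of_mem_Ioo ⟨?_, ?_⟩
  · rw [lt_div_iff₀ (by positivity)]; nlinarith
  · rw [div_lt_iff₀ (by positivity)]; nlinarith

theorem cos_pi_mul_div_neg (hn : n ≠ 0) {y : ℝ} (hy : n / 2 < |y|) (hy' : |y| < 3 * n / 2) :
    Real.cos (Real.pi * y / n) < 0 := by
  have hpi := Real.pi_pos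
  have habs : |Real.pi * y / n| = Real.pi * |y| / n := by
    rw [abs_div, abs_mul, abs_of_pos hpi, Nat.abs_cast]
  rw [← Real.cos_abs, habs]
  refine Real.cos_neg_of_pi_div_two_lt_of_lt ?_ ?_
  · rw [lt_div_iff₀ (by positivity)]; nlinarith
  · rw [div_lt_iff₀ (by positivity)]; nlinarith

theorem cos_pi_mul_div_eq_zero_iff (hn : n ≠ 0) {y : ℝ} (hy : |y| ≤ n / 2) :
    Real.cos (Real.pi * y / n) = 0 ↔ |y| = n / 2 := by
  refine ⟨fun h => hy.antisymm (not_lt.1 fun hlt => (cos_pi_mul_div_pos hn hlt).ne' h),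
    fun h => ?_⟩
  have habs : |Real.pi * y / n| = Real.pi / 2 := by
    rw [abs_div, abs_mul, abs_of_pos Real.pi_pos, Nat.abs_cast, h]
    field_simp
  rw [← Real.cos_abs, habs, Real.cos_pi_div_two]

theorem height_cornerPolar_le (hn : n ≠ 0) (k : ℤ) {σ y : ℝ} (hσ : 0 ≤ σ)
    (hy : |y| ≤ (n - 1) / 2) : height n k (cornerPolar n r k σ y) ≤ apothem n r := by
  rw [height_cornerPolar hn]
  rw [abs_le] at hy
  exact sub_le_self _ (mul_nonneg hσ
    (cos_pi_mul_div_nonneg hn (abs_le.2 ⟨by linarith, by linarith⟩)))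

theorem height_pred_cornerPolar_le (hn : n ≠ 0) (k : ℤ) {σ y : ℝ} (hσ : 0 ≤ σ)
    (hy : |y| ≤ (n - 1) / 2) : height n (k - 1) (cornerPolar n r k σ y) ≤ apothem n r := by
  rw [height_pred_cornerPolar hn]
  rw [abs_le] at hy
  exact sub_le_self _ (mul_nonneg hσ
    (cos_pi_mul_div_nonneg hn (abs_le.2 ⟨by linarith, by linarith⟩)))

theorem abs_le_of_cornerPolar_mem_polygon (hn : 2 ≤ n) (hr : 0 < r) {k : ℤ} {σ y : ℝ}
    (hσ : 0 < σ) (hy : |y| ≤ n) (h : cornerPolar n r k σ y ∈ polygon n r) :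
    |y| ≤ (n - 1) / 2 := by
  have hn' : n ≠ 0 := by omega
  have hn2 : (2 : ℝ) ≤ n := by exact_mod_cast hn
  have h1 := height_le_of_mem hn' hr h k
  have h2 := height_le_of_mem hn' hr h (k - 1)
  rw [height_cornerPolar hn', sub_le_self_iff, mul_nonneg_iff_of_pos_left hσ] at h1
  rw [height_pred_cornerPolar hn', sub_le_self_iff, mul_nonneg_iff_of_pos_left hσ] at h2
  rw [abs_le] at hy ⊢
  refine ⟨not_lt.1 fun hlt => (cos_pi_mul_div_neg hn' ?_ ?_).not_ge h1,
    not_lt.1 fun hlt => (cos_pi_mul_div_neg hn' ?_ ?_).not_ge h2⟩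
  · exact lt_abs.2 (.inr (by linarith))
  · exact abs_lt.2 ⟨by linarith, by linarith⟩
  · exact lt_abs.2 (.inl (by linarith))
  · exact abs_lt.2 ⟨by linarith, by linarith⟩

theorem height_cornerPolar_eq_iff (hn : n ≠ 0) (k : ℤ) {σ y : ℝ} (hσ : 0 < σ)
    (hy : |y| ≤ (n - 1) / 2) :
    height n k (cornerPolar n r k σ y) = apothem n r ↔ y = -((n - 1) / 2) := by
  rw [abs_le] at hy
  rw [height_cornerPolar hn, sub_eq_self, mul_eq_zero_iff_left hσ.ne', cos_pi_mul_div_eq_zero_iff hn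
    (abs_le.2 ⟨by linarith, by linarith⟩), abs_eq (by positivity)]
  refine ⟨fun h => ?_, fun h => .inr (by linarith)⟩
  rcases h with h | h <;> linarith

theorem height_pred_cornerPolar_eq_iff (hn : n ≠ 0) (k : ℤ) {σ y : ℝ} (hσ : 0 < σ)
    (hy : |y| ≤ (n - 1) / 2) :
    height n (k - 1) (cornerPolar n r k σ y) = apothem n r ↔ y = (n - 1) / 2 := by
  rw [abs_le] at hy
  rw [height_pred_cornerPolar hn, sub_eq_self, mul_eq_zero_iff_left hσ.ne',
    cos_pi_mul_div_eq_zero_iff hn (abs_le.2 ⟨by linarith, by linarith⟩), abs_eq (by positivity)]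
  refine ⟨fun h => ?_, fun h => .inl (by linarith)⟩
  rcases h with h | h <;> linarith

theorem abs_sub_one_mul_le (hn : n ≠ 0) {x : ℝ} (hx : |x| ≤ 1 / 2) :
    |(n - 1) * x| ≤ ((n : ℝ) - 1) / 2 := by
  have hn1 : (0 : ℝ) ≤ n - 1 := by
    rw [← Nat.cast_pred (by omega)]
    positivity
  rw [abs_mul, abs_of_nonneg hn1]
  nlinarith

theorem wedgeMap_eq_cornerPolar (hn : 2 ≤ n) (r : ℝ) {m : ℤ} {a : ℂ} {x : ℝ}
    (hax : a = ‖a‖ * cis n (m + x)) : wedgeMap n r m a =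
      cornerPolar n r (apexIndex n m) (‖a‖ ^ (n - 1)) ((n - 1) * x) := by
  rw [← wedgeMap_norm_mul_cis hn, ← hax]

theorem height_wedgeMap_eq_iff (hn : 2 ≤ n) {m : ℤ} {a : ℂ} (ha : a ≠ 0) {x : ℝ}
    (hx : |x| ≤ 1 / 2) (hax : a = ‖a‖ * cis n (m + x)) :
    height n (apexIndex n m) (wedgeMap n r m a) = apothem n r ↔ x = -(1 / 2) := by
  have hn1 : (n : ℝ) - 1 ≠ 0 := sub_ne_zero.2 (by exact_mod_cast (by omega : n ≠ 1))
  rw [wedgeMap_eq_cornerPolar hn r hax, height_cornerPolar_eq_iff (by omega) _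
    (pow_pos (norm_pos_iff.2 ha) _) (abs_sub_one_mul_le (by omega) hx),
    show -(((n : ℝ) - 1) / 2) = (n - 1) * -(1 / 2) by ring, mul_right_inj' hn1]

theorem height_pred_wedgeMap_eq_iff (hn : 2 ≤ n) {m : ℤ} {a : ℂ} (ha : a ≠ 0) {x : ℝ}
    (hx : |x| ≤ 1 / 2) (hax : a = ‖a‖ * cis n (m + x)) :
    height n (apexIndex n m - 1) (wedgeMap n r m a) = apothem n r ↔ x = 1 / 2 := by
  have hn1 : (n : ℝ) - 1 ≠ 0 := sub_ne_zero.2 (by exact_mod_cast (by omega : n ≠ 1))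
  rw [wedgeMap_eq_cornerPolar hn r hax, height_pred_cornerPolar_eq_iff (by omega) _
    (pow_pos (norm_pos_iff.2 ha) _) (abs_sub_one_mul_le (by omega) hx), div_eq_mul_one_div,
    mul_right_inj' hn1]

theorem related_wedgeMap_pred (hn : 2 ≤ n) {m : ℤ} {a : ℂ} (ha : a ≠ 0)
    (hax : a = ‖a‖ * cis n (m + -(1 / 2))) :
    Related n r (wedgeMap n r m a) (wedgeMap n r (m - 1) a) :=
  .inr (.inl ⟨apexIndex n m, (height_wedgeMap_eq_iff hn ha (by norm_num [abs_neg]) hax).2 rfl,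
    wedgeMap_pred (by omega) m a⟩)

theorem related_wedgeMap (hn : 2 ≤ n) {m l : ℤ} {a : ℂ} (ham : a ∈ sector n m)
    (hal : a ∈ sector n l) : Related n r (wedgeMap n r m a) (wedgeMap n r l a) := by
  have hn' : n ≠ 0 := by omega
  rcases eq_or_ne a 0 with rfl | ha
  · rw [wedgeMap_zero hn, wedgeMap_zero hn]
    exact .inr (.inr ⟨mem_range_self _, mem_range_self _⟩)
  obtain ⟨x, hx, hax⟩ := ham
  obtain ⟨y, hy, hay⟩ := hal
  obtain ⟨q, hq⟩ := exists_int_of_eq_norm_mul_cis hn' ha hax hay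
  obtain ⟨d, hd⟩ : ∃ d : ℤ, d = m - l - 2 * n * q := ⟨_, rfl⟩
  have hdxy : (d : ℝ) = y - x := by
    rw [hd]
    push_cast
    linear_combination hq
  rw [abs_le] at hx hy
  have hd_le : d ≤ 1 := by exact_mod_cast (by linarith : (d : ℝ) ≤ 1)
  have hle_d : -1 ≤ d := by exact_mod_cast (by linarith : (-1 : ℝ) ≤ d)
  obtain rfl | rfl | rfl : d = -1 ∨ d = 0 ∨ d = 1 := by omega
  · obtain rfl : y = -(1 / 2) := by push_cast at hdxy; linarith
    rw [wedgeMap_congr hn' (k := l - 1) ⟨q, by linarith⟩]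
    exact (related_wedgeMap_pred hn ha hay).symm hn'
  · rw [wedgeMap_congr hn' (k := l) ⟨q, by linarith⟩]
    exact .inl rfl
  · obtain rfl : x = -(1 / 2) := by push_cast at hdxy; linarith
    rw [wedgeMap_congr hn' (j := l) (k := m - 1) ⟨-q, by linarith⟩]
    exact related_wedgeMap_pred hn ha hax

theorem exists_mem_sector_wedgeMap_eq (hn : 2 ≤ n) (hr : 0 < r) {w : ℂ} (hw : w ∈ polygon n r)
    (m : ℤ) : ∃ a ∈ sector n m, wedgeMap n r m a = w := by
  have hn2 : (2 : ℝ) ≤ n := by exact_mod_cast hn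
  obtain ⟨y, hy, hwy⟩ := exists_eq_cornerPolar (by omega : n ≠ 0) r (apexIndex n m) w
  set σ := ‖w - corner n r (apexIndex n m)‖
  rcases (norm_nonneg (w - corner n r (apexIndex n m))).eq_or_lt' with h0 | hpos
  · exact ⟨0, zero_mem_sector n m, by rw [wedgeMap_zero hn, sub_eq_zero.1 (norm_eq_zero.1 h0)]⟩
  have hyn := abs_le_of_cornerPolar_mem_polygon hn hr hpos hy (hwy ▸ hw)
  have hρ : 0 ≤ σ ^ ((n - 1 : ℕ) : ℝ)⁻¹ := Real.rpow_nonneg hpos.le _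
  refine ⟨(σ ^ ((n - 1 : ℕ) : ℝ)⁻¹ : ℝ) * cis n (m + y / (n - 1)), ⟨y / (n - 1), ?_, ?_⟩, ?_⟩
  · rw [abs_div, abs_of_pos (by linarith : (0 : ℝ) < n - 1), div_le_iff₀ (by linarith)]
    linarith
  · rw [norm_mul, norm_cis, mul_one, Complex.norm_real, Real.norm_of_nonneg hρ]
  · rw [wedgeMap_norm_mul_cis hn, Real.rpow_inv_natCast_pow hpos.le (by omega),
      mul_div_cancel₀ _ (by linarith), ← hwy]

theorem eventually_height_lt (hn : n ≠ 0) (r : ℝ) : ∀ᶠ δ in 𝓝[>] (0 : ℝ), ∀ c ∈ range (corner n r),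
    ∀ z ∈ Metric.closedBall c δ, ∀ j, height n j c < apothem n r → height n j z < apothem n r := by
  rw [eventually_all_finite (finite_range_corner hn r)]
  intro c _
  obtain ⟨ρ, hρ, hlt⟩ := exists_closedBall_height_lt hn r c
  filter_upwards [Ioc_mem_nhdsGT hρ] with δ hδ z hz
  exact hlt z (Metric.closedBall_subset_closedBall hδ.2 hz)

theorem eventually_disjoint_closedBall {X : Type*} [MetricSpace X] {s : Set X}
    (hs : s.Finite) : ∀ᶠ δ in 𝓝[>] (0 : ℝ), ∀ x ∈ s, ∀ y ∈ s, x ≠ y →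
      Disjoint (Metric.closedBall x δ) (Metric.closedBall y δ) := by
  simp only [eventually_all_finite hs]
  intro x _ y _
  rcases eq_or_ne x y with hxy | hxy
  · exact .of_forall fun _ h => absurd hxy h
  filter_upwards [Ioo_mem_nhdsGT (half_pos (dist_pos.2 hxy))] with δ hδ _
  exact Metric.closedBall_disjoint_closedBall (by linarith [hδ.2])

theorem exists_isVertexRadius (hn : 2 ≤ n) (hr : 0 < r) : ∃ δ, IsVertexRadius n r δ := by
  have hn' : n ≠ 0 := by omega
  have hone : ∀ᶠ δ in 𝓝[>] (0 : ℝ), δ ∈ Ioc 0 1 := Ioc_mem_nhdsGT zero_lt_one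
  obtain ⟨δ, hδ, hheight, hdisj⟩ := (hone.and ((eventually_height_lt hn' r).and
    (eventually_disjoint_closedBall (finite_range_corner hn' r)))).exists
  refine ⟨δ, hδ.1, hδ.2, fun {k z} hz j hk hk' => ?_, fun {j k z} hj hk => ?_⟩
  · refine hheight _ (mem_range_self k) z hz j (height_corner_lt hn' hr ?_ ?_)
    · rwa [dvd_sub_comm]
    · rwa [sub_right_comm, dvd_sub_comm]
  · rw [← corner_eq_corner_iff hn hr]
    exact by_contra fun hne =>
      disjoint_left.1 (hdisj _ (mem_range_self j) _ (mem_range_self k) hne) hj hk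

namespace IsVertexRadius

variable {δ : ℝ}

theorem wedgeMap_mem_closedBall (h : IsVertexRadius n r δ) (hn : 2 ≤ n) {a : ℂ}
    (ha : a ∈ Metric.closedBall 0 δ) (m : ℤ) :
    wedgeMap n r m a ∈ Metric.closedBall (corner n r (apexIndex n m)) δ := by
  rw [mem_closedBall_zero_iff] at ha
  rw [mem_closedBall_iff_norm, wedgeMap, add_sub_cancel_right, norm_pow]
  exact (pow_le_of_le_one (norm_nonneg a) (ha.trans h.le_one) (by omega)).trans ha

theorem wedgeMap_mem_polygon (h : IsVertexRadius n r δ) (hn : 2 ≤ n) (hr : 0 < r) {m : ℤ} {a : ℂ}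
    (ha : a ∈ sector n m ∩ Metric.closedBall 0 δ) : wedgeMap n r m a ∈ polygon n r := by
  have hn' : n ≠ 0 := by omega
  obtain ⟨⟨x, hx, hax⟩, haδ⟩ := ha
  have hy := abs_sub_one_mul_le hn' hx
  have hpow := pow_nonneg (norm_nonneg a) (n - 1)
  refine (mem_polygon_iff hn hr _).2 fun j => ?_
  by_cases hj : (2 * n : ℤ) ∣ j - apexIndex n m
  · rw [height_congr hn' hj, wedgeMap_eq_cornerPolar hn r hax]
    exact height_cornerPolar_le hn' _ hpow hy
  by_cases hj' : (2 * n : ℤ) ∣ j - (apexIndex n m - 1)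
  · rw [height_congr hn' hj', wedgeMap_eq_cornerPolar hn r hax]
    exact height_pred_cornerPolar_le hn' _ hpow hy
  exact (h.height_lt (h.wedgeMap_mem_closedBall hn haδ m) j hj hj').le

theorem eq_of_wedgeMap_eq (h : IsVertexRadius n r δ) (hn : 2 ≤ n) (he : Even n) {m l : ℤ} {a b : ℂ}
    (ha : a ∈ sector n m ∩ Metric.closedBall 0 δ) (hb : b ∈ sector n l ∩ Metric.closedBall 0 δ)
    (hab : wedgeMap n r m a = wedgeMap n r l b) : a = b := by
  have hn' : n ≠ 0 := by omega
  have hdvd := dvd_of_apexIndex_dvd he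
    (h.dvd_sub (h.wedgeMap_mem_closedBall hn ha.2 m) (hab ▸ h.wedgeMap_mem_closedBall hn hb.2 l))
  rw [wedgeMap_congr hn' hdvd] at hab
  exact injOn_pow_sector hn m ha.1 (sector_congr hn' hdvd ▸ hb.1) (add_right_cancel hab)

theorem wedgeMap_ne_corner (h : IsVertexRadius n r δ) (hn : 2 ≤ n) {a : ℂ} (ha : a ≠ 0)
    (haδ : a ∈ Metric.closedBall 0 δ) (m : ℤ) : wedgeMap n r m a ∉ range (corner n r) := by
  rintro ⟨q, hq⟩
  have hdvd := h.dvd_sub (Metric.mem_closedBall_self h.pos.le)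
    (hq ▸ h.wedgeMap_mem_closedBall hn haδ m)
  rw [corner_congr (by omega) hdvd, wedgeMap, right_eq_add] at hq
  exact pow_ne_zero _ ha hq

theorem exists_wedgeMap_eq_of_related (h : IsVertexRadius n r δ) (hn : 2 ≤ n) (hr : 0 < r)
    (he : Even n) {m : ℤ} {a : ℂ} (ha : a ∈ sector n m ∩ Metric.closedBall 0 δ) {w : ℂ}
    (hw : Related n r (wedgeMap n r m a) w) : ∃ l : ℤ, a ∈ sector n l ∧ wedgeMap n r l a = w := by
  have hn' : n ≠ 0 := by omega
  rcases eq_or_ne a 0 with rfl | ha0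
  · rw [wedgeMap_zero hn] at hw
    obtain ⟨q, rfl⟩ := hw.mem_range_corner hn' hr (mem_range_self _)
    obtain ⟨l, hl⟩ := exists_apexIndex_dvd he q
    exact ⟨l, zero_mem_sector n l, by rw [wedgeMap_zero hn, corner_congr hn' hl]⟩
  obtain ⟨⟨x, hx, hax⟩, haδ⟩ := id ha
  rcases hw with hw | ⟨j, hj, rfl⟩ | ⟨hcorner, -⟩
  · exact ⟨m, ha.1, hw⟩
  · by_cases hd : (2 * n : ℤ) ∣ j - apexIndex n m
    · rw [height_congr hn' hd, height_wedgeMap_eq_iff hn ha0 hx hax] at hj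
      exact ⟨m - 1, mem_sector_pred (hj ▸ hax), by rw [wedgeMap_pred hn', crossing_congr hn' hd]⟩
    by_cases hd' : (2 * n : ℤ) ∣ j - (apexIndex n m - 1)
    · rw [height_congr hn' hd', height_pred_wedgeMap_eq_iff hn ha0 hx hax] at hj
      exact ⟨m + 1, mem_sector_succ (hj ▸ hax), by rw [wedgeMap_succ hn', crossing_congr hn' hd']⟩
    exact absurd hj (h.height_lt (h.wedgeMap_mem_closedBall hn haδ m) j hd hd').ne
  · exact absurd hcorner (h.wedgeMap_ne_corner hn ha0 haδ m)

theorem eventually_mem_image_wedgeMap (h : IsVertexRadius n r δ) (hn : 2 ≤ n) (hr : 0 < r) {m : ℤ}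
    {a : ℂ} (ha : a ∈ Metric.ball 0 δ) : ∀ᶠ w in 𝓝[polygon n r] (wedgeMap n r m a),
      w ∈ wedgeMap n r m '' (sector n m ∩ Metric.ball 0 δ) := by
  rw [mem_ball_zero_iff] at ha
  have hmem : wedgeMap n r m a ∈ Metric.ball (corner n r (apexIndex n m)) (δ ^ (n - 1)) := by
    rw [mem_ball_iff_norm, wedgeMap, add_sub_cancel_right, norm_pow]
    exact pow_lt_pow_left₀ ha (norm_nonneg a) (by omega)
  filter_upwards [self_mem_nhdsWithin,
    mem_nhdsWithin_of_mem_nhds (Metric.isOpen_ball.mem_nhds hmem)] with w hwP hw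
  obtain ⟨b, hb, rfl⟩ := exists_mem_sector_wedgeMap_eq hn hr hwP m
  rw [mem_ball_iff_norm, wedgeMap, add_sub_cancel_right, norm_pow] at hw
  exact ⟨b, ⟨hb, mem_ball_zero_iff.2 (lt_of_pow_lt_pow_left₀ _ h.pos.le hw)⟩, rfl⟩

theorem discPieces (h : IsVertexRadius n r δ) (hn : 2 ≤ n) (hr : 0 < r) (he : Even n) :
    DiscPieces n r (fun m : Fin (2 * n) => sector n (m : ℕ))
      (fun m : Fin (2 * n) => wedgeMap n r (m : ℕ)) 0 δ := by
  have hn' : n ≠ 0 := by omega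
  have hfin (k : ℤ) : ∃ m : Fin (2 * n), sector n k = sector n (m : ℕ) ∧
      wedgeMap n r k = wedgeMap n r (m : ℕ) := by
    obtain ⟨m, hm, hd⟩ := exists_nat_dvd_sub hn' k
    exact ⟨⟨m, hm⟩, sector_congr hn' hd, wedgeMap_congr hn' hd⟩
  refine ⟨fun m => isClosed_sector n _, fun m => by unfold wedgeMap; fun_prop, fun a _ => ?_,
    fun m a ha => h.wedgeMap_mem_polygon hn hr ha,
    fun m l a ha hal => related_wedgeMap hn ha.1 hal,
    fun m l a ha b hb hab => h.eq_of_wedgeMap_eq hn he ha hb hab, fun m a ha w hw => ?_,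
    fun m a ha => ?_⟩
  · obtain ⟨k, hk⟩ := exists_mem_sector hn' a
    obtain ⟨m, hm, -⟩ := hfin k
    exact mem_iUnion.2 ⟨m, hm ▸ hk⟩
  · obtain ⟨k, hak, hk⟩ := h.exists_wedgeMap_eq_of_related hn hr he ha hw
    obtain ⟨l, hl, hl'⟩ := hfin k
    exact ⟨l, hl ▸ hak, hl' ▸ hk⟩
  · exact (h.eventually_mem_image_wedgeMap hn hr ha.2).mono fun w hw => ⟨m, hw⟩

end IsVertexRadius

end Vertex

section ConePoints

variable {n : ℕ} {r : ℝ} {φ ψ : OpenPartialHomeomorph (Surface n r) ℂ}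

theorem conePoints_two_eq_empty (hr : 0 < r) (h1 : OneVertex 2 r) : conePoints 2 r = ∅ := by
  obtain ⟨δ, hδ⟩ := exists_isVertexRadius le_rfl hr
  have h := hδ.discPieces le_rfl hr even_two
  have htranslation : (fun m : Fin (2 * 2) => wedgeMap 2 r (m : ℕ)) =
      fun (m : Fin (2 * 2)) (a : ℂ) => a + corner 2 r (apexIndex 2 (m : ℕ)) := by
    funext m a
    simp [wedgeMap]
  rw [htranslation] at h
  have hflat := h.exists_flatChart le_rfl hr h1 hδ.pos (i := 0) (zero_mem_sector 2 _)
  rw [zero_add, toSurface_corner two_ne_zero h1] at hflat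
  rw [eq_empty_iff_forall_notMem]
  intro x hx
  obtain rfl : x = vertexPoint 2 r 0 := conePoints_subset le_rfl hr h1 hx
  exact hx hflat

theorem IsVertexRadius.cornerPolar_mem_openPolygon {δ : ℝ} (hδ : IsVertexRadius n r δ)
    (hn : n ≠ 0) (k : ℤ) {σ y : ℝ} (hσ : σ ∈ Ioc 0 δ) (hy : |y| < (n - 1) / 2) :
    cornerPolar n r k σ y ∈ openPolygon n r := by
  intro j
  have hy' := abs_lt.1 hy
  by_cases hj : (2 * n : ℤ) ∣ j - k
  · rw [height_congr hn hj]
    refine (height_cornerPolar_le hn k hσ.1.le hy.le).lt_of_ne fun h => ?_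
    linarith [(height_cornerPolar_eq_iff hn k hσ.1 hy.le).1 h]
  by_cases hj' : (2 * n : ℤ) ∣ j - (k - 1)
  · rw [height_congr hn hj']
    refine (height_pred_cornerPolar_le hn k hσ.1.le hy.le).lt_of_ne fun h => ?_
    linarith [(height_pred_cornerPolar_eq_iff hn k hσ.1 hy.le).1 h]
  refine hδ.height_lt ?_ j hj hj'
  rw [cornerPolar, Metric.mem_closedBall, dist_eq_norm, add_sub_cancel_left, norm_mul, norm_cis,
    mul_one, Complex.norm_real, Real.norm_of_nonneg hσ.1.le]
  exact hσ.2

theorem IsVertexRadius.ray_mem_openPolygon {δ : ℝ} (hδ : IsVertexRadius n r δ) (hn : n ≠ 0)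
    {k : ℤ} {u : ℂ} (hu : u ≠ 0) {y : ℝ} (huy : u = ‖u‖ * cis n (k + n + y))
    (hy : |y| < (n - 1) / 2) {t : ℝ} (ht : t ∈ Ioo 0 (δ / ‖u‖)) :
    corner n r k + t * u ∈ openPolygon n r := by
  have hpos := norm_pos_iff.2 hu
  have hpolar : corner n r k + t * u = cornerPolar n r k (t * ‖u‖) y := by
    rw [cornerPolar, Complex.ofReal_mul, mul_assoc, ← huy]
  rw [hpolar]
  exact hδ.cornerPolar_mem_openPolygon hn k ⟨mul_pos ht.1 hpos, ((lt_div_iff₀ hpos).1 ht.2).le⟩ hy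

-- The interior angle exceeds twice the angle `π / n` between the bisectors at consecutive vertices,
-- so every direction points into the polygon at two consecutive vertices.
theorem exists_two_rays (hn : 4 ≤ n) (hr : 0 < r) {u : ℂ} (hu : u ≠ 0) :
    ∃ k l : ℤ, corner n r k ≠ corner n r l ∧ ∃ ε > 0, ∀ t ∈ Ioo (0 : ℝ) ε,
      corner n r k + t * u ∈ openPolygon n r ∧ corner n r l + t * u ∈ openPolygon n r := by
  have hn' : n ≠ 0 := by omega
  have hn4 : (4 : ℝ) ≤ n := by exact_mod_cast hn
  obtain ⟨δ, hδ⟩ := exists_isVertexRadius (by omega : 2 ≤ n) hr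
  obtain ⟨x, -, hx⟩ := exists_norm_mul_cis hn' u
  have hfract := Int.floor_add_fract x
  have h0 := Int.fract_nonneg x
  have hlt := Int.fract_lt_one x
  refine ⟨⌊x⌋ - n, ⌊x⌋ - n + 1, fun h => ?_, δ / ‖u‖, div_pos hδ.pos (norm_pos_iff.2 hu),
    fun t ht => ⟨hδ.ray_mem_openPolygon hn' hu (y := Int.fract x) ?_ ?_ ht,
      hδ.ray_mem_openPolygon hn' hu (y := Int.fract x - 1) ?_ ?_ ht⟩⟩
  · rw [corner_eq_corner_iff (by omega) hr, sub_add_cancel_left] at h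
    have := Int.le_of_dvd one_pos (dvd_neg.1 h)
    omega
  · convert hx using 3
    push_cast
    linarith
  · exact abs_lt.2 ⟨by linarith, by linarith⟩
  · convert hx using 3
    push_cast
    linarith
  · exact abs_lt.2 ⟨by linarith, by linarith⟩

theorem tendsto_add_mul_nhdsWithin {s : Set ℂ} {l : Filter ℝ} {t₀ : ℝ} (hl : l ≤ 𝓝 t₀) {z u : ℂ}
    (hs : ∀ᶠ t : ℝ in l, z + t * u ∈ s) :
    Tendsto (fun t : ℝ => z + t * u) l (𝓝[s] (z + t₀ * u)) := by
  have hcont : Continuous fun t : ℝ => z + t * u := by fun_prop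
  exact tendsto_nhdsWithin_iff.2 ⟨(hcont.tendsto t₀).mono_left hl, hs⟩

theorem tendsto_corner_ray (hn : 2 ≤ n) (hr : 0 < r) {k : ℤ} {u : ℂ} {ε : ℝ} (hε : 0 < ε)
    (h : ∀ t ∈ Ioo (0 : ℝ) ε, corner n r k + t * u ∈ openPolygon n r) :
    Tendsto (fun t : ℝ => corner n r k + t * u) (𝓝[>] 0) (𝓝[polygon n r] (corner n r k)) := by
  have hlim := tendsto_add_mul_nhdsWithin (z := corner n r k) (u := u) nhdsWithin_le_nhds
    (eventually_of_mem (Ioo_mem_nhdsGT hε) fun t ht => openPolygon_subset_polygon hn hr (h t ht))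
  simpa only [Complex.ofReal_zero, zero_mul, add_zero] using hlim

theorem injOn_toSurface_openPolygon (hn : 2 ≤ n) (hr : 0 < r) (h1 : OneVertex n r) :
    InjOn (toSurface n r) (openPolygon n r) := by
  intro z hz w hw h
  have hsub := openPolygon_subset_polygon hn hr
  rw [toSurface_eq_iff hn hr h1 (hsub hz) (hsub hw)] at h
  exact ((h.eq_or_crossing (k := 0) hn fun j _ => hz j).resolve_right fun h => (hz 0).ne h.1).symm

theorem toSurface_ray_ne (hn : 2 ≤ n) (hr : 0 < r) (h1 : OneVertex n r) {z w v : ℂ} (hne : z ≠ w)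
    (hz : z + v ∈ openPolygon n r) (hw : w + v ∈ openPolygon n r) :
    toSurface n r (z + v) ≠ toSurface n r (w + v) :=
  fun h => hne (add_right_cancel (injOn_toSurface_openPolygon hn hr h1 hz hw h))

theorem IsFlatChart.eventually_toSurface (hφ : IsFlatChart n r φ) {z : ℂ} (hz : z ∈ polygon n r)
    (hzφ : toSurface n r z ∈ φ.source) : ∀ᶠ w in 𝓝[polygon n r] z, toSurface n r w ∈ φ.source ∧
      φ (toSurface n r w) = φ (toSurface n r z) + (w - z) := by
  have hsource := (continuousOn_toSurface n r z hz).eventually (φ.open_source.mem_nhds hzφ)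
  rw [toSurface_of_mem hz] at hzφ
  obtain ⟨c, hc⟩ := hφ ⟨z, hz⟩ hzφ
  have htranslation : ∀ᶠ w in 𝓝[polygon n r] z, φ (toSurface n r w) = w + c := by
    rw [nhdsWithin_eq_map_subtype_coe hz, eventually_map]
    filter_upwards [hc] with w hw
    rw [toSurface_coe, hw]
  filter_upwards [hsource, htranslation] with w hwφ hw
  refine ⟨hwφ, ?_⟩
  rw [hw, htranslation.self_of_nhdsWithin hz]
  ring

theorem IsFlatChart.eventually_corner_ray (hφ : IsFlatChart n r φ)
    (hp : vertexPoint n r 0 ∈ φ.source) (hn : 2 ≤ n) (hr : 0 < r) (h1 : OneVertex n r) {k : ℤ}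
    {u : ℂ} {ε : ℝ} (hε : 0 < ε)
    (h : ∀ t ∈ Ioo (0 : ℝ) ε, corner n r k + t * u ∈ openPolygon n r) :
    ∀ᶠ t : ℝ in 𝓝[>] 0, toSurface n r (corner n r k + t * u) ∈ φ.source ∧
      φ (toSurface n r (corner n r k + t * u)) = φ (vertexPoint n r 0) + t * u := by
  have hn' : n ≠ 0 := by omega
  have hev := hφ.eventually_toSurface (corner_mem_polygon hn' k) (by rwa [toSurface_corner hn' h1])
  filter_upwards [(tendsto_corner_ray hn hr hε h).eventually hev] with t ht
  rwa [toSurface_corner hn' h1, add_sub_cancel_left] at ht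

-- Parallel rays from two vertices would have the same image in a flat chart at the vertex point.
theorem conePoints_eq_singleton (hn : 4 ≤ n) (hr : 0 < r) (h1 : OneVertex n r) :
    conePoints n r = {vertexPoint n r 0} := by
  have hn2 : 2 ≤ n := by omega
  refine (conePoints_subset hn2 hr h1).antisymm ?_
  rintro _ rfl ⟨φ, hφ, hp⟩
  obtain ⟨k, l, hkl, ε, hε, hrays⟩ := exists_two_rays (u := 1) hn hr one_ne_zero
  obtain ⟨t, ⟨hkφ, hk⟩, ⟨hlφ, hl⟩, ht⟩ :=
    ((hφ.eventually_corner_ray hp hn2 hr h1 hε fun t ht => (hrays t ht).1).and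
      ((hφ.eventually_corner_ray hp hn2 hr h1 hε fun t ht => (hrays t ht).2).and
        (Ioo_mem_nhdsGT hε))).exists
  exact toSurface_ray_ne hn2 hr h1 hkl (hrays t ht).1 (hrays t ht).2
    (φ.injOn hkφ hlφ (hk.trans hl.symm))

end ConePoints

section OrientedAtlas

/-- A map with nonvanishing complex derivative at the points of `s`. Transition maps with this
property are smooth and preserve the orientation. -/
def IsConformalOn (f : ℂ → ℂ) (s : Set ℂ) : Prop := ∀ z ∈ s, ∃ d ≠ 0, HasDerivAt f d z

variable {S : Type*} [TopologicalSpace S] {φ ψ : OpenPartialHomeomorph S ℂ}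

theorem IsConformalOn.contDiffOn {f : ℂ → ℂ} {s : Set ℂ} (h : IsConformalOn f s) (hs : IsOpen s) :
    ContDiffOn ℝ ∞ f s := by
  have hdiff : DifferentiableOn ℂ f s := fun z hz =>
    let ⟨_, _, hd⟩ := h z hz
    hd.differentiableAt.differentiableWithinAt
  exact (hdiff.contDiffOn hs).restrict_scalars ℝ

theorem IsConformalOn.det_fderiv_pos {f : ℂ → ℂ} {s : Set ℂ} (h : IsConformalOn f s) {z : ℂ}
    (hz : z ∈ s) : 0 < (fderiv ℝ f z).det := by
  obtain ⟨d, hd0, hd⟩ := h z hz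
  have hf : HasFDerivAt f (d • (1 : ℂ →L[ℝ] ℂ)) z := hd.complexToReal_fderiv
  have hdet : (d • (1 : ℂ →L[ℝ] ℂ)).det = Complex.normSq d := by
    rw [← Algebra.norm_complex_apply, Algebra.norm_apply, ContinuousLinearMap.det]
    congr 1
  rw [hf.fderiv, hdet]
  exact Complex.normSq_pos.2 hd0

theorem IsConformalOn.transition_symm
    (h : IsConformalOn (ψ ∘ φ.symm) (φ.symm.trans ψ).source) :
    IsConformalOn (φ ∘ ψ.symm) (ψ.symm.trans φ).source := by
  intro z hz
  have hz' : z ∈ (φ.symm.trans ψ).target := by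
    rwa [← OpenPartialHomeomorph.symm_source, OpenPartialHomeomorph.trans_symm_eq_symm_trans_symm]
  obtain ⟨d, hd0, hd⟩ := h _ ((φ.symm.trans ψ).map_target hz')
  exact ⟨d⁻¹, inv_ne_zero hd0, (φ.symm.trans ψ).hasDerivAt_symm hz' hd0 hd⟩

theorem isConformalOn_transition_self (φ : OpenPartialHomeomorph S ℂ) :
    IsConformalOn (φ ∘ φ.symm) (φ.symm.trans φ).source := by
  intro z hz
  refine ⟨1, one_ne_zero, (hasDerivAt_id z).congr_of_eventuallyEq ?_⟩
  filter_upwards [φ.open_target.mem_nhds hz.1] with w hw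
  exact φ.right_inv hw

theorem IsTranslationAtlas.isConformalOn_transition {A : Set (OpenPartialHomeomorph S ℂ)}
    (hA : IsTranslationAtlas A) (hφ : φ ∈ A) (hψ : ψ ∈ A) :
    IsConformalOn (ψ ∘ φ.symm) (φ.symm.trans ψ).source := by
  intro z hz
  have hzφ : z ∈ φ.target := hz.1
  have hev := (φ.continuousAt_symm hzφ).eventually (hA φ hφ ψ hψ _ ⟨φ.map_target hzφ, hz.2⟩)
  refine ⟨1, one_ne_zero, ((hasDerivAt_id z).add_const
    (ψ (φ.symm z) - φ (φ.symm z))).congr_of_eventuallyEq ?_⟩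
  filter_upwards [hev, φ.open_target.mem_nhds hzφ] with w hw hwφ
  rw [Function.comp_apply, hw, φ.right_inv hwφ]
  rfl

theorem isClosedOrientableSurface_of_isConformalOn [T2Space S] [CompactSpace S] [ConnectedSpace S]
    {A : Set (OpenPartialHomeomorph S ℂ)} (hcover : uncharted A = ∅)
    (hA : ∀ φ ∈ A, ∀ ψ ∈ A, IsConformalOn (ψ ∘ φ.symm) (φ.symm.trans ψ).source) :
    IsClosedOrientableSurface S where
  t2 := inferInstance
  compact := inferInstance
  connected := inferInstance
  oriented_atlas := ⟨A, fun _ => notMem_uncharted_iff.1 (hcover ▸ notMem_empty _),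
    fun φ hφ ψ hψ => ⟨(hA φ hφ ψ hψ).contDiffOn (φ.symm.trans ψ).open_source,
      fun _ => (hA φ hφ ψ hψ).det_fderiv_pos⟩⟩

end OrientedAtlas

section VertexChart

variable {n : ℕ} {r : ℝ} {Φ ψ : OpenPartialHomeomorph (Surface n r) ℂ}

theorem DiscPieces.eventually_transition_eq {ι : Type*} [Finite ι] {C : ι → Set ℂ} {g : ℂ → ℂ}
    {t : ι → ℂ} {c ρ : ℝ} (h : DiscPieces n r C (fun i a => g a + t i) c ρ)
    (hΦt : Φ.target = Metric.ball (c : ℂ) ρ)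
    (hΦ : ∀ i, ∀ a ∈ C i ∩ Metric.ball (c : ℂ) ρ, Φ.symm a = toSurface n r (g a + t i))
    (hψ : IsFlatChart n r ψ) {a₀ : ℂ} (ha₀ : a₀ ∈ (Φ.symm.trans ψ).source) :
    ∀ᶠ a in 𝓝 a₀, (ψ ∘ Φ.symm) a = g a + ((ψ ∘ Φ.symm) a₀ - g a₀) := by
  rw [OpenPartialHomeomorph.trans_source, OpenPartialHomeomorph.symm_source, hΦt] at ha₀
  obtain ⟨hB, hψs⟩ := ha₀
  have hBK := Metric.ball_subset_closedBall (x := (c : ℂ)) (ε := ρ)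
  have hpiece : ∀ i, ∀ᶠ a in 𝓝 a₀, a ∈ C i →
      (ψ ∘ Φ.symm) a = g a + ((ψ ∘ Φ.symm) a₀ - g a₀) := by
    intro i
    by_cases hi : a₀ ∈ C i
    swap
    · filter_upwards [(h.isClosed i).isOpen_compl.mem_nhds hi] with a ha ha'
      exact absurd ha' ha
    have hsource : toSurface n r (g a₀ + t i) ∈ ψ.source := hΦ i a₀ ⟨hi, hB⟩ ▸ hψs
    have hev := eventually_nhdsWithin_iff.1
      (hψ.eventually_toSurface (h.mapsTo i ⟨hi, hBK hB⟩) hsource)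
    filter_upwards [(h.continuous i).continuousAt.eventually hev,
      Metric.isOpen_ball.mem_nhds hB] with a hev haB ha
    rw [Function.comp_apply, Function.comp_apply, hΦ i a ⟨ha, haB⟩, hΦ i a₀ ⟨hi, hB⟩,
      (hev (h.mapsTo i ⟨ha, hBK haB⟩)).2]
    ring
  filter_upwards [eventually_all.2 hpiece, Metric.isOpen_ball.mem_nhds hB] with a ha haB
  obtain ⟨i, hi⟩ := mem_iUnion.1 (h.cover (hBK haB))
  exact ha i hi

theorem exists_vertexChart (hn : 2 ≤ n) (hr : 0 < r) (h1 : OneVertex n r) :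
    ∃ Φ : OpenPartialHomeomorph (Surface n r) ℂ,
      vertexPoint n r 0 ∈ Φ.source ∧ Φ (vertexPoint n r 0) = 0 ∧
      ∀ ψ, IsFlatChart n r ψ → ∀ a₀ ∈ (Φ.symm.trans ψ).source, ∀ᶠ a in 𝓝 a₀,
        (ψ ∘ Φ.symm) a = a ^ (n - 1) + ((ψ ∘ Φ.symm) a₀ - a₀ ^ (n - 1)) := by
  obtain ⟨δ, hδ⟩ := exists_isVertexRadius hn hr
  have h := hδ.discPieces hn hr (even_of_oneVertex hn hr h1)
  obtain ⟨Φ, hΦt, hΦ⟩ := h.exists_chart hn hr h1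
  have h0 : (0 : ℂ) ∈ Φ.target := hΦt ▸ Metric.mem_ball_self hδ.pos
  have hvertex : Φ.symm 0 = vertexPoint n r 0 := by
    rw [hΦ ⟨0, by omega⟩ 0 ⟨zero_mem_sector n _, hΦt ▸ h0⟩, wedgeMap_zero hn,
      toSurface_corner (by omega) h1]
  refine ⟨Φ, hvertex ▸ Φ.map_target h0, hvertex ▸ Φ.right_inv h0, fun ψ hψ a₀ ha₀ => ?_⟩
  exact h.eventually_transition_eq hΦt hΦ hψ ha₀

theorem isConformalOn_vertexChart_transition (hn : 2 ≤ n) (hr : 0 < r) (h1 : OneVertex n r)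
    (hp : vertexPoint n r 0 ∈ Φ.source) (h0 : Φ (vertexPoint n r 0) = 0)
    (hψ : IsFlatChart n r ψ) (hpow : ∀ a₀ ∈ (Φ.symm.trans ψ).source, ∀ᶠ a in 𝓝 a₀,
      (ψ ∘ Φ.symm) a = a ^ (n - 1) + ((ψ ∘ Φ.symm) a₀ - a₀ ^ (n - 1))) :
    IsConformalOn (ψ ∘ Φ.symm) (Φ.symm.trans ψ).source := by
  intro a₀ ha₀
  refine ⟨((n - 1 : ℕ) : ℂ) * a₀ ^ (n - 1 - 1), ?_,
    ((hasDerivAt_pow (n - 1) a₀).add_const _).congr_of_eventuallyEq (hpow a₀ ha₀)⟩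
  refine mul_ne_zero (Nat.cast_ne_zero.2 (by omega)) ?_
  rcases eq_or_ne a₀ 0 with rfl | hne
  swap
  · exact pow_ne_zero _ hne
  -- A flat chart at the vertex exists only for `n = 2`, where the exponent vanishes.
  have hpψ : vertexPoint n r 0 ∈ ψ.source := by
    rw [← Φ.left_inv hp, h0]
    exact ha₀.2
  have hn4 : ¬ 4 ≤ n := fun h4 =>
    (conePoints_eq_singleton h4 hr h1).superset rfl ⟨ψ, hψ, hpψ⟩
  obtain ⟨m, hm⟩ := even_of_oneVertex hn hr h1
  rw [show n - 1 - 1 = 0 by omega, pow_zero]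
  exact one_ne_zero

theorem isClosedOrientableSurface_surface (hn : 2 ≤ n) (hr : 0 < r) (h1 : OneVertex n r) :
    IsClosedOrientableSurface (Surface n r) := by
  have hn' : n ≠ 0 := by omega
  have := compactSpace_surface hn' r
  have := connectedSpace_surface hn' r
  have := t2Space_surface hn hr h1
  obtain ⟨Φ, hp, h0, hpow⟩ := exists_vertexChart hn hr h1
  have hΦ : ∀ ψ, IsFlatChart n r ψ → IsConformalOn (ψ ∘ Φ.symm) (Φ.symm.trans ψ).source :=
    fun ψ hψ => isConformalOn_vertexChart_transition hn hr h1 hp h0 hψ (hpow ψ hψ)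
  refine isClosedOrientableSurface_of_isConformalOn (A := insert Φ (flatCharts n r)) ?_ ?_
  · refine eq_empty_of_forall_notMem fun x => notMem_uncharted_iff.2 ?_
    by_cases hx : x ∈ conePoints n r
    · exact ⟨Φ, mem_insert _ _, conePoints_subset hn hr h1 hx ▸ hp⟩
    · obtain ⟨φ, hφ, hxφ⟩ := not_not.1 hx
      exact ⟨φ, mem_insert_of_mem _ hφ, hxφ⟩
  · rintro φ (rfl | hφ) ψ (rfl | hψ)
    · exact isConformalOn_transition_self _
    · exact hΦ ψ hψ
    · exact (hΦ φ hφ).transition_symm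
    · exact (isTranslationAtlas_flatCharts hn hr h1).isConformalOn_transition hφ hψ

end VertexChart

section Foliation

variable {n : ℕ} {r : ℝ} {u : ℂ}

theorem lines_eq_leaves (n : ℕ) (r : ℝ) (u : ℂ) : lines n r u = leaves (flatCharts n r) u := by
  ext L
  constructor
  · rintro ⟨I, γ, hI, hne, hconn, hγ, hcont, hcone, rfl⟩
    exact ⟨γ, I, ⟨hI, hne, hconn, hγ, hcont, hcone⟩, rfl⟩
  · rintro ⟨γ, I, ⟨hI, hne, hconn, hγ, hcont, hcone⟩, rfl⟩
    exact ⟨I, γ, hI, hne, hconn, hγ, hcont, hcone, rfl⟩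

theorem conePoints_subsingleton (hn : 2 ≤ n) (hr : 0 < r) (h1 : OneVertex n r) :
    (conePoints n r).Subsingleton :=
  subsingleton_singleton.anti (conePoints_subset hn hr h1)

theorem exists_mem_lines (hn : 2 ≤ n) (hr : 0 < r) (h1 : OneVertex n r) {x : Surface n r}
    (hx : x ∉ conePoints n r) (u : ℂ) : ∃ L ∈ lines n r u, x ∈ L := by
  have := compactSpace_surface (by omega : n ≠ 0) r
  have := t2Space_surface hn hr h1
  rw [lines_eq_leaves]
  exact exists_mem_leaves (isTranslationAtlas_flatCharts hn hr h1)
    (conePoints_subsingleton hn hr h1) hx u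

theorem singularPoints_lines_subset (hn : 2 ≤ n) (hr : 0 < r) (h1 : OneVertex n r) (hu : u ≠ 0) :
    singularPoints (lines n r u) ⊆ conePoints n r := by
  have := compactSpace_surface (by omega : n ≠ 0) r
  have := t2Space_surface hn hr h1
  rw [lines_eq_leaves]
  intro x hx
  by_contra hxc
  exact hx (isRegularPoint_leaves (isTranslationAtlas_flatCharts hn hr h1)
    (conePoints_subsingleton hn hr h1) hu hxc)

theorem isStraight_toSurface (hn : 2 ≤ n) (hr : 0 < r) (h1 : OneVertex n r) {z : ℂ} {I : Set ℝ}
    (hI : IsOpen I) (h : ∀ t ∈ I, z + t * u ∈ openPolygon n r) :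
    IsStraight (flatCharts n r) u (fun t => toSurface n r (z + t * u)) I := by
  intro t ht
  have hpolygon := fun s hs => openPolygon_subset_polygon hn hr (h s hs)
  obtain ⟨φ, hφ, hx⟩ := exists_flatChart_interior hn hr h1 (h t ht)
  have hlim := tendsto_add_mul_nhdsWithin le_rfl (eventually_of_mem (hI.mem_nhds ht) hpolygon)
  refine ⟨φ, hφ, hx, ?_⟩
  filter_upwards [hlim.eventually (hφ.eventually_toSurface (hpolygon t ht) hx)] with s hs
  refine ⟨hs.1, hs.2.trans ?_⟩
  push_cast
  ring

theorem tendsto_toSurface_corner_ray (hn : 2 ≤ n) (hr : 0 < r) (h1 : OneVertex n r) {k : ℤ}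
    {ε : ℝ} (hε : 0 < ε) (h : ∀ t ∈ Ioo (0 : ℝ) ε, corner n r k + t * u ∈ openPolygon n r) :
    Tendsto (fun t : ℝ => toSurface n r (corner n r k + t * u)) (𝓝[>] 0)
      (𝓝 (vertexPoint n r 0)) := by
  have hn' : n ≠ 0 := by omega
  rw [← toSurface_corner hn' h1 k]
  exact (continuousOn_toSurface n r _ (corner_mem_polygon hn' k)).tendsto.comp
    (tendsto_corner_ray hn hr hε h)

theorem exists_lines_ne (hn : 4 ≤ n) (hr : 0 < r) (h1 : OneVertex n r) (hu : u ≠ 0) :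
    ∃ L ∈ lines n r u, ∃ L' ∈ lines n r u, L ≠ L' ∧ vertexPoint n r 0 ∈ L ∩ L' := by
  have hn2 : 2 ≤ n := by omega
  have := compactSpace_surface (by omega : n ≠ 0) r
  have := t2Space_surface hn2 hr h1
  have hp : vertexPoint n r 0 ∈ conePoints n r := (conePoints_eq_singleton hn hr h1).superset rfl
  obtain ⟨k, l, hkl, ε, hε, hrays⟩ := exists_two_rays hn hr hu
  have hk : ∀ t ∈ Ioo (0 : ℝ) ε, corner n r k + t * u ∈ openPolygon n r :=
    fun t ht => (hrays t ht).1
  have hl : ∀ t ∈ Ioo (0 : ℝ) ε, corner n r l + t * u ∈ openPolygon n r :=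
    fun t ht => (hrays t ht).2
  rw [lines_eq_leaves]
  exact exists_leaves_ne_of_rays (isTranslationAtlas_flatCharts hn2 hr h1)
    (conePoints_subsingleton hn2 hr h1) hp hε
    (isStraight_toSurface hn2 hr h1 isOpen_Ioo hk) (tendsto_toSurface_corner_ray hn2 hr h1 hε hk)
    (isStraight_toSurface hn2 hr h1 isOpen_Ioo hl) (tendsto_toSurface_corner_ray hn2 hr h1 hε hl)
    fun t ht => toSurface_ray_ne hn2 hr h1 hkl (hk t ht) (hl t ht)

theorem mem_singularPoints_of_mem_inter {S : Type*} [TopologicalSpace S] {F : Set (Set S)}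
    {L L' : Set S} (hL : L ∈ F) (hL' : L' ∈ F) (hne : L ≠ L') {x : S} (hx : x ∈ L ∩ L') :
    x ∈ singularPoints F := by
  rintro ⟨φ, hxφ, -, hunique, -⟩
  exact hne ((hunique x hxφ).unique ⟨hL, hx.1⟩ ⟨hL', hx.2⟩)

theorem four_le_of_mem_conePoints (hn : 2 ≤ n) (hr : 0 < r) (h1 : OneVertex n r) {x : Surface n r}
    (hx : x ∈ conePoints n r) : 4 ≤ n := by
  obtain ⟨m, hm⟩ := even_of_oneVertex hn hr h1
  by_contra hlt
  obtain rfl : n = 2 := by omega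
  rwa [conePoints_two_eq_empty hr h1] at hx

theorem singularPoints_lines_eq_conePoints (hn : 2 ≤ n) (hr : 0 < r) (h1 : OneVertex n r)
    (hu : u ≠ 0) : singularPoints (lines n r u) = conePoints n r := by
  refine (singularPoints_lines_subset hn hr h1 hu).antisymm fun x hx => ?_
  obtain ⟨L, hL, L', hL', hne, hp⟩ :=
    exists_lines_ne (four_le_of_mem_conePoints hn hr h1 hx) hr h1 hu
  exact mem_singularPoints_of_mem_inter hL hL' hne (conePoints_subset hn hr h1 hx ▸ hp)

theorem sUnion_lines (hn : 2 ≤ n) (hr : 0 < r) (h1 : OneVertex n r) (hu : u ≠ 0) :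
    ⋃₀ lines n r u = univ := by
  refine eq_univ_of_forall fun x => ?_
  by_cases hx : x ∈ conePoints n r
  · obtain ⟨L, hL, _, _, _, hp⟩ :=
      exists_lines_ne (four_le_of_mem_conePoints hn hr h1 hx) hr h1 hu
    exact ⟨L, hL, conePoints_subset hn hr h1 hx ▸ hp.1⟩
  · exact exists_mem_lines hn hr h1 hx u

end Foliation

end PolygonSurface

end

theorem theorem2 (r : ℝ) (hr : 0 < r) :
    (∀ g : ℕ, 1 ≤ g → PolygonSurface.OneVertex (2 * g) r ∧
      PolygonSurface.eulerChar (2 * g) r = 2 - 2 * (g : ℤ)) ∧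
    ∀ n : ℕ, 2 ≤ n → PolygonSurface.OneVertex n r →
      PolygonSurface.IsClosedOrientableSurface (PolygonSurface.Surface n r) ∧
      ∃ g : ℕ, 1 ≤ g ∧ PolygonSurface.eulerChar n r = 2 - 2 * (g : ℤ) ∧
        (1 < g → PolygonSurface.conePoints n r = {PolygonSurface.vertexPoint n r 0}) ∧
        (g = 1 → PolygonSurface.conePoints n r = ∅) ∧
        ∀ u : ℂ, u ≠ 0 →
          ⋃₀ PolygonSurface.lines n r u = Set.univ ∧
          (1 < g →
            PolygonSurface.singularPoints (PolygonSurface.lines n r u) =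
                {PolygonSurface.vertexPoint n r 0} ∧
            ∃ L ∈ PolygonSurface.lines n r u, ∃ L' ∈ PolygonSurface.lines n r u,
              L ≠ L' ∧ PolygonSurface.vertexPoint n r 0 ∈ L ∩ L') ∧
          (g = 1 → PolygonSurface.singularPoints (PolygonSurface.lines n r u) = ∅) := by
  open PolygonSurface in
  refine ⟨fun g hg => ?_, fun n hn h1 => ?_⟩
  · have h1 : OneVertex (2 * g) r := oneVertex_of_even (by omega) (even_two_mul g) r
    refine ⟨h1, ?_⟩
    rw [eulerChar_eq (by omega) hr h1]
    push_cast
    rfl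
  · obtain ⟨g, rfl⟩ := even_of_oneVertex hn hr h1
    have hcone (h : 1 < g) : conePoints (g + g) r = {vertexPoint (g + g) r 0} :=
      conePoints_eq_singleton (by omega) hr h1
    have hempty (h : g = 1) : conePoints (g + g) r = ∅ := by
      subst h
      exact conePoints_two_eq_empty hr h1
    refine ⟨isClosedOrientableSurface_surface hn hr h1, g, by omega, ?_, hcone, hempty,
      fun u hu => ⟨sUnion_lines hn hr h1 hu, ?_⟩⟩
    · rw [eulerChar_eq hn hr h1]
      push_cast
      ring
    · rw [singularPoints_lines_eq_conePoints hn hr h1 hu]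
      exact ⟨fun h => ⟨hcone h, exists_lines_ne (by omega) hr h1 hu⟩, hempty⟩
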